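/- Let $k,n\ge 0$ be integers with $k\le n-4$. **Decorated permutations and cells.** A decorated permutation of $[n]$ is a permutation with each fixed point coloured black or white. Let $\mathrm{Gr}_{k,n}^{\ge 0}$ be the set of $k$-dimensional subspaces $V\subseteq\mathbb{R}^n$ that are row spans of $k\times n$ matrices with nonnegative maximal minors. For $V\in\mathrm{Gr}_{k,n}^{\ge0}$ let $I_r(V)$ be the lexicographically minimal $I\in\binom{[n]}{k}$ with $\Delta_I(V)\ne0$, for the order $r<r+1<\dots<n<1<\dots<r-1$. The decorated permutation $\pi$ of $V$ is given by $I_{i+1}=(I_i\setminus\{i\})\cup\{\pi(i)\}$ if $i\in I_i$ (the fixed point being white if $\pi(i)=i$), while $i$ is a black fixed point if $i\notin I_i$ (indices mod $n$). The positroid cell $S_\pi$ is the set of $V\in\mathrm{Gr}_{k,n}^{\ge0}$ with decorated permutation $\pi$. **$\oplus$-diagrams.** A $\oplus$-diagram $D$ of type $(k,n)$ is a filling by $0$ and $+$ of a Young diagram inside a $k\times(n-k)$ rectangle. Label the $n$ steps of its southeast border, read from the northeast to the southwest corner of the rectangle, by $1,\dots,n$, and give each edge of the northwest border the label of the opposite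 edge. Pipes start at the southeast border and run west or north. At a $0$ they go straight; at a $+$ a pipe entering from the east turns north and one entering from the south turns west. Put $\pi_D(i)=j$ if the pipe starting at $i$ ends at $j$; a fixed point is black if it labels horizontal edges and white if it labels vertical edges. Put $S_D:=S_{\pi_D}\subseteq \mathrm{Gr}_{k,n}^{\ge0}$. **The diagrams $\mathcal D_{n,k,4}$.** Let $W_U,W_L$ be lattice paths with unit west and south steps from the northeast to the southwest corner of a $k\times(n-k-4)$ rectangle, with $W_L$ weakly below $W_U$, and let $Y_U,Y_L$ be the Young diagrams in the rectangle with southeast borders $W_U,W_L$. Let $\Omega_{LD}(W_U,W_L)$ be the following $\oplus$-diagram of type $(k,n)$. 1. Its shape is $Y_L$ with $4$ columns of height $k$ added at the left. Put a $+$ at both ends of each row. 2. For each column of $Y_U$, from left to right, of height $i$ say, place a top-justified column of $i$ zeros, in empty boxes of a single column, as far right as possible. 3. In each row, put a $+$ in the two rightmost empty boxes. 4. Fill the remaining boxes with $0$. Let $\mathcal D_{n,k,4}$ be the set of all these diagrams. **BCFW cells.** Plabic graphs are planar graphs in a disk with boundary vertices $1,\dots,n$ of degree one, in clockwise order, and internal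 vertices coloured black or white. The trip permutation $\pi_G$ of $G$ sends $i$ to the end of the path that starts at $i$ and turns maximally right at black and maximally left at white vertices. To blow up $G$ at a boundary vertex $i$ whose neighbour $v$ is internal of degree $3$, with edges to $i$, $e$, $f$ in clockwise order, replace $v$ by a square with vertices $a,b,c,d$ in clockwise order, where $a,c$ are black and $b,d$ are white, $a$ is incident to $e$, $b$ to $f$, $c$ is joined to boundary vertex $i$, and $d$ is joined to a new boundary vertex $i+1$ (the old labels $i+1,\dots,n$ increase by one). Define $\tilde{\mathcal G}_{n,k,4}$ recursively as follows. $\tilde{\mathcal G}_{4,2,4}$ consists of the square with vertices $v_1,v_2,v_3,v_4$ in clockwise order, coloured white, black, white, black, with $v_i$ joined to the boundary vertex $i$; the sets $\tilde{\mathcal G}_{4,k,4}$ with $k\neq 2$ are empty. For $n\ge5$, $\tilde{\mathcal G}_{n,k,4}$ consists of the blowups at some $i\ne1,n-1$ of graphs in $\tilde{\mathcal G}_{n-1,k,4}$ if $i$ is adjacent to a black vertex, and of graphs in $\tilde{\mathcal G}_{n-1,k-1,4}$ if $i$ is adjacent to a white vertex. With $c_n=(n\ n{-}1\ \cdots\ 2\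 1)$, put $\Pi_{n,k,4}=\{c_n^2\pi_G: G\in\tilde{\mathcal G}_{n,k+2,4}\}$, all fixed points of $c_n^2\pi_G$ being coloured black. The $(k,n)$-BCFW cells are the elements of $\mathcal C_{n,k,4}=\{S_\pi:\pi\in\Pi_{n,k,4}\}$. **Theorem.** The map $D\mapsto S_D$ is a bijection from $\mathcal D_{n,k,4}$ to the set $\mathcal C_{n,k,4}$ of $(k,n)$-BCFW cells, and the map $D\mapsto\pi_D$ is a bijection from $\mathcal D_{n,k,4}$ to $\Pi_{n,k,4}$. -/

import Mathlib

namespace BCFW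

/-! ### Decorated permutations -/

/-- A decorated permutation of `{1, …, n}` (written `0, …, n - 1` here): a permutation together
with the set of its white fixed points; the remaining fixed points are black. -/
@[ext] structure DecPerm (n : ℕ) where
  perm : Equiv.Perm (Fin n)
  white : Set (Fin n)
  white_fixed : ∀ i ∈ white, perm i = i

/-- A permutation with all of its fixed points coloured black. -/
def DecPerm.allBlack {n : ℕ} (p : Equiv.Perm (Fin n)) : DecPerm n where
  perm := p
  white := ∅
  white_fixed := by simp

/-! ### Positroid cells -/

/-- A point `V` of the totally nonnegative Grassmannian `Gr_{k,n}^{≥ 0}`: a `k`-dimensional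
subspace of `ℝⁿ` which is the row span of a `k × n` matrix with nonnegative maximal minors. -/
def IsTotallyNonneg (k : ℕ) {n : ℕ} (V : Submodule ℝ (Fin n → ℝ)) : Prop :=
  Module.finrank ℝ V = k ∧
    ∃ A : Matrix (Fin k) (Fin n) ℝ, Submodule.span ℝ (Set.range A) = V ∧
      ∀ f : Fin k ↪o Fin n, 0 ≤ (A.submatrix id f).det

/-- The `j`-th column of `V`, i.e. the `j`-th coordinate function on `V`. The linear relations
between these are those between the columns of any matrix with row span `V`. -/
def column {n : ℕ} (V : Submodule ℝ (Fin n → ℝ)) (j : Fin n) : V →ₗ[ℝ] ℝ :=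
  (LinearMap.proj j : (Fin n → ℝ) →ₗ[ℝ] ℝ).domRestrict V

/-- The `r`-th term `I_r` of the Grassmann necklace of `V`: the lexicographically minimal set `I`
with `Δ_I(V) ≠ 0` for the order `r < r + 1 < ⋯ < n < 1 < ⋯ < r - 1`. It consists of the `j` such
that the `j`-th column is not in the span of the columns `r, r + 1, …, j - 1` (cyclically). -/
def necklace {n : ℕ} (V : Submodule ℝ (Fin n → ℝ)) (r : Fin n) : Set (Fin n) :=
  {j | column V j ∉ Submodule.span ℝ (column V '' {l | l - r < j - r})}

/-- `V` has decorated permutation `π`: `I_{i+1} = (I_i \ {i}) ∪ {π(i)}` if `i ∈ I_i`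
(and a fixed point `i` is then white), whereas `I_{i+1} = I_i` and `i` is a black fixed point
if `i ∉ I_i`. -/
def HasDecPerm {n : ℕ} (V : Submodule ℝ (Fin n → ℝ)) (π : DecPerm n) : Prop :=
  ∀ i : Fin n,
    (i ∈ necklace V i ∧ necklace V (finRotate n i) = insert (π.perm i) (necklace V i \ {i}) ∧
      (π.perm i = i → i ∈ π.white)) ∨
    (i ∉ necklace V i ∧ necklace V (finRotate n i) = necklace V i ∧
      π.perm i = i ∧ i ∉ π.white)

/-- The positroid cell `S_π` of `Gr_{k,n}^{≥ 0}` labelled by the decorated permutation `π`. -/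
def positroidCell (k : ℕ) {n : ℕ} (π : DecPerm n) : Set (Submodule ℝ (Fin n → ℝ)) :=
  {V | IsTotallyNonneg k V ∧ HasDecPerm V π}

/-! ### `⊕`-diagrams and their decorated permutations -/

/-- A `⊕`-diagram of type `(k, n)`: a Young diagram inside a `k × (n - k)` rectangle, with the
set of its boxes that contain a `+` (the other ones contain a `0`). The box in row `i` and column
`j`, counted from the top left corner and from `0`, is `(i, j)`. -/
@[ext] structure OplusDiagram (k n : ℕ) where
  shape : YoungDiagram
  plus : Finset (ℕ × ℕ)
  k_le_n : k ≤ n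
  rowLen_le : ∀ i, shape.rowLen i ≤ n - k
  colLen_le : ∀ j, shape.colLen j ≤ k
  plus_subset : plus ⊆ shape.cells

mutual

/-- Follow the pipe that runs west across the left end of box `(i, j)`, i.e. in row `i` with `j`
boxes to its left, to the northwest border. A box with a `0` is a cross; a box with a `+` is an
elbow, in which a pipe coming from the east turns north and one from the south turns west.
The result is `inl i'` (`inr j'`) if the pipe ends at the left of row `i'` (top of column `j'`). -/
def exitWest (plus : Finset (ℕ × ℕ)) : ℕ → ℕ → ℕ ⊕ ℕ
  | i, 0 => Sum.inl i
  | i, j + 1 => if (i, j) ∈ plus then exitNorth plus i j else exitWest plus i j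
termination_by i j => i + j

/-- Follow the pipe that runs north in column `j` with `i` boxes above it. -/
def exitNorth (plus : Finset (ℕ × ℕ)) : ℕ → ℕ → ℕ ⊕ ℕ
  | 0, j => Sum.inr j
  | i + 1, j => if (i, j) ∈ plus then exitWest plus i j else exitNorth plus i j
termination_by i j => i + j

end

/-- Positions of a pipe, as used by `exitWest` and `exitNorth`. -/
inductive PipePos
  | west (i j : ℕ)
  | north (i j : ℕ)

/-- Where the pipe through a given position ends. -/
def PipePos.exit (plus : Finset (ℕ × ℕ)) : PipePos → ℕ ⊕ ℕ
  | west i j => exitWest plus i j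
  | north i j => exitNorth plus i j

/-- A single step of a pipe through a box of the shape. -/
inductive PipeStep (μ : YoungDiagram) (plus : Finset (ℕ × ℕ)) : PipePos → PipePos → Prop
  | ww {i j : ℕ} : (i, j) ∈ μ → (i, j) ∉ plus → PipeStep μ plus (.west i (j + 1)) (.west i j)
  | wn {i j : ℕ} : (i, j) ∈ μ → (i, j) ∈ plus → PipeStep μ plus (.west i (j + 1)) (.north i j)
  | nw {i j : ℕ} : (i, j) ∈ μ → (i, j) ∈ plus → PipeStep μ plus (.north (i + 1) j) (.west i j)
  | nn {i j : ℕ} : (i, j) ∈ μ → (i, j) ∉ plus → PipeStep μ plus (.north (i + 1) j) (.north i j)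

theorem PipeStep.inj {μ : YoungDiagram} {plus : Finset (ℕ × ℕ)} {s s' t : PipePos}
    (h : PipeStep μ plus s t) (h' : PipeStep μ plus s' t) : s = s' := by
  cases h <;> cases h' <;> first | rfl | contradiction

/-- The size of a position; it drops by one in every step. -/
def PipePos.size : PipePos → ℕ
  | west i j => i + j
  | north i j => i + j

/-- The positions inside a shape. -/
def PipePos.Inside (μ : YoungDiagram) : PipePos → Prop
  | west i j => j ≤ μ.rowLen i
  | north i j => i ≤ μ.colLen j

theorem PipePos.step_or_end (μ : YoungDiagram) (plus : Finset (ℕ × ℕ)) (s : PipePos)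
    (hs : s.Inside μ) :
    ((∃ i, s = .west i 0) ∨ (∃ j, s = .north 0 j)) ∨
      ∃ t, PipeStep μ plus s t ∧ t.Inside μ ∧ t.exit plus = s.exit plus ∧ t.size < s.size := by
  rcases s with ⟨i, _ | j⟩ | ⟨_ | i, j⟩
  · exact Or.inl (Or.inl ⟨i, rfl⟩)
  · right
    have hm : (i, j) ∈ μ := YoungDiagram.mem_iff_lt_rowLen.2 (by simp only [Inside] at hs; omega)
    have h1 := YoungDiagram.mem_iff_lt_rowLen.1 hm
    have h2 := YoungDiagram.mem_iff_lt_colLen.1 hm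
    by_cases hp : (i, j) ∈ plus
    · exact ⟨.north i j, .wn hm hp, h2.le, by simp [exit, exitWest, hp], by simp [size]⟩
    · exact ⟨.west i j, .ww hm hp, h1.le, by simp [exit, exitWest, hp], by simp [size]⟩
  · exact Or.inl (Or.inr ⟨j, rfl⟩)
  · right
    have hm : (i, j) ∈ μ := YoungDiagram.mem_iff_lt_colLen.2 (by simp only [Inside] at hs; omega)
    have h1 := YoungDiagram.mem_iff_lt_rowLen.1 hm
    have h2 := YoungDiagram.mem_iff_lt_colLen.1 hm
    by_cases hp : (i, j) ∈ plus
    · exact ⟨.west i j, .nw hm hp, h1.le, by simp [exit, exitNorth, hp], by simp [size]⟩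
    · exact ⟨.north i j, .nn hm hp, h2.le, by simp [exit, exitNorth, hp], by simp [size]⟩

theorem PipePos.connected (μ : YoungDiagram) (plus : Finset (ℕ × ℕ)) :
    ∀ (N : ℕ) (s t : PipePos), s.size + t.size ≤ N → s.Inside μ → t.Inside μ →
      s.exit plus = t.exit plus →
      Relation.ReflTransGen (PipeStep μ plus) s t ∨ Relation.ReflTransGen (PipeStep μ plus) t s := by
  intro N
  induction N using Nat.strong_induction_on with
  | _ N ih =>
    -- a step out of the first position reduces the claim to smaller positions
    have key : ∀ s s' t : PipePos, s.size + t.size ≤ N → t.Inside μ → PipeStep μ plus s s' →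
        s'.Inside μ → s'.size < s.size → s'.exit plus = t.exit plus →
        Relation.ReflTransGen (PipeStep μ plus) s t ∨
          Relation.ReflTransGen (PipeStep μ plus) t s := by
      intro s s' t hN ht hst hs' hlt he
      rcases ih (s'.size + t.size) (by omega) s' t le_rfl hs' ht he with h | h
      · exact Or.inl (h.head hst)
      · rcases Relation.ReflTransGen.cases_tail h with h | ⟨p, hp, hps⟩
        · subst h
          exact Or.inl (Relation.ReflTransGen.single hst)
        · rw [hps.inj hst] at hp
          exact Or.inr hp
    intro s t hN hs ht he
    rcases s.step_or_end μ plus hs with hse | ⟨s', h1, h2, h3, h4⟩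
    · rcases t.step_or_end μ plus ht with hte | ⟨t', h1, h2, h3, h4⟩
      · left
        rcases hse with ⟨i, rfl⟩ | ⟨j, rfl⟩ <;> rcases hte with ⟨i', rfl⟩ | ⟨j', rfl⟩ <;>
          simp [exit, exitWest, exitNorth] at he <;> subst he <;> exact .refl
      · exact (key t t' s (by omega) hs h1 h2 h4 (h3.trans he.symm)).symm
    · exact key s s' t hN ht h1 h2 h4 (h3.trans he)

theorem exit_bounds (plus : Finset (ℕ × ℕ)) : ∀ (N i j : ℕ), i + j = N →
    ((∀ a, exitWest plus i j = Sum.inl a → a ≤ i) ∧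
      (∀ b, exitWest plus i j = Sum.inr b → b < j)) ∧
    ((∀ a, exitNorth plus i j = Sum.inl a → a < i) ∧
      (∀ b, exitNorth plus i j = Sum.inr b → b ≤ j)) := by
  intro N
  induction N using Nat.strong_induction_on with
  | _ N ih =>
    intro i j hN
    constructor
    · rcases j with _ | j
      · simp [exitWest]
      · obtain ⟨⟨h1, h2⟩, h3, h4⟩ := ih (i + j) (by omega) i j rfl
        by_cases hp : (i, j) ∈ plus <;> simp only [exitWest, hp, if_true, if_false]
        · exact ⟨fun a h => (h3 a h).le, fun b h => by have := h4 b h; omega⟩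
        · exact ⟨h1, fun b h => by have := h2 b h; omega⟩
    · rcases i with _ | i
      · simp [exitNorth]
      · obtain ⟨⟨h1, h2⟩, h3, h4⟩ := ih (i + j) (by omega) i j rfl
        by_cases hp : (i, j) ∈ plus <;> simp only [exitNorth, hp, if_true, if_false]
        · exact ⟨fun a h => by have := h1 a h; omega, fun b h => (h2 b h).le⟩
        · exact ⟨fun a h => by have := h3 a h; omega, h4⟩

namespace OplusDiagram

variable {k n : ℕ} (D : OplusDiagram k n)

/-- The position at which the pipe enters through an edge of the southeast border: the vertical
edge of a row (`inl`) or the horizontal edge of a column (`inr`). -/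
def start : Fin k ⊕ Fin (n - k) → PipePos
  | Sum.inl i => .west i (D.shape.rowLen i)
  | Sum.inr j => .north (D.shape.colLen j) j

/-- The label of an edge of the southeast border, and of the opposite edge on the northwest
border, minus one: the number of steps that precede it on the path from the northeast to
the southwest corner of the `k × (n - k)` rectangle. -/
def labelNat : Fin k ⊕ Fin (n - k) → ℕ
  | Sum.inl i => i + (n - k - D.shape.rowLen i)
  | Sum.inr j => (n - k - 1 - j) + D.shape.colLen j

theorem labelNat_lt (e : Fin k ⊕ Fin (n - k)) : D.labelNat e < n := by
  have := D.k_le_n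
  rcases e with i | j
  · have := i.2
    simp only [labelNat]
    omega
  · have := j.2
    have := D.colLen_le j
    simp only [labelNat]
    omega

/-- The label of an edge, in `Fin n`. -/
def label (e : Fin k ⊕ Fin (n - k)) : Fin n := ⟨D.labelNat e, D.labelNat_lt e⟩

theorem label_bijective : Function.Bijective D.label := by
  have hk := D.k_le_n
  have mixed : ∀ (i : Fin k) (j : Fin (n - k)), D.labelNat (Sum.inl i) ≠ D.labelNat (Sum.inr j) := by
    intro i j h
    simp only [labelNat] at h
    have h1 := D.rowLen_le i
    have h2 := j.2
    by_cases hm : ((i : ℕ), (j : ℕ)) ∈ D.shape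
    · have h3 := YoungDiagram.mem_iff_lt_rowLen.1 hm
      have h4 := YoungDiagram.mem_iff_lt_colLen.1 hm
      omega
    · have h3 := mt YoungDiagram.mem_iff_lt_rowLen.2 hm
      have h4 := mt YoungDiagram.mem_iff_lt_colLen.2 hm
      omega
  rw [Fintype.bijective_iff_injective_and_card]
  refine ⟨?_, by simp; omega⟩
  intro e e' h
  have h : D.labelNat e = D.labelNat e' := congrArg Fin.val h
  rcases e with i | j <;> rcases e' with i' | j'
  · simp only [labelNat] at h
    congr 1
    apply Fin.ext
    have a1 := D.rowLen_le i
    have a2 := D.rowLen_le i'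
    rcases lt_trichotomy (i : ℕ) i' with hl | hl | hl
    · have := D.shape.rowLen_anti i i' hl.le
      omega
    · exact hl
    · have := D.shape.rowLen_anti i' i hl.le
      omega
  · exact absurd h (mixed i j')
  · exact absurd h.symm (mixed i' j)
  · simp only [labelNat] at h
    congr 1
    apply Fin.ext
    have a1 := j.2
    have a2 := j'.2
    rcases lt_trichotomy (j : ℕ) j' with hl | hl | hl
    · have := D.shape.colLen_anti j j' hl.le
      omega
    · exact hl
    · have := D.shape.colLen_anti j' j hl.le
      omega

theorem start_inside (e : Fin k ⊕ Fin (n - k)) : (D.start e).Inside D.shape := by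
  rcases e with i | j <;> exact le_rfl

theorem exit_lt (e : Fin k ⊕ Fin (n - k)) :
    (∀ a, (D.start e).exit D.plus = Sum.inl a → a < k) ∧
      (∀ b, (D.start e).exit D.plus = Sum.inr b → b < n - k) := by
  rcases e with i | j
  · obtain ⟨⟨h1, h2⟩, -⟩ := exit_bounds D.plus _ i (D.shape.rowLen i) rfl
    exact ⟨fun a h => (h1 a h).trans_lt i.2, fun b h => (h2 b h).trans_le (D.rowLen_le i)⟩
  · obtain ⟨-, h1, h2⟩ := exit_bounds D.plus _ (D.shape.colLen j) j rfl
    exact ⟨fun a h => (h1 a h).trans_le (D.colLen_le j), fun b h => (h2 b h).trans_lt j.2⟩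

/-- The edge of the northwest border at which the pipe that starts at a given edge of the
southeast border ends; opposite edges are identified. -/
def pipe (e : Fin k ⊕ Fin (n - k)) : Fin k ⊕ Fin (n - k) :=
  match h : (D.start e).exit D.plus with
  | Sum.inl a => Sum.inl ⟨a, (D.exit_lt e).1 a h⟩
  | Sum.inr b => Sum.inr ⟨b, (D.exit_lt e).2 b h⟩

theorem pipe_val (e : Fin k ⊕ Fin (n - k)) :
    Sum.map Fin.val Fin.val (D.pipe e) = (D.start e).exit D.plus := by
  unfold pipe
  split <;> simp_all

theorem no_step_to_start (s : PipePos) (e : Fin k ⊕ Fin (n - k)) :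
    ¬ PipeStep D.shape D.plus s (D.start e) := by
  have h1 : ∀ i, (i, D.shape.rowLen i) ∉ D.shape := fun i h =>
    lt_irrefl _ (YoungDiagram.mem_iff_lt_rowLen.1 h)
  have h2 : ∀ j, (D.shape.colLen j, j) ∉ D.shape := fun j h =>
    lt_irrefl _ (YoungDiagram.mem_iff_lt_colLen.1 h)
  intro h
  rcases e with i | j
  · cases h with
    | ww hm _ => exact h1 _ hm
    | nw hm _ => exact h1 _ hm
  · cases h with
    | wn hm _ => exact h2 _ hm
    | nn hm _ => exact h2 _ hm

theorem start_injective : Function.Injective D.start := by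
  intro e e' h
  rcases e with i | j <;> rcases e' with i' | j' <;> simp [start] at h
  · rw [Fin.ext h.1]
  · rw [Fin.ext h.2]

theorem pipe_bijective : Function.Bijective D.pipe := by
  rw [← Finite.injective_iff_bijective]
  intro e e' h
  have h : (D.start e).exit D.plus = (D.start e').exit D.plus := by
    rw [← pipe_val, ← pipe_val, h]
  apply D.start_injective
  rcases PipePos.connected D.shape D.plus _ _ _ le_rfl (D.start_inside e) (D.start_inside e') h
    with h | h
  · rcases Relation.ReflTransGen.cases_tail h with h | ⟨p, -, hp⟩
    · exact h.symm
    · exact absurd hp (D.no_step_to_start _ _)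
  · rcases Relation.ReflTransGen.cases_tail h with h | ⟨p, -, hp⟩
    · exact h
    · exact absurd hp (D.no_step_to_start _ _)

/-- The decorated permutation `π_D`: if the pipe starting at the edge labelled `i` ends at the edge
labelled `j`, then `π_D(i) = j`; a fixed point is white if it labels vertical edges,
and black if it labels horizontal ones. -/
noncomputable def decPerm : DecPerm n where
  perm := (Equiv.ofBijective D.label D.label_bijective).symm.trans
    ((Equiv.ofBijective D.pipe D.pipe_bijective).trans
      (Equiv.ofBijective D.label D.label_bijective))
  white := {i | ∃ r : Fin k, i = D.label (Sum.inl r) ∧ D.pipe (Sum.inl r) = Sum.inl r}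
  white_fixed := by
    rintro _ ⟨r, rfl, hr⟩
    have h : (Equiv.ofBijective D.label D.label_bijective).symm (D.label (Sum.inl r)) = Sum.inl r :=
      Equiv.ofBijective_symm_apply_apply _ D.label_bijective _
    simp [h, hr]

/-- The positroid cell `S_D = S_{π_D}` of `Gr_{k,n}^{≥ 0}`. -/
noncomputable def cell : Set (Submodule ℝ (Fin n → ℝ)) := positroidCell k D.decPerm

end OplusDiagram

/-! ### Lattice paths and the `⊕`-diagrams built from them -/

/-- The steps of a lattice path: one unit to the west (`H`) or to the south (`V`). -/
inductive Letter
  | H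
  | V
  deriving DecidableEq

/-- A lattice path inside an `a × b` rectangle, from the northeast to the southwest corner. -/
structure LatticePath (a b : ℕ) where
  word : List Letter
  count_V : word.count Letter.V = a
  count_H : word.count Letter.H = b

/-- `L` is weakly below `U`. -/
def Noncrossing {a b : ℕ} (U L : LatticePath a b) : Prop :=
  ∀ i ≤ a + b, (U.word.take i).count Letter.V ≤ (L.word.take i).count Letter.V

/-- The row lengths, from top to bottom, of the Young diagram with southeast border a given word:
the row to the left of a vertical step has one box for each horizontal step after it. -/
def rowLengths : List Letter → List ℕ
  | [] => []
  | Letter.V :: w => w.count Letter.H :: rowLengths w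
  | Letter.H :: w => rowLengths w

theorem rowLengths_le (w : List Letter) : ∀ x ∈ rowLengths w, x ≤ w.count Letter.H := by
  induction w with
  | nil => simp [rowLengths]
  | cons a w ih =>
    cases a
    · intro x hx
      have := ih x hx
      simp
      omega
    · intro x hx
      simp only [rowLengths, List.mem_cons] at hx
      rcases hx with rfl | hx
      · simp
      · have := ih x hx
        simp
        omega

theorem rowLengths_length (w : List Letter) : (rowLengths w).length = w.count Letter.V := by
  induction w with
  | nil => simp [rowLengths]
  | cons a w ih => cases a <;> simp [rowLengths, ih]

theorem rowLengths_sorted (m : ℕ) (w : List Letter) :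
    ((rowLengths w).map (· + m)).SortedGE := by
  rw [List.sortedGE_iff_pairwise, List.pairwise_map]
  induction w with
  | nil => simp [rowLengths]
  | cons a w ih =>
    cases a
    · exact ih
    · simp only [rowLengths, List.pairwise_cons]
      exact ⟨fun x hx => by have := rowLengths_le w x hx; omega, ih⟩

/-- The Young diagram with southeast border `w`, with `m` columns of full height added at the
left. -/
def borderDiagram (m : ℕ) (w : List Letter) : YoungDiagram :=
  YoungDiagram.ofRowLens ((rowLengths w).map (· + m)) (rowLengths_sorted m w)

/-- Step 1: the boxes at the two ends of each row, which contain a `+`. -/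
def endBoxes (μ : YoungDiagram) : Finset (ℕ × ℕ) :=
  μ.cells.filter fun c => c.2 = 0 ∨ c.2 + 1 = μ.rowLen c.1

/-- Add a top-justified column of `h` zeros to the filled boxes, as far right as
possible: in the last column whose `h` top boxes exist and are all still empty. -/
def placeColumn (μ : YoungDiagram) (filled : Finset (ℕ × ℕ)) (h : ℕ) : Finset (ℕ × ℕ) :=
  let x := ((Finset.range (μ.rowLen 0)).filter fun x =>
    ∀ r < h, (r, x) ∈ μ.cells ∧ (r, x) ∉ filled).sup id
  filled ∪ (Finset.range h).image fun r => (r, x)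

/-- Steps 1 and 2: the boxes of `μ` which are filled after placing the columns of `ν`
from left to right. -/
def filledBoxes (μ ν : YoungDiagram) : Finset (ℕ × ℕ) :=
  ((List.range (ν.rowLen 0)).map ν.colLen).foldl (placeColumn μ) (endBoxes μ)

/-- Step 3: the two rightmost empty boxes of each row, which get a `+`. -/
def innerBoxes (μ ν : YoungDiagram) : Finset (ℕ × ℕ) :=
  let empty := μ.cells \ filledBoxes μ ν
  empty.filter fun c => (empty.filter fun c' => c'.1 = c.1 ∧ c.2 < c'.2).card < 2

/-- The map `Ω_{LD}` from pairs of lattice paths in a `k × (n - k - 4)` rectangle to `⊕`-diagrams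
of type `(k, n)`. -/
def omegaLD {k n : ℕ} (hkn : k + 4 ≤ n) (U L : LatticePath k (n - k - 4)) : OplusDiagram k n where
  shape := borderDiagram 4 L.word
  plus := endBoxes (borderDiagram 4 L.word) ∪
    innerBoxes (borderDiagram 4 L.word) (borderDiagram 0 U.word)
  k_le_n := by omega
  rowLen_le := by
    intro i
    by_contra hlt
    have hm : (i, n - k) ∈ borderDiagram 4 L.word :=
      YoungDiagram.mem_iff_lt_rowLen.2 (not_le.1 hlt)
    obtain ⟨h1, h2⟩ := YoungDiagram.mem_ofRowLens.1 hm
    have h3 := rowLengths_le L.word _ (List.getElem_mem (l := rowLengths L.word)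
      (by simpa using h1))
    have h4 := L.count_H
    simp only [List.getElem_map] at h2
    omega
  colLen_le := by
    intro j
    by_contra hlt
    have hm : (k, j) ∈ borderDiagram 4 L.word :=
      YoungDiagram.mem_iff_lt_colLen.2 (not_le.1 hlt)
    obtain ⟨h1, -⟩ := YoungDiagram.mem_ofRowLens.1 hm
    have h4 := L.count_V
    simp [rowLengths_length, h4] at h1
  plus_subset := by
    apply Finset.union_subset (Finset.filter_subset _ _)
    exact (Finset.filter_subset _ _).trans Finset.sdiff_subset

/-- The set `D_{n,k,4}` of `⊕`-diagrams obtained from pairs of noncrossing lattice paths. -/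
def latticeDiagrams {k n : ℕ} (hkn : k + 4 ≤ n) : Set (OplusDiagram k n) :=
  {D | ∃ U L : LatticePath k (n - k - 4), Noncrossing U L ∧ omegaLD hkn U L = D}

/-! ### Plabic graphs -/

/-- A graph with `n` boundary vertices drawn in a disk, up to homotopy, with each internal vertex
coloured white or black, encoded by its half-edges. `rot` sends a half-edge to the
next one clockwise at the same vertex, so that the vertices are the cycles of `rot`; `edge`
exchanges the two halves of an edge; `bd i` is the half-edge at the `i`-th boundary vertex, which
has degree one, the boundary vertices being numbered clockwise.
The only graphs used below arise from a plane drawing by local operations in the plane. -/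
structure PlabicGraph (n : ℕ) where
  Dart : Type
  decEq : DecidableEq Dart
  finite : Finite Dart
  edge : Dart → Dart
  edge_edge : Function.Involutive edge
  edge_ne : ∀ d, edge d ≠ d
  rot : Equiv.Perm Dart
  bd : Fin n → Dart
  bd_injective : Function.Injective bd
  rot_bd : ∀ i, rot (bd i) = bd i
  /-- Whether the vertex at a half-edge is white (irrelevant at boundary vertices). -/
  isWhite : Dart → Bool
  isWhite_rot : ∀ d, isWhite (rot d) = isWhite d

namespace PlabicGraph

attribute [instance] PlabicGraph.decEq PlabicGraph.finite

variable {n : ℕ} (G : PlabicGraph n)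

theorem isWhite_rot_symm (d : G.Dart) : G.isWhite (G.rot.symm d) = G.isWhite d := by
  rw [← G.isWhite_rot, Equiv.apply_symm_apply]

/-- Having reached a vertex through a half-edge, turn maximally left (to the next half-edge
clockwise) if the vertex is white, and maximally right if it is black. -/
def turn : Equiv.Perm G.Dart where
  toFun d := if G.isWhite d then G.rot d else G.rot.symm d
  invFun d := if G.isWhite d then G.rot.symm d else G.rot d
  left_inv d := by
    by_cases h : G.isWhite d <;> simp [h, G.isWhite_rot, G.isWhite_rot_symm]
  right_inv d := by
    by_cases h : G.isWhite d <;> simp [h, G.isWhite_rot, G.isWhite_rot_symm]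

/-- Traverse an edge from the given half-edge on, and turn at its other end. (At a boundary vertex
the new half-edge is the one through which it was reached.) -/
def walk : Equiv.Perm G.Dart := G.edge_edge.toPerm.trans G.turn

theorem exists_return (i : Fin n) : ∃ m : ℕ, ∃ j, (G.walk ^ (m + 1)) (G.bd i) = G.bd j := by
  have h : 0 < orderOf G.walk := orderOf_pos G.walk
  refine ⟨orderOf G.walk - 1, i, ?_⟩
  rw [Nat.sub_add_cancel h, pow_orderOf_eq_one]
  rfl

/-- One less than the number of edges of the path that starts at boundary vertex `i`. -/
def tripLength (i : Fin n) : ℕ := Nat.find (G.exists_return i)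

theorem exists_trip (i : Fin n) : ∃ j, (G.walk ^ (G.tripLength i + 1)) (G.bd i) = G.bd j :=
  Nat.find_spec (G.exists_return i)

/-- The boundary vertex at which the path that starts at boundary vertex `i` ends. -/
def tripEnd (i : Fin n) : Fin n :=
  Fin.find (fun j => (G.walk ^ (G.tripLength i + 1)) (G.bd i) = G.bd j) (G.exists_trip i)

theorem walk_trip (i : Fin n) :
    (G.walk ^ (G.tripLength i + 1)) (G.bd i) = G.bd (G.tripEnd i) :=
  Fin.find_spec (G.exists_trip i)

theorem tripEnd_bijective : Function.Bijective G.tripEnd := by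
  rw [← Finite.injective_iff_bijective]
  have key : ∀ i i' : Fin n, G.tripEnd i = G.tripEnd i' → G.tripLength i ≤ G.tripLength i' →
      i = i' := by
    intro i i' h hle
    have h1 := G.walk_trip i
    rw [h, ← G.walk_trip i'] at h1
    obtain ⟨m, hm⟩ := Nat.exists_eq_add_of_le hle
    rw [hm, show G.tripLength i + m + 1 = (G.tripLength i + 1) + m by omega,
      pow_add _ (G.tripLength i + 1) m, Equiv.Perm.mul_apply] at h1
    have h2 := (G.walk ^ (G.tripLength i + 1)).injective h1
    rcases m with _ | m
    · exact G.bd_injective h2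
    · exact absurd ⟨i, h2.symm⟩ (Nat.find_min (G.exists_return i') (m := m)
        (show m < G.tripLength i' by omega))
  intro i i' h
  rcases le_total (G.tripLength i) (G.tripLength i') with hle | hle
  · exact key i i' h hle
  · exact (key i' i h.symm hle).symm

/-- The permutation `π_G` (without the colours of its fixed points). -/
noncomputable def trip : Equiv.Perm (Fin n) := Equiv.ofBijective G.tripEnd G.tripEnd_bijective

/-- The half-edge opposite to boundary vertex `i`. It belongs to the vertex adjacent to `i`. -/
def port (i : Fin n) : G.Dart := G.edge (G.bd i)

/-- The vertex adjacent to boundary vertex `i` has degree `3` (so it is internal). -/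
def TrivalentAt (i : Fin n) : Prop :=
  G.rot (G.port i) ≠ G.port i ∧ G.rot (G.rot (G.rot (G.port i))) = G.port i

/-- The half-edges that are added when a vertex is blown up to a square. The square has the
vertices `a` (black, incident to `e`), `b` (white, incident to `f`), `c` (black, incident to `i`)
and `d` (white, incident to `i + 1`); `xy` is the half at `x` of the edge from `x` to `y`, `out`
is the half at `d` of the edge from `d` to the boundary vertex `i + 1`, and `new` is its other
half. -/
inductive SquareDart
  | ab | ad | ba | bc | cb | cd | da | dc | out | new
  deriving DecidableEq

open SquareDart in
instance : Finite SquareDart :=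
  Finite.of_surjective (![ab, ad, ba, bc, cb, cd, da, dc, out, new] : Fin 10 → SquareDart) (by
    intro x
    cases x
    exacts [⟨0, rfl⟩, ⟨1, rfl⟩, ⟨2, rfl⟩, ⟨3, rfl⟩, ⟨4, rfl⟩, ⟨5, rfl⟩, ⟨6, rfl⟩, ⟨7, rfl⟩,
      ⟨8, rfl⟩, ⟨9, rfl⟩])

open SquareDart in
/-- The other half of an edge. -/
def SquareDart.opp : SquareDart → SquareDart
  | ab => ba | ba => ab | bc => cb | cb => bc | cd => dc | dc => cd | da => ad | ad => da
  | out => new | new => out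

/-- Blow up `G` at the boundary vertex `i`, adjacent to a vertex `v` of degree `3`. The half-edges
at `v` are, clockwise, `p` (on the edge to `i`), `e` and `f`. They are distributed to the
vertices `c`, `a` and `b` of the new square, whose vertices are, clockwise, `a, b, c, d`. -/
def blowup (i : Fin n) (h : G.TrivalentAt i) : PlabicGraph (n + 1) where
  Dart := G.Dart ⊕ SquareDart
  decEq := inferInstance
  finite := inferInstance
  edge := Sum.map G.edge SquareDart.opp
  edge_edge := by
    rintro (x | x)
    · simp [G.edge_edge x]
    · cases x <;> rfl
  edge_ne := by
    rintro (x | x)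
    · simp [G.edge_ne x]
    · cases x <;> simp [SquareDart.opp]
  rot :=
    { toFun := fun x => match x with
        | .inl x =>
          if x = G.port i then .inr .cd
          else if x = G.rot (G.port i) then .inr .ab
          else if x = G.rot (G.rot (G.port i)) then .inr .bc
          else .inl (G.rot x)
        | .inr .cd => .inr .cb
        | .inr .cb => .inl (G.port i)
        | .inr .ab => .inr .ad
        | .inr .ad => .inl (G.rot (G.port i))
        | .inr .bc => .inr .ba
        | .inr .ba => .inl (G.rot (G.rot (G.port i)))
        | .inr .da => .inr .dc
        | .inr .dc => .inr .out
        | .inr .out => .inr .da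
        | .inr .new => .inr .new
      invFun := fun x => match x with
        | .inl x =>
          if x = G.port i then .inr .cb
          else if x = G.rot (G.port i) then .inr .ad
          else if x = G.rot (G.rot (G.port i)) then .inr .ba
          else .inl (G.rot.symm x)
        | .inr .cd => .inl (G.port i)
        | .inr .cb => .inr .cd
        | .inr .ab => .inl (G.rot (G.port i))
        | .inr .ad => .inr .ab
        | .inr .bc => .inl (G.rot (G.rot (G.port i)))
        | .inr .ba => .inr .bc
        | .inr .da => .inr .out
        | .inr .dc => .inr .da
        | .inr .out => .inr .dc
        | .inr .new => .inr .new
      left_inv := by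
        obtain ⟨h1, h2⟩ := h
        have h3 : G.rot (G.rot (G.port i)) ≠ G.port i := fun hc => h1 (by rw [hc] at h2; exact h2)
        rintro (x | x)
        · by_cases hx1 : x = G.port i
          · simp [hx1]
          by_cases hx2 : x = G.rot (G.port i)
          · simp [hx2, h1]
          by_cases hx3 : x = G.rot (G.rot (G.port i))
          · simp [hx3, h3, h1]
          have e1 : G.rot x ≠ G.port i := fun hc => hx3 (G.rot.injective (hc.trans h2.symm))
          simp [hx1, hx2, hx3, e1]
        · cases x <;> simp [h1, h3]
      right_inv := by
        obtain ⟨h1, h2⟩ := h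
        have h3 : G.rot (G.rot (G.port i)) ≠ G.port i := fun hc => h1 (by rw [hc] at h2; exact h2)
        rintro (x | x)
        · by_cases hx1 : x = G.port i
          · simp [hx1]
          by_cases hx2 : x = G.rot (G.port i)
          · simp [hx2, h1]
          by_cases hx3 : x = G.rot (G.rot (G.port i))
          · simp [hx3, h3, h1]
          have e1 : G.rot.symm x ≠ G.port i := fun hc => hx2 (by rw [← hc]; simp)
          have e2 : G.rot.symm x ≠ G.rot (G.port i) := fun hc => hx3 (by rw [← hc]; simp)
          have e3 : G.rot.symm x ≠ G.rot (G.rot (G.port i)) := fun hc =>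
            hx1 (by rw [← h2, ← hc]; simp)
          simp [hx1, hx2, hx3, e1, e2, e3]
        · cases x <;> simp [h1, h3] }
  bd := i.succ.insertNth (.inr .new) fun j => .inl (G.bd j)
  bd_injective := by
    intro x y
    refine Fin.succAboveCases i.succ ?_ (fun j => ?_) x <;>
      refine Fin.succAboveCases i.succ ?_ (fun j' => ?_) y
    · simp
    · simp
    · simp
    · intro hj
      simp only [Fin.insertNth_apply_succAbove] at hj
      rw [G.bd_injective (Sum.inl_injective hj)]
  rot_bd := by
    obtain ⟨h1, h2⟩ := h
    intro j
    refine Fin.succAboveCases i.succ ?_ (fun j => ?_) j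
    · simp
    · have e1 : G.bd j ≠ G.port i := fun hc => h1 (by rw [← hc, G.rot_bd])
      have e2 : G.bd j ≠ G.rot (G.port i) := fun hc => e1 (G.rot.injective ((G.rot_bd j).trans hc))
      have e3 : G.bd j ≠ G.rot (G.rot (G.port i)) := fun hc =>
        e2 (G.rot.injective ((G.rot_bd j).trans hc))
      simp [e1, e2, e3, G.rot_bd]
  isWhite := fun x => match x with
    | .inl x =>
      if x = G.port i then false
      else if x = G.rot (G.port i) then false
      else if x = G.rot (G.rot (G.port i)) then true
      else G.isWhite x
    | .inr .cd => false
    | .inr .cb => false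
    | .inr .ab => false
    | .inr .ad => false
    | .inr .bc => true
    | .inr .ba => true
    | .inr .da => true
    | .inr .dc => true
    | .inr .out => true
    | .inr .new => true
  isWhite_rot := by
    obtain ⟨h1, h2⟩ := h
    have h3 : G.rot (G.rot (G.port i)) ≠ G.port i := fun hc => h1 (by rw [hc] at h2; exact h2)
    rintro (x | x)
    · by_cases hx1 : x = G.port i
      · simp [hx1]
      by_cases hx2 : x = G.rot (G.port i)
      · simp [hx2, h1]
      by_cases hx3 : x = G.rot (G.rot (G.port i))
      · simp [hx3, h3, h1]
      have e1 : G.rot x ≠ G.port i := fun hc => hx3 (G.rot.injective (hc.trans h2.symm))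
      simp [hx1, hx2, hx3, e1, G.isWhite_rot]
    · cases x <;> simp [h1, h3]

/-- The initial plabic graph with `4` boundary vertices: a square with vertices `v₁` (white), `v₂`
(black), `v₃` (white), `v₄` (black), in clockwise order, with `vᵢ` joined to the boundary vertex
`i`. The half-edges `(i, 0)`, `(i, 1)`, `(i, 2)`, `(i, 3)` are at the boundary vertex `i`,
at `vᵢ` towards that boundary vertex, at `vᵢ` towards `vᵢ₊₁`, and at `vᵢ` towards `vᵢ₋₁`. -/
def square : PlabicGraph 4 where
  Dart := Fin 4 × Fin 4
  decEq := inferInstance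
  finite := inferInstance
  edge := fun x => ![(x.1, 1), (x.1, 0), (x.1 + 1, 3), (x.1 - 1, 2)] x.2
  edge_edge := by unfold Function.Involutive; decide
  edge_ne := by decide
  rot :=
    { toFun := fun x => (x.1, ![0, 2, 3, 1] x.2)
      invFun := fun x => (x.1, ![0, 3, 1, 2] x.2)
      left_inv := by unfold Function.LeftInverse; decide
      right_inv := by unfold Function.RightInverse Function.LeftInverse; decide }
  bd := fun i => (i, 0)
  bd_injective := by unfold Function.Injective; decide
  rot_bd := by decide
  isWhite := fun x => ![true, false, true, false] x.1
  isWhite_rot := by decide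

end PlabicGraph

/-! ### The BCFW recursion -/

/-- `BCFWGraph n k G`: the graph `G` belongs to the recursively defined family of plabic graphs
with `n` boundary vertices and type `(k, n)`. One never blows up at the first or last boundary
vertex. -/
inductive BCFWGraph : (n k : ℕ) → PlabicGraph n → Prop
  | square : BCFWGraph 4 2 PlabicGraph.square
  | black {n k : ℕ} {G : PlabicGraph n} (hG : BCFWGraph n k G) (i : Fin n)
      (first : (i : ℕ) ≠ 0) (last : (i : ℕ) + 1 ≠ n) (h : G.TrivalentAt i)
      (color : G.isWhite (G.port i) = false) : BCFWGraph (n + 1) k (G.blowup i h)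
  | white {n k : ℕ} {G : PlabicGraph n} (hG : BCFWGraph n k G) (i : Fin n)
      (first : (i : ℕ) ≠ 0) (last : (i : ℕ) + 1 ≠ n) (h : G.TrivalentAt i)
      (color : G.isWhite (G.port i) = true) : BCFWGraph (n + 1) (k + 1) (G.blowup i h)

/-- The long cycle `c_n = (n n-1 ⋯ 2 1)`, i.e. `i ↦ i - 1` modulo `n`. -/
def longCycle (n : ℕ) : Equiv.Perm (Fin n) := (finRotate n)⁻¹

/-- The set `Π_{n,k,4}` of BCFW permutations `c_n² π_G`, where `G` is in the family of type
`(k + 2, n)` and all fixed points are coloured black. -/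
def bcfwPerms (k n : ℕ) : Set (DecPerm n) :=
  {π | ∃ G : PlabicGraph n, BCFWGraph n (k + 2) G ∧
    π = DecPerm.allBlack (longCycle n ^ 2 * G.trip)}

/-- The set `C_{n,k,4}` of `(k, n)`-BCFW cells. -/
def bcfwCells (k n : ℕ) : Set (Set (Submodule ℝ (Fin n → ℝ))) :=
  {S | ∃ π ∈ bcfwPerms k n, S = positroidCell k π}

end BCFW

namespace BCFW

open Letter

/-! ### Permutations attached to pairs of noncrossing lattice paths -/

-- Diagrams and plabic graphs turn out to obey one and the same recursion, along which both
-- permutations can be computed.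
--
-- Take a noncrossing pair (U, L) and look at the last letter of U. If it is a west step, then L
-- ends in a west step too, and both can be removed. If it is a south step, remove it together with
-- the last south step of L, which is followed only by west steps. `PathPair` is this recursion run
-- backwards, with a permutation σ and a strand state carried along.
--
-- Diagrams. A common final west step lengthens every row of both shapes by one box. The first
-- column of zeros placed in step 2 then has full height and occupies the rightmost column that
-- avoids the final + of the bottom row. Deleting this column gives back the old diagram, so the
-- pipes change only by a new fixed point (`Connects.columnAdded`). A new south step leaves the
-- boxes of the upper shape unchanged and adds to the lower shape a bottom row whose boxes with +
-- are the first one and the last three. This inserts a new row label and a new last label and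
-- composes with a 5-cycle (`Connects.rowAdded`). Hence σ is the permutation of the diagram
-- (`PathPair.connects`).
--
-- Graphs. A blowup only needs to know, for every boundary vertex s, the trip leaving s and the
-- strand at the neighbour of s that avoids s. On these data (`StrandState`) it acts by an explicit
-- local rule (`PlabicGraph.Realizes.blowup`), and blowups at different vertices commute up to a
-- shift of labels (`StrandState.blow_blow`). So any sequence of blowups can be sorted into weakly
-- increasing positions. In sorted order, the vertex b of the last blowup is black and all later
-- ones except the last boundary vertex are white. The next blowup is thus either at b (black, a
-- west step) or further on (white, a south step), so sorted sequences are exactly path pairs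
-- (`PathPair.exists_blow`, `StrandFamily.exists_pathPair`). The trip from s ends at σ(s) + 2 modulo
-- n (`PathPair.firstHit_boundary`), and the factor c_n² removes the 2.
--
-- Injectivity on permutations holds because σ reveals the last step of the recursion: its value at
-- the last label gives b, and b is a fixed point exactly after a west step (`PathPair.paths_eq`).
--
-- For cells, a subspace determines its decorated permutation (`HasDecPerm.unique`), so it is enough
-- that the cells are nonempty. Every decorated permutation has a totally nonnegative realization,
-- built from fixed points and bridges (`DecPerm.exists_isRealizedBy`), in a dimension that for σ is
-- the number of south steps (`PathPair.rank_eq`).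

/-- The increasing map that misses the value `c`. -/
def skip (c s : ℕ) : ℕ := if s < c then s else s + 1

theorem skip_injective (c : ℕ) : Function.Injective (skip c) := by
  intro a b h
  simp only [skip] at h
  split_ifs at h <;> omega

/-- Insert a new fixed point `c`. -/
def insertFixed (c : ℕ) (σ : ℕ → ℕ) (u : ℕ) : ℕ :=
  if u < c then skip c (σ u) else if u = c then c else skip c (σ (u - 1))

/-- The cycle `(r, r + 1, r + 2, r + 3, N)`. -/
def rowCycle (r N u : ℕ) : ℕ :=
  if u = r then r + 1 else if u = r + 1 then r + 2 else if u = r + 2 then r + 3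
  else if u = r + 3 then N else if u = N then r else u

/-- Insert a new fixed point `r` and a new last point, and compose with `rowCycle`. -/
def addRow (r N : ℕ) (σ : ℕ → ℕ) (u : ℕ) : ℕ := insertFixed r σ (rowCycle r N u)

theorem insertFixed_skip (c : ℕ) (σ : ℕ → ℕ) (s : ℕ) :
    insertFixed c σ (skip c s) = skip c (σ s) := by
  by_cases h : s < c
  · simp [insertFixed, skip, h]
  · simp [insertFixed, skip, h, show ¬ s + 1 < c by omega, show s + 1 ≠ c by omega]

theorem insertFixed_self (c : ℕ) (σ : ℕ → ℕ) : insertFixed c σ c = c := by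
  simp [insertFixed]

theorem addRow_last {r N : ℕ} (h : r + 3 < N) (σ : ℕ → ℕ) : addRow r N σ N = r := by
  simp only [addRow, rowCycle]
  rw [if_neg (by omega), if_neg (by omega), if_neg (by omega), if_neg (by omega), if_pos trivial,
    insertFixed_self]

theorem addRow_add_three {r N : ℕ} (h : r + 3 < N) (σ : ℕ → ℕ) :
    addRow r N σ (r + 3) = skip r (σ (N - 1)) := by
  simp only [addRow, rowCycle]
  rw [if_neg (by omega), if_neg (by omega), if_neg (by omega), if_pos trivial, insertFixed,
    if_neg (by omega), if_neg (by omega)]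

/-- The cycle moves `r`, `r + 1`, `r + 2` up by one, so it turns the sequence that misses `r + 3`
into the one that misses `r`. Together with `addRow_last` and `addRow_add_three` this covers all
labels. -/
theorem addRow_skip {r N s : ℕ} (hs : s + 1 < N) (σ : ℕ → ℕ) :
    addRow r N σ (skip (r + 3) s) = skip r (σ s) := by
  have h1 : rowCycle r N (skip (r + 3) s) = skip r s := by
    simp only [rowCycle, skip]
    split_ifs <;> omega
  rw [addRow, h1, insertFixed_skip]

theorem cases_addRow {r N u : ℕ} (h : r + 3 < N) (hu : u < N + 1) :
    u = N ∨ u = r + 3 ∨ ∃ s, s + 1 < N ∧ u = skip (r + 3) s := by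
  rcases lt_trichotomy u (r + 3) with h1 | h1 | h1
  · exact Or.inr (Or.inr ⟨u, by omega, by simp [skip, h1]⟩)
  · exact Or.inr (Or.inl h1)
  · by_cases h2 : u = N
    · exact Or.inl h2
    · exact Or.inr (Or.inr ⟨u - 1, by omega, by
        rw [skip, if_neg (by omega)]; omega⟩)

theorem cases_skip (c u : ℕ) : u = c ∨ ∃ s, u = skip c s ∧ ∀ n, c ≤ n → u < n + 1 → s < n := by
  rcases lt_trichotomy u c with h1 | h1 | h1
  · exact Or.inr ⟨u, by simp [skip, h1], by omega⟩
  · exact Or.inl h1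
  · exact Or.inr ⟨u - 1, by rw [skip, if_neg (by omega)]; omega, by omega⟩

theorem skip_le (c s : ℕ) : skip c s ≤ s + 1 := by
  simp only [skip]; split_ifs <;> omega

theorem skip_of_lt {c s : ℕ} (h : s < c) : skip c s = s := by simp [skip, h]

theorem skip_of_le {c s : ℕ} (h : c ≤ s) : skip c s = s + 1 := by simp [skip, h]

/-- The way in which strands in a plabic graph move between marked positions: `(s, false)` is
the boundary vertex `s` and `(s, true)` the strand at the vertex adjacent to `s` that avoids `s`. -/
@[ext] structure StrandState where
  next : ℕ × Bool → ℕ × Bool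
  white : ℕ → Bool

namespace StrandState

/-- The strands of the square. -/
def init : StrandState where
  next x := if x.2 then (3 - x.1, false) else (if x.1 % 2 = 0 then x.1 + 1 else x.1 - 1, true)
  white s := s % 2 = 0

/-- How the sources of the strands in a blowup correspond to sources before. -/
def pull (c : Bool) (i : ℕ) (x : ℕ × Bool) : ℕ × Bool :=
  if x.1 < i then x else if i + 1 < x.1 then (x.1 - 1, x.2) else (i, if x.1 = i then !c else c)

/-- How the targets of the strands before a blowup correspond to targets after it. -/
def push (c : Bool) (i : ℕ) (x : ℕ × Bool) : ℕ × Bool :=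
  if x.1 < i then x else if i < x.1 then (x.1 + 1, x.2) else (if x.2 = c then i + 1 else i, true)

/-- The strands of a blowup at `i`. -/
def blow (i : ℕ) (S : StrandState) : StrandState where
  next x := if x = (i, true) then (i + 1, false) else if x = (i + 1, true) then (i, false)
    else push (S.white i) i (S.next (pull (S.white i) i x))
  white s := if s < i then S.white s else if s = i then false else if s = i + 1 then true
    else S.white (s - 1)

end StrandState

/-- The pairs of lattice paths, built up letter by letter in the upper path, with the position
after the last south step of the lower path, the permutation of the associated diagram, and the
strands of an associated plabic graph. -/
inductive PathPair : List Letter → List Letter → ℕ → (ℕ → ℕ) → StrandState → Prop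
  | nil : PathPair [] [] 1 id .init
  | black {U L : List Letter} {b : ℕ} {σ : ℕ → ℕ} {S : StrandState} (h : PathPair U L b σ S) :
      PathPair (U ++ [H]) (L ++ [H]) b (insertFixed b σ) (S.blow b)
  | white {U w : List Letter} {t b : ℕ} {σ : ℕ → ℕ} {S : StrandState}
      (h : PathPair U (w ++ List.replicate t H) b σ S) :
      PathPair (U ++ [V]) (w ++ V :: List.replicate t H) (w.length + 2)
        (addRow w.length (w.length + t + 4) σ) (S.blow (w.length + 2))

-- Path pairs: the last south step, recovery from the permutation, noncrossing pairs

namespace PathPair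

variable {U L : List Letter} {b : ℕ} {σ : ℕ → ℕ} {S : StrandState}

theorem length_eq (h : PathPair U L b σ S) : U.length = L.length := by
  induction h with
  | nil => rfl
  | black _ ih => simp [ih]
  | white _ ih => simp at ih ⊢; omega

theorem count_eq (h : PathPair U L b σ S) : U.count V = L.count V := by
  induction h with
  | nil => rfl
  | black _ ih => simp [ih]
  | white _ ih => simp at ih ⊢; omega

theorem getElem?_ne (h : PathPair U L b σ S) : ∀ j, b ≤ j + 1 → L[j]? ≠ some V := by
  induction h with
  | nil => simp
  | @black U L b σ S _ ih =>
    intro j hj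
    rcases lt_trichotomy j L.length with h | rfl | h
    · rw [List.getElem?_append_left h]; exact ih j hj
    · simp
    · rw [List.getElem?_eq_none (by simp; omega)]; simp
  | @white U w t b σ S _ ih =>
    intro j hj
    rw [List.getElem?_append_right (by omega), show j - w.length = (j - w.length - 1) + 1 by omega,
      List.getElem?_cons_succ]
    intro hc
    have := List.eq_of_mem_replicate (List.mem_of_getElem? hc)
    contradiction

/-- With `getElem?_ne` this fixes the meaning of `b`: counting from 0, the last south step of `L`
has index `b - 2`, and `b = 1` if there is none. -/
theorem bound_cases (h : PathPair U L b σ S) :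
    b = 1 ∨ ∃ a, b = a + 2 ∧ L[a]? = some V := by
  induction h with
  | nil => simp
  | @black U L b σ S _ ih =>
    rcases ih with h | ⟨a, h, ha⟩
    · exact Or.inl h
    · exact Or.inr ⟨a, h, by rw [List.getElem?_append_left (List.getElem?_eq_some_iff.1 ha).1, ha]⟩
  | @white U w t b σ S _ ih => exact Or.inr ⟨w.length, rfl, by simp⟩

theorem one_le (h : PathPair U L b σ S) : 1 ≤ b := by
  rcases h.bound_cases with h | ⟨a, h, -⟩ <;> omega

theorem bound_le (h : PathPair U L b σ S) : b ≤ L.length + 1 := by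
  rcases h.bound_cases with h | ⟨a, h, ha⟩
  · omega
  · have := (List.getElem?_eq_some_iff.1 ha).1; omega

theorem bound_le_of_append {w : List Letter} {t : ℕ}
    (h : PathPair U (w ++ List.replicate t H) b σ S) : b ≤ w.length + 1 := by
  rcases h.bound_cases with hb | ⟨a, hb, ha⟩
  · omega
  · by_contra hlt
    rw [List.getElem?_append_right (by omega)] at ha
    have := List.eq_of_mem_replicate (List.mem_of_getElem? ha)
    contradiction

theorem perm_lt (h : PathPair U L b σ S) : ∀ s < L.length + 4, σ s < L.length + 4 := by
  induction h with
  | nil => simp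
  | @black U L b σ S h ih =>
    intro u hu
    have hb := h.bound_le
    simp only [List.length_append, List.length_singleton] at hu ⊢
    rcases cases_skip b u with rfl | ⟨s, rfl, hs⟩
    · rw [insertFixed_self]; omega
    · rw [insertFixed_skip]
      have := ih s (hs _ (by omega) (by omega))
      have := skip_le b (σ s)
      omega
  | @white U w t b σ S h ih =>
    intro u hu
    simp only [List.length_append, List.length_cons, List.length_replicate] at hu ih ⊢
    rcases cases_addRow (r := w.length) (N := w.length + t + 4) (by omega) (by omega : u < _) with
      rfl | rfl | ⟨s, hs, rfl⟩
    · rw [addRow_last (by omega)]; omega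
    · rw [addRow_add_three (by omega)]
      have := skip_le w.length (σ (w.length + t + 4 - 1))
      have := ih (w.length + t + 4 - 1) (by omega)
      omega
    · rw [addRow_skip (by omega)]
      have := skip_le w.length (σ s)
      have := ih s (by omega)
      omega

/-- The last label remembers `b`. A west step shifts the last label but not its value `b - 2`, which
lies below the inserted point; a south step sends the new last label to the index of the new step.
-/
theorem perm_last (h : PathPair U L b σ S) :
    (L.count V = 0 ∧ b = 1 ∧ ∀ s, σ s = s) ∨ (0 < L.count V ∧ σ (L.length + 3) + 2 = b) := by
  induction h with
  | nil => simp
  | @black U L b σ S h ih =>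
    have hb := h.bound_le
    rcases ih with ⟨h1, h2, h3⟩ | ⟨h1, h2⟩
    · refine Or.inl ⟨by simpa using h1, h2, fun u => ?_⟩
      rcases cases_skip b u with rfl | ⟨s, rfl, hs⟩
      · rw [insertFixed_self]
      · rw [insertFixed_skip, h3]
    · refine Or.inr ⟨by simpa using h1, ?_⟩
      simp only [List.length_append, List.length_singleton]
      rw [show L.length + 1 + 3 = skip b (L.length + 3) by rw [skip_of_le (by omega)],
        insertFixed_skip, skip_of_lt (by omega)]
      exact h2
  | @white U w t b σ S h ih =>
    refine Or.inr ⟨by simp, ?_⟩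
    simp only [List.length_append, List.length_cons, List.length_replicate]
    rw [show w.length + (t + 1) + 3 = w.length + t + 4 by omega, addRow_last (by omega)]

/-- Values that drop below their argument are indices of letters of `L` up to the last south step.
This separates them from the labels touched by the next step of the recursion, both in `paths_eq`
and in the count of `sum_lt`. -/
theorem le_perm_or (h : PathPair U L b σ S) :
    ∀ s < L.length + 4, s ≤ σ s ∨ σ s + 2 ≤ b := by
  induction h with
  | nil => simp
  | @black U L b σ S h ih =>
    intro u hu
    have hb := h.bound_le
    simp only [List.length_append, List.length_singleton] at hu ⊢
    rcases cases_skip b u with rfl | ⟨s, rfl, hs⟩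
    · rw [insertFixed_self]; omega
    · rw [insertFixed_skip]
      have := ih s (hs _ (by omega) (by omega))
      simp only [skip]
      split_ifs <;> omega
  | @white U w t b σ S h ih =>
    intro u hu
    have hb := h.bound_le_of_append
    have hl := h.perm_last
    simp only [List.length_append, List.length_cons, List.length_replicate] at hu ih hl ⊢
    rcases cases_addRow (r := w.length) (N := w.length + t + 4) (by omega) (by omega : u < _) with
      rfl | rfl | ⟨s, hs, rfl⟩
    · rw [addRow_last (by omega)]; omega
    · rw [addRow_add_three (by omega), show w.length + t + 4 - 1 = w.length + t + 3 by omega]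
      rcases hl with ⟨-, -, h1⟩ | ⟨-, h1⟩
      · rw [h1, skip_of_le (by omega)]; omega
      · rw [skip_of_lt (by omega)]; omega
    · rw [addRow_skip (by omega)]
      have := ih s (by omega)
      simp only [skip]
      split_ifs <;> omega

/-- A pair of lattice paths is determined by its permutation. -/
theorem paths_eq (h : PathPair U L b σ S) {U' L' : List Letter} {b' : ℕ} {σ' : ℕ → ℕ}
    {S' : StrandState} (h' : PathPair U' L' b' σ' S') (hl : L.length = L'.length)
    (hc : L.count V = L'.count V) (hσ : ∀ s < L.length + 4, σ s = σ' s) : U = U' ∧ L = L' := by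
  -- After a west step `b` is fixed. After a south step with the same `b = w.length + 2` it is not:
  -- this would require `σ' b = b - 1`, which is less than `b` but greater than what `le_perm_or`
  -- allows.
  have mixed : ∀ {U L : List Letter} {b : ℕ} {σ : ℕ → ℕ} {S : StrandState} {U' w : List Letter}
      {t b' : ℕ} {σ' : ℕ → ℕ} {S' : StrandState}, PathPair U L b σ S →
      PathPair U' (w ++ List.replicate t H) b' σ' S' → L.length = w.length + t → b = w.length + 2 →
      insertFixed b σ b ≠ addRow w.length (w.length + t + 4) σ' b := by
    intro U L b σ S U' w t b' σ' S' h h' hl hb he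
    subst hb
    rw [insertFixed_self, show w.length + 2 = skip (w.length + 3) (w.length + 2) by
      rw [skip_of_lt (by omega)], addRow_skip (by omega)] at he
    have h1 := h'.le_perm_or (w.length + 2) (by simp; omega)
    have h2 := h'.bound_le_of_append
    simp only [skip] at he
    split_ifs at he <;> omega
  -- The value at the last label determines `b`, by `perm_last`.
  have bound : ∀ {U L : List Letter} {b : ℕ} {σ : ℕ → ℕ} {S : StrandState} {U' L' : List Letter}
      {b' : ℕ} {σ' : ℕ → ℕ} {S' : StrandState}, PathPair U L b σ S → PathPair U' L' b' σ' S' →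
      L.length = L'.length → L.count V = L'.count V → (∀ s < L.length + 4, σ s = σ' s) →
      b = b' := by
    intro U L b σ S U' L' b' σ' S' h h' hl hc hσ
    have h1 := h.perm_last
    have h2 := h'.perm_last
    have h3 := hσ (L.length + 3) (by omega)
    rw [← hl] at h2
    omega
  have hb := bound h h' hl hc hσ
  induction h generalizing U' L' b' σ' S' with
  | nil =>
    obtain rfl : L' = [] := List.length_eq_zero_iff.1 hl.symm
    exact ⟨(List.length_eq_zero_iff.1 h'.length_eq).symm, rfl⟩
  | @black U L b σ S h ih =>
    have hbl := h.bound_le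
    have whole : PathPair (U ++ [H]) (L ++ [H]) b (insertFixed b σ) (S.blow b) := .black h
    cases h' with
    | nil => simp at hl
    | @black U' L' b' σ' S' h' =>
      subst hb
      simp only [List.length_append, List.length_singleton, Nat.add_right_cancel_iff] at hl
      simp only [List.count_append, Nat.add_right_cancel_iff] at hc
      have e : ∀ s < L.length + 4, σ s = σ' s := by
        intro s hs
        have := hσ (skip b s) (by have := skip_le b s; simp; omega)
        rw [insertFixed_skip, insertFixed_skip] at this
        exact skip_injective _ this
      obtain ⟨rfl, rfl⟩ := ih h' hl hc e (bound h h' hl hc e)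
      exact ⟨rfl, rfl⟩
    | @white U' w t b' σ' S' h' =>
      simp at hl
      exact absurd (hσ b (by simp; omega)) (mixed h h' (by omega) hb)
  | @white U w t b σ S h ih =>
    cases h' with
    | nil => simp at hl
    | @black U' L' b' σ' S' h' =>
      simp at hl
      subst hb
      exact absurd (hσ (w.length + 2) (by simp; omega)).symm (mixed h' h (by omega) rfl)
    | @white U' w' t' b' σ' S' h' =>
      simp only [List.length_append, List.length_cons, List.length_replicate] at hl hσ
      have hw : w.length = w'.length := by omega
      have ht : t = t' := by omega
      subst ht
      rw [← hw] at hσ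
      have hbw := h.bound_le_of_append
      have e : ∀ s < w.length + t + 4, σ s = σ' s := by
        intro s hs
        apply skip_injective w.length
        by_cases h1 : s + 1 < w.length + t + 4
        · rw [← addRow_skip h1, ← addRow_skip h1]
          exact hσ _ (by have := skip_le (w.length + 3) s; omega)
        · rw [show s = w.length + t + 4 - 1 by omega, ← addRow_add_three (by omega),
            ← addRow_add_three (by omega)]
          exact hσ _ (by omega)
      have hl' : (w ++ List.replicate t H).length = (w' ++ List.replicate t H).length := by simp [hw]
      have hc' : (w ++ List.replicate t H).count V = (w' ++ List.replicate t H).count V := by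
        simp at hc ⊢; omega
      have e' : ∀ s < (w ++ List.replicate t H).length + 4, σ s = σ' s := by simpa using e
      obtain ⟨rfl, h2⟩ := ih h' hl' hc' e' (bound h h' hl' hc' e')
      simp at h2
      simp [h2]

theorem exists_last_V (L : List Letter) (h : 0 < L.count V) :
    ∃ w t, L = w ++ V :: List.replicate t H := by
  induction L using List.reverseRecOn with
  | nil => simp at h
  | append_singleton L a ih =>
    cases a
    · obtain ⟨w, t, rfl⟩ := ih (by simpa using h)
      exact ⟨w, t + 1, by simp [List.replicate_succ']⟩
    · exact ⟨L, 0, by simp⟩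

/-- Induction on the last letter of `U`, removing with it a final west step or the last south step
of `L`; the point is that the smaller pair is still noncrossing. -/
theorem exists_of_noncrossing (U L : List Letter) (hl : U.length = L.length)
    (hc : U.count V = L.count V)
    (hn : ∀ i ≤ L.length, (U.take i).count V ≤ (L.take i).count V) :
    ∃ b σ S, PathPair U L b σ S := by
  induction U using List.reverseRecOn generalizing L with
  | nil =>
    obtain rfl : L = [] := List.length_eq_zero_iff.1 hl.symm
    exact ⟨_, _, _, .nil⟩
  | append_singleton U a ih =>
    cases a
    · rcases List.eq_nil_or_concat L with rfl | ⟨L, c, rfl⟩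
      · simp at hl
      rw [List.concat_eq_append] at hl hc hn ⊢
      simp only [List.length_append, List.length_singleton, Nat.add_right_cancel_iff] at hl hn
      -- Before its final west step `U` has made all its south steps, hence so has `L`, whose last
      -- letter must then be a west step.
      have h1 := hn L.length (by omega)
      rw [List.take_left, List.take_append_of_le_length hl.ge, List.take_of_length_le hl.le] at h1
      cases c
      · obtain ⟨b, σ, S, h⟩ := ih L hl (by simpa using hc) (fun i hi => by
          have := hn i (by omega)
          rwa [List.take_append_of_le_length (by omega),
            List.take_append_of_le_length (by omega)] at this)
        exact ⟨_, _, _, .black h⟩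
      · simp at hc
        omega
    · obtain ⟨w, t, rfl⟩ := exists_last_V L (by rw [← hc]; simp)
      simp at hl hc
      obtain ⟨b, σ, S, h⟩ := ih (w ++ List.replicate t H) (by simp; omega)
        (by simpa [List.count_replicate] using hc) (fun i hi => by
          simp only [List.length_append, List.length_replicate] at hi
          rcases le_total i w.length with h1 | h1
          · have := hn i (by simp; omega)
            rw [List.take_append_of_le_length (by omega),
              List.take_append_of_le_length (by omega)] at this
            rwa [List.take_append_of_le_length (by omega)]
          -- Beyond `w` the shortened lower path has only west steps left, so it has already made as
          -- many south steps as `U` makes in total.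
          · calc (U.take i).count V ≤ U.count V := (List.take_sublist i U).count_le _
              _ ≤ w.count V := by simp [List.count_replicate] at hc; omega
              _ ≤ _ := by
                rw [List.take_append, List.take_of_length_le h1, List.count_append]
                omega)
      exact ⟨_, _, _, .white h⟩

theorem noncrossing (h : PathPair U L b σ S) (i : ℕ) :
    (U.take i).count V ≤ (L.take i).count V := by
  induction h generalizing i with
  | nil => simp
  | @black U L b σ S h ih =>
    have := ih i
    have := h.length_eq
    by_cases hi : i ≤ L.length
    · rwa [List.take_append_of_le_length (by omega), List.take_append_of_le_length (by omega)]
    · rw [List.take_of_length_le (by simp; omega), List.take_of_length_le (by simp; omega)]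
      simp [h.count_eq]
  | @white U w t b σ S h ih =>
    have h1 := ih i
    have h2 := h.length_eq
    have h3 := h.count_eq
    simp [List.count_replicate] at h2 h3
    by_cases hi : i ≤ w.length
    · rw [List.take_append_of_le_length (by omega)] at h1 ⊢
      rwa [List.take_append_of_le_length (by omega)]
    · have h4 : (List.take i (w ++ V :: List.replicate t H)).count V = w.count V + 1 := by
        rw [List.take_append, List.take_of_length_le (by omega),
          show i - w.length = (i - w.length - 1) + 1 by omega, List.take_succ_cons]
        simp [List.take_replicate, List.count_replicate]
      have h5 := (List.take_sublist i (U ++ [V])).count_le V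
      simp at h5
      omega

end PathPair

end BCFW


namespace BCFW

open Letter

/-! ### Blowups of strand states -/

namespace StrandState

theorem push_of_lt (c : Bool) {i s : ℕ} (u : Bool) (h : s < i) : push c i (s, u) = (s, u) := by
  simp [push, h]

theorem push_of_gt (c : Bool) {i s : ℕ} (u : Bool) (h : i < s) :
    push c i (s, u) = (s + 1, u) := by
  simp [push, h, h.le]

theorem push_self (c : Bool) (i : ℕ) (u : Bool) :
    push c i (i, u) = (if u = c then i + 1 else i, true) := by
  simp [push]

theorem pull_of_lt (c : Bool) {i s : ℕ} (u : Bool) (h : s < i) : pull c i (s, u) = (s, u) := by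
  simp [pull, h]

theorem pull_of_gt (c : Bool) {i s : ℕ} (u : Bool) (h : i + 1 < s) :
    pull c i (s, u) = (s - 1, u) := by
  simp [pull, h, show ¬ s < i by omega]

theorem pull_self (c : Bool) (i : ℕ) (u : Bool) : pull c i (i, u) = (i, !c) := by
  simp [pull]

theorem pull_succ (c : Bool) (i : ℕ) (u : Bool) : pull c i (i + 1, u) = (i, c) := by
  simp [pull]

/-- Each push changes only targets at its own vertex and shifts later labels, so pushes at different
vertices do not interact; `j` becomes `j + 1` after the insertion at `i < j`. -/
theorem push_push (c d : Bool) {i j : ℕ} (h : i < j) (x : ℕ × Bool) :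
    push d (j + 1) (push c i x) = push c i (push d j x) := by
  obtain ⟨s, u⟩ := x
  rcases lt_trichotomy s j with h1 | rfl | h1
  · rw [push_of_lt d u h1]
    rcases lt_trichotomy s i with h2 | rfl | h2
    · rw [push_of_lt c u h2, push_of_lt d u (by omega)]
    · rw [push_self, push_of_lt]
      split_ifs <;> omega
    · rw [push_of_gt c u h2, push_of_lt d u (by omega)]
  · rw [push_of_gt c u h, push_self, push_self, push_of_gt]
    · congr 1
      split_ifs <;> rfl
    · split_ifs <;> omega
  · rw [push_of_gt c u (by omega), push_of_gt d u (by omega), push_of_gt d u h1,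
      push_of_gt c u (by omega)]

theorem next_blow_fst (i : ℕ) (S : StrandState) :
    (blow i S).next (i, true) = (i + 1, false) := by simp [blow]

theorem next_blow_snd (i : ℕ) (S : StrandState) :
    (blow i S).next (i + 1, true) = (i, false) := by simp [blow]

theorem next_blow (S : StrandState) {i : ℕ} {x : ℕ × Bool} (h1 : x ≠ (i, true))
    (h2 : x ≠ (i + 1, true)) :
    (blow i S).next x = push (S.white i) i (S.next (pull (S.white i) i x)) := by
  simp [blow, h1, h2]

theorem next_blow_of_lt (S : StrandState) {i s : ℕ} (u : Bool) (h : s < i) :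
    (blow i S).next (s, u) = push (S.white i) i (S.next (s, u)) := by
  rw [next_blow, pull_of_lt _ _ h] <;> simp <;> omega

theorem next_blow_of_gt (S : StrandState) {i s : ℕ} (u : Bool) (h : i + 1 < s) :
    (blow i S).next (s, u) = push (S.white i) i (S.next (s - 1, u)) := by
  rw [next_blow, pull_of_gt _ _ h] <;> simp <;> omega

theorem next_blow_self (S : StrandState) (i : ℕ) :
    (blow i S).next (i, false) = push (S.white i) i (S.next (i, !S.white i)) := by
  rw [next_blow, pull_self] <;> simp

theorem next_blow_succ (S : StrandState) (i : ℕ) :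
    (blow i S).next (i + 1, false) = push (S.white i) i (S.next (i, S.white i)) := by
  rw [next_blow, pull_succ] <;> simp

theorem white_blow_of_lt (S : StrandState) {i s : ℕ} (h : s < i) :
    (blow i S).white s = S.white s := by simp [blow, h]

theorem white_blow_self (S : StrandState) (i : ℕ) : (blow i S).white i = false := by simp [blow]

theorem white_blow_succ (S : StrandState) (i : ℕ) : (blow i S).white (i + 1) = true := by
  simp [blow]

theorem white_blow_of_gt (S : StrandState) {i s : ℕ} (h : i + 1 < s) :
    (blow i S).white s = S.white (s - 1) := by
  simp [blow, show ¬ s < i by omega, show s ≠ i by omega, show s ≠ i + 1 by omega]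

/-- Blowups at different positions commute. -/
theorem blow_blow {i j : ℕ} (h : i < j) (S : StrandState) :
    blow (j + 1) (blow i S) = blow i (blow j S) := by
  have e1 : (blow i S).white (j + 1) = S.white j := white_blow_of_gt S (by omega)
  have e2 : (blow j S).white i = S.white i := white_blow_of_lt S h
  have hw : (blow (j + 1) (blow i S)).white = (blow i (blow j S)).white := by
    funext s
    simp only [blow]
    split_ifs <;> first | rfl | omega
  refine StrandState.ext ?_ hw
  funext ⟨s, u⟩
  rcases lt_trichotomy s (j + 1) with h1 | rfl | h1
  · rw [next_blow_of_lt _ u h1, e1]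
    rcases lt_trichotomy s i with h2 | rfl | h2
    · rw [next_blow_of_lt _ u h2, next_blow_of_lt _ u h2, next_blow_of_lt _ u (by omega),
        push_push _ _ h, e2]
    · cases u
      · rw [next_blow_self, next_blow_self, e2, next_blow_of_lt _ _ h, push_push _ _ h]
      · rw [next_blow_fst, next_blow_fst, push_of_lt _ _ (by omega)]
    · rcases (by omega : s = i + 1 ∨ i + 1 < s) with rfl | h3
      · cases u
        · rw [next_blow_succ, next_blow_succ, e2, next_blow_of_lt _ _ h, push_push _ _ h]
        · rw [next_blow_snd, next_blow_snd, push_of_lt _ _ (by omega)]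
      · rw [next_blow_of_gt _ u h3, next_blow_of_gt _ u h3, next_blow_of_lt _ u (by omega),
          push_push _ _ h, e2]
  · rw [next_blow_of_gt (blow j S) u (by omega : i + 1 < j + 1), Nat.add_sub_cancel]
    cases u
    · rw [next_blow_self, next_blow_self, e1, e2, next_blow_of_gt _ _ (by omega),
        Nat.add_sub_cancel, push_push _ _ h]
    · rw [next_blow_fst, next_blow_fst, push_of_gt _ _ (by omega)]
  · rcases (by omega : s = j + 1 + 1 ∨ j + 1 + 1 < s) with rfl | h3
    · rw [next_blow_of_gt (blow j S) u (by omega : i + 1 < j + 1 + 1), Nat.add_sub_cancel]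
      cases u
      · rw [next_blow_succ, next_blow_succ, e1, e2, next_blow_of_gt _ _ (by omega),
          Nat.add_sub_cancel, push_push _ _ h]
      · rw [next_blow_snd, next_blow_snd, push_of_gt _ _ (by omega)]
    · rw [next_blow_of_gt _ u (by omega), next_blow_of_gt _ u (by omega),
        next_blow_of_gt _ u (by omega), next_blow_of_gt _ u (by omega), push_push _ _ h, e1, e2]

end StrandState

open StrandState

/-- The strand states of the graphs in the BCFW recursion. -/
inductive StrandFamily : ℕ → ℕ → StrandState → Prop
  | init : StrandFamily 4 2 .init
  | blow {n k : ℕ} {S : StrandState} (h : StrandFamily n k S) {i : ℕ} (first : 1 ≤ i)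
      (last : i + 1 < n) :
      StrandFamily (n + 1) (k + if S.white i then 1 else 0) (S.blow i)

-- Sorting a sequence of blowups into a path pair

namespace PathPair

variable {U L : List Letter} {b : ℕ} {σ : ℕ → ℕ} {S : StrandState}

/-- A blowup puts a black vertex followed by a white one at its position, and the positions weakly
increase. This is why the constructors `black` and `white` are blowups at vertices of these colours,
and why the colour at a position beyond the bound decides between them. -/
theorem white_last (h : PathPair U L b σ S) :
    S.white b = false ∧ ∀ s, b < s → s < L.length + 3 → S.white s = true := by
  induction h with
  | nil => exact ⟨by simp [init], fun s h1 h2 => by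
      obtain rfl : s = 2 := by simp at h2; omega
      simp [init]⟩
  | @black U L b σ S h ih =>
    refine ⟨white_blow_self _ _, fun s h1 h2 => ?_⟩
    simp at h2
    rcases (by omega : s = b + 1 ∨ b + 1 < s) with rfl | h3
    · exact white_blow_succ _ _
    · rw [white_blow_of_gt _ h3]
      exact ih.2 _ (by omega) (by omega)
  | @white U w t b σ S h ih =>
    have hb := h.bound_le_of_append
    refine ⟨white_blow_self _ _, fun s h1 h2 => ?_⟩
    simp at h2 ih
    rcases (by omega : s = w.length + 2 + 1 ∨ w.length + 2 + 1 < s) with rfl | h3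
    · exact white_blow_succ _ _
    · rw [white_blow_of_gt _ h3]
      exact ih.2 _ (by omega) (by omega)

theorem family (h : PathPair U L b σ S) : StrandFamily (L.length + 4) (L.count V + 2) S := by
  induction h with
  | nil => exact .init
  | @black U L b σ S h ih =>
    have := StrandFamily.blow ih (i := b) h.one_le (by have := h.bound_le; omega)
    rw [h.white_last.1] at this
    simpa [show L.length + 1 + 4 = L.length + 4 + 1 by omega] using this
  | @white U w t b σ S h ih =>
    have hb := h.bound_le_of_append
    have := StrandFamily.blow ih (i := w.length + 2) (by omega) (by simp)
    rw [h.white_last.2 _ (by omega) (by simp)] at this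
    simp at this ⊢
    convert this using 1 <;> omega

/-- Blow up at a position after the last south step of the lower path. -/
theorem blow_of_le (h : PathPair U L b σ S) {i : ℕ} (hb : b ≤ i) (hi : i < L.length + 3) :
    ∃ U' L' σ', PathPair U' L' i σ' (S.blow i) ∧ L'.length = L.length + 1 ∧
      L'.count V = L.count V + if S.white i then 1 else 0 := by
  rcases hb.eq_or_lt with rfl | hlt
  · exact ⟨_, _, _, .black h, by simp, by simp [h.white_last.1]⟩
  -- As `i` exceeds `b`, the letters of `L` from index `i - 2` on are west steps, so a south step
  -- may be inserted there.
  · obtain ⟨w, t, rfl, hw⟩ : ∃ w t, L = w ++ List.replicate t H ∧ w.length + 2 = i := by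
      have h1 := h.one_le
      refine ⟨L.take (i - 2), L.length - (i - 2), ?_, by simp; omega⟩
      conv_lhs => rw [← List.take_append_drop (i - 2) L]
      congr 1
      rw [List.eq_replicate_iff]
      refine ⟨by simp, fun a ha => ?_⟩
      obtain ⟨j, hj⟩ := List.mem_iff_getElem?.1 ha
      rw [List.getElem?_drop] at hj
      cases a
      · rfl
      · exact absurd hj (h.getElem?_ne _ (by omega))
    subst hw
    refine ⟨_, _, _, .white h, by simp; omega, ?_⟩
    rw [h.white_last.2 _ hlt hi]
    simp
    omega

/-- Insertion sort: a blowup before the last position is moved past the last step by `blow_blow`,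
which shifts that step by one. The estimate for `b'` is needed in the induction, to know that the
shifted step still comes last. -/
theorem exists_blow (h : PathPair U L b σ S) {i : ℕ} (hi1 : 1 ≤ i) (hi : i < L.length + 3) :
    ∃ U' L' b' σ', PathPair U' L' b' σ' (S.blow i) ∧ L'.length = L.length + 1 ∧
      L'.count V = L.count V + (if S.white i then 1 else 0) ∧ b' ≤ max i (b + 1) := by
  induction h generalizing i with
  | nil =>
    obtain ⟨U', L', σ', h1, h2, h3⟩ := nil.blow_of_le hi1 hi
    exact ⟨U', L', i, σ', h1, h2, h3, le_max_left _ _⟩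
  | @black U L b σ S h ih =>
    by_cases hb : b ≤ i
    · obtain ⟨U', L', σ', h1, h2, h3⟩ := (black h).blow_of_le hb hi
      exact ⟨U', L', i, σ', h1, h2, h3, le_max_left _ _⟩
    · push Not at hb
      have hbl := h.bound_le
      obtain ⟨U', L', b', σ', h1, h2, h3, h4⟩ := ih hi1 (by omega)
      have hw : (S.blow i).white (b + 1) = false := by
        rw [white_blow_of_gt _ (by omega)]; exact h.white_last.1
      -- Vertex `b + 1` is black, whereas vertices strictly between the bound and the last one are
      -- white; so the bound is exactly `b + 1` and the shifted step is again a west step.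
      have hb' : b' = b + 1 := by
        by_contra hne
        have := h1.white_last.2 (b + 1) (by omega) (by omega)
        rw [hw] at this
        contradiction
      subst hb'
      refine ⟨_, _, _, _, by rw [← blow_blow hb]; exact .black h1, by simp [h2], ?_, by omega⟩
      rw [white_blow_of_lt _ hb]
      simp [h3]
  | @white U w t b σ S h ih =>
    by_cases hb : w.length + 2 ≤ i
    · obtain ⟨U', L', σ', h1, h2, h3⟩ := (white h).blow_of_le hb hi
      exact ⟨U', L', i, σ', h1, h2, h3, le_max_left _ _⟩
    · push Not at hb
      have hbl := h.bound_le_of_append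
      simp only [List.length_append, List.length_replicate] at ih
      obtain ⟨U', L', b', σ', h1, h2, h3, h4⟩ := ih hi1 (by omega)
      have hw : (S.blow i).white (w.length + 2 + 1) = true := by
        rw [white_blow_of_gt _ (by omega)]
        exact h.white_last.2 _ (by omega) (by simp)
      have hb' : b' ≠ w.length + 2 + 1 := by
        rintro rfl
        have := h1.white_last.1
        rw [hw] at this
        contradiction
      -- The shifted vertex is still white, so the bound does not reach it and the shifted step is
      -- again a south step.
      obtain ⟨U'', L'', σ'', g1, g2, g3⟩ := h1.blow_of_le (i := w.length + 2 + 1) (by omega)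
        (by omega)
      refine ⟨U'', L'', _, σ'', by rw [← blow_blow hb]; exact g1, by simp [g2, h2]; omega, ?_,
        by omega⟩
      rw [white_blow_of_lt _ hb, g3, hw, h3]
      simp
      omega

end PathPair

theorem StrandFamily.exists_pathPair {n k : ℕ} {S : StrandState} (h : StrandFamily n k S) :
    ∃ U L b σ, PathPair U L b σ S ∧ L.length + 4 = n ∧ L.count V + 2 = k := by
  induction h with
  | init => exact ⟨_, _, _, _, .nil, rfl, rfl⟩
  | @blow n k S h i first last ih =>
    obtain ⟨U, L, b, σ, h1, rfl, rfl⟩ := ih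
    obtain ⟨U', L', b', σ', g1, g2, g3, -⟩ := h1.exists_blow first (by omega)
    exact ⟨U', L', b', σ', g1, by omega, by omega⟩

end BCFW


namespace BCFW

open Letter

/-! ### Trips in strand states -/

/-- `y` is the first element of `s` that is reached by applying `f` repeatedly to `x`, at least
once. -/
inductive FirstHit {α : Type*} (f : α → α) (s : Set α) : α → α → Prop
  | hit {x : α} (h : f x ∈ s) : FirstHit f s x (f x)
  | step {x y : α} (h : f x ∉ s) (hy : FirstHit f s (f x) y) : FirstHit f s x y

namespace FirstHit

variable {α : Type*} {f : α → α} {s t : Set α} {x y z : α}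

theorem unique (h : FirstHit f s x y) (h' : FirstHit f s x z) : y = z := by
  induction h with
  | hit h =>
    cases h' with
    | hit => rfl
    | step h1 _ => exact absurd h h1
  | step h _ ih =>
    cases h' with
    | hit h1 => exact absurd h1 h
    | step _ h2 => exact ih h2

theorem trans (h : FirstHit f t x y) (hst : s ⊆ t) (hy : y ∉ s) (h' : FirstHit f s y z) :
    FirstHit f s x z := by
  induction h with
  | hit h => exact .step hy h'
  | step h _ ih => exact .step (fun hc => h (hst hc)) (ih hy h')

theorem of_subset (h : FirstHit f t x y) (hst : s ⊆ t) (hy : y ∈ s) : FirstHit f s x y := by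
  induction h with
  | hit h => exact .hit hy
  | step h _ ih => exact .step (fun hc => h (hst hc)) (ih hy)

/-- Stop at an additional element. -/
theorem insert_cases (h : FirstHit f s x y) (a : α) :
    FirstHit f (insert a s) x y ∨ (FirstHit f (insert a s) x a ∧ FirstHit f s a y) := by
  induction h with
  | hit h => exact Or.inl (.hit (Or.inr h))
  | @step x y h hy ih =>
    by_cases ha : f x = a
    · have h1 : FirstHit f (insert a s) x (f x) := .hit (Or.inl ha)
      rw [ha] at h1 hy
      exact Or.inr ⟨h1, hy⟩
    · have hm : f x ∉ insert a s := by simp [ha, h]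
      exact ih.imp (.step hm) (fun h => And.intro (FirstHit.step hm h.1) h.2)

/-- An element is always entered from the same side. -/
theorem insert_of_apply_eq {d : Set α} (hd : Set.MapsTo f d d) (hf : Set.InjOn f d) (hx : x ∈ d)
    (h : FirstHit f s x y) {a : α} (ha : a ∈ d) (hxa : x ≠ a) (hay : f a = y) :
    FirstHit f (insert a s) x a := by
  induction h with
  | hit h => exact absurd (hf ha hx hay) (Ne.symm hxa)
  | @step x y h hy ih =>
    by_cases hc : f x = a
    · have h1 : FirstHit f (insert a s) x (f x) := .hit (Or.inl hc)
      rwa [hc] at h1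
    · exact .step (by simp [hc, h]) (ih (hd hx) hc hay)

end FirstHit

/-- The boundary positions of a strand state. -/
def boundary : Set (ℕ × Bool) := {x | x.2 = false}

-- Trips in a blown up strand state

namespace StrandState

/-- A trip survives the blowup until it meets vertex `i`. There it enters the square at one of the
two new marks and leaves at one of the two boundary vertices `i`, `i + 1`. A trip that passed by
vertex `i`, stopping at `(i, true)`, is thereby cut off at one of them, and a trip that ended at `i`
now ends at the other. -/
theorem firstHit_blow (S : StrandState) (i : ℕ) {x y x' : ℕ × Bool}
    (h : FirstHit S.next (insert (i, true) boundary) x y) (h1 : x' ≠ (i, true))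
    (h2 : x' ≠ (i + 1, true)) (hx : pull (S.white i) i x' = x) :
    FirstHit (S.blow i).next boundary x'
      (if y = (i, true) then (if S.white i then i else i + 1)
        else skip (if S.white i then i else i + 1) y.1, false) := by
  -- Each new mark leads directly to the boundary vertex of the other label.
  have enter : ∀ (x' : ℕ × Bool) (j : ℕ), (S.blow i).next x' = (if j = i then i + 1 else i, true) →
      FirstHit (S.blow i).next boundary x' (if j = i then i else i + 1, false) := by
    intro x' j hj
    refine .step (by simp [hj, boundary]) ?_
    rw [hj]
    split_ifs with h
    · rw [← next_blow_snd i S]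
      exact .hit (by simp [next_blow_snd, boundary])
    · rw [← next_blow_fst i S]
      exact .hit (by simp [next_blow_fst, boundary])
  have e := next_blow S h1 h2
  rw [hx] at e
  induction h generalizing x' with
  | @hit x h =>
    rcases h with h | h
    · rw [if_pos h]
      rw [h, push_self] at e
      cases hw : S.white i
      · simpa using enter x' (i + 1) (by simpa [hw] using e)
      · simpa using enter x' i (by simpa [hw] using e)
    · obtain ⟨s, hs⟩ : ∃ s, S.next x = (s, false) := ⟨(S.next x).1, Prod.ext rfl h⟩
      rw [hs] at e ⊢
      simp only [Prod.mk.injEq, Bool.false_eq_true, and_false, if_false]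
      rcases lt_trichotomy s i with hlt | rfl | hlt
      · rw [push_of_lt _ _ hlt] at e
        rw [skip_of_lt (by split_ifs <;> omega), ← e]
        exact .hit (by simp [e, boundary])
      · rw [push_self] at e
        cases hw : S.white s
        · rw [hw] at e
          simpa [skip] using enter x' s (by simpa using e)
        · rw [hw] at e
          simpa [skip] using enter x' (s + 1) (by simpa using e)
      · rw [push_of_gt _ _ hlt] at e
        rw [skip_of_le (by split_ifs <;> omega), ← e]
        exact .hit (by simp [e, boundary])
  | @step x y h hy ih =>
    obtain ⟨s, hs⟩ : ∃ s, S.next x = (s, true) := ⟨(S.next x).1, Prod.ext rfl (by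
      simpa [boundary] using fun hc => h (Or.inr hc))⟩
    rw [hs] at e h
    have hsi : s ≠ i := fun hc => h (Or.inl (by rw [hc]))
    have key : ∀ s', (S.blow i).next x' = (s', true) → s' ≠ i → s' ≠ i + 1 →
        pull (S.white i) i (s', true) = (s, true) →
        FirstHit (S.blow i).next boundary x' (if y = (i, true) then (if S.white i then i else i + 1)
          else skip (if S.white i then i else i + 1) y.1, false) := by
      intro s' e' n1 n2 hp
      refine .step (by simp [e', boundary]) ?_
      have g1 : (s', true) ≠ (i, true) := by simp [n1]
      have g2 : (s', true) ≠ (i + 1, true) := by simp [n2]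
      rw [e']
      exact ih g1 g2 (by rw [hp, hs]) (by rw [next_blow S g1 g2, hp, hs])
    rcases lt_or_gt_of_ne hsi with hlt | hlt
    · rw [push_of_lt _ _ hlt] at e
      exact key s e (by omega) (by omega) (pull_of_lt _ _ hlt)
    · rw [push_of_gt _ _ hlt] at e
      exact key (s + 1) e (by omega) (by omega) (by rw [pull_of_gt _ _ (by omega)]; simp)

theorem push_fst_lt (c : Bool) (i : ℕ) {n : ℕ} {x : ℕ × Bool} (hx : x.1 < n) :
    (push c i x).1 < n + 1 := by
  simp only [push]
  split_ifs <;> (try simp only) <;> omega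

theorem pull_fst_lt (c : Bool) {i n : ℕ} (hi : i < n) {x : ℕ × Bool} (hx : x.1 < n + 1) :
    (pull c i x).1 < n := by
  simp only [pull]
  split_ifs <;> (try simp only) <;> omega

theorem pull_push (c : Bool) (i : ℕ) (x : ℕ × Bool) : pull c i (push c i x) = x := by
  obtain ⟨s, u⟩ := x
  rcases lt_trichotomy s i with h | rfl | h
  · rw [push_of_lt _ _ h, pull_of_lt _ _ h]
  · rw [push_self]
    split_ifs with h
    · rw [pull_succ, h]
    · rw [pull_self, Bool.eq_not_of_ne h]
  · rw [push_of_gt _ _ h, pull_of_gt _ _ (by omega), Nat.add_sub_cancel]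

/-- Used to show that `pull` is injective away from the two new marks. Pushing a position at `i`
always yields an inner mark, whereas the sources pulled back to `i` are boundary vertices, so the
flag has to be reset there. -/
theorem push_pull (c : Bool) (i : ℕ) {x : ℕ × Bool} (h1 : x ≠ (i, true)) (h2 : x ≠ (i + 1, true)) :
    ((push c i (pull c i x)).1, decide ((pull c i x).1 ≠ i) && (pull c i x).2) = x := by
  obtain ⟨s, u⟩ := x
  rcases lt_trichotomy s i with h | rfl | h
  · rw [pull_of_lt _ _ h, push_of_lt _ _ h]
    simp [h.ne]
  · cases u
    · rw [pull_self, push_self]; simp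
    · contradiction
  · rcases (by omega : s = i + 1 ∨ i + 1 < s) with rfl | h3
    · cases u
      · rw [pull_succ, push_self]; simp
      · contradiction
    · rw [pull_of_gt _ _ h3, push_of_gt _ _ (by omega)]
      simp only [Prod.mk.injEq]
      refine ⟨by omega, ?_⟩
      simp [show s - 1 ≠ i by omega]

theorem push_ne (c : Bool) (i : ℕ) (x : ℕ × Bool) :
    push c i x ≠ (i, false) ∧ push c i x ≠ (i + 1, false) := by
  obtain ⟨s, u⟩ := x
  rcases lt_trichotomy s i with h | rfl | h
  · rw [push_of_lt _ _ h]; simp; omega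
  · rw [push_self]; simp
  · rw [push_of_gt _ _ h]; simp; omega

theorem blow_mapsTo {S : StrandState} {i n : ℕ} (hi : i < n)
    (h : Set.MapsTo S.next {x | x.1 < n} {x | x.1 < n}) :
    Set.MapsTo (S.blow i).next {x | x.1 < n + 1} {x | x.1 < n + 1} := by
  intro x hx
  simp only [blow, Set.mem_ofPred_eq]
  split_ifs
  · simp only; omega
  · simp only; omega
  · exact push_fst_lt _ i (h (pull_fst_lt _ hi hx))

/-- The two new marks are sent to the boundary vertices `i + 1` and `i`, which are never values of
`push`; elsewhere the new map is `push ∘ S.next ∘ pull`. -/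
theorem blow_injOn {S : StrandState} {i n : ℕ} (hi : i < n)
    (h : Set.InjOn S.next {x | x.1 < n}) :
    Set.InjOn (S.blow i).next {x | x.1 < n + 1} := by
  intro x hx y hy hxy
  have key : ∀ z, z ≠ (i, true) → z ≠ (i + 1, true) → (S.blow i).next z ≠ (i, false) ∧
      (S.blow i).next z ≠ (i + 1, false) := by
    intro z h1 h2
    rw [next_blow S h1 h2]
    exact push_ne _ _ _
  by_cases x1 : x = (i, true)
  · subst x1
    rw [next_blow_fst] at hxy
    by_cases y1 : y = (i, true)
    · exact y1.symm
    by_cases y2 : y = (i + 1, true)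
    · rw [y2, next_blow_snd] at hxy; simp at hxy
    · exact absurd hxy.symm (key y y1 y2).2
  by_cases x2 : x = (i + 1, true)
  · subst x2
    rw [next_blow_snd] at hxy
    by_cases y1 : y = (i, true)
    · rw [y1, next_blow_fst] at hxy; simp at hxy
    by_cases y2 : y = (i + 1, true)
    · exact y2.symm
    · exact absurd hxy.symm (key y y1 y2).1
  by_cases y1 : y = (i, true)
  · rw [y1, next_blow_fst] at hxy
    exact absurd hxy (key x x1 x2).2
  by_cases y2 : y = (i + 1, true)
  · rw [y2, next_blow_snd] at hxy
    exact absurd hxy (key x x1 x2).1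
  rw [next_blow S x1 x2, next_blow S y1 y2] at hxy
  have h1 := congrArg (pull (S.white i) i) hxy
  rw [pull_push, pull_push] at h1
  have h2 := h (pull_fst_lt _ hi hx) (pull_fst_lt _ hi hy) h1
  rw [← push_pull (S.white i) i x1 x2, h2, push_pull _ _ y1 y2]

end StrandState

open StrandState

theorem add_two_mod {n x : ℕ} (hx : x < n) (hn : 2 ≤ n) :
    (x + 2) % n = if x + 2 < n then x + 2 else x + 2 - n := by
  split_ifs with h
  · exact Nat.mod_eq_of_lt h
  · rw [Nat.mod_eq_sub_mod (by omega), Nat.mod_eq_of_lt (by omega)]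

/-- Relates insertion of a label in σ to insertion of a trip endpoint: rotation by two carries the
gap at `r` to a gap at `r + 2`. -/
theorem skip_add_two_mod {n r x : ℕ} (hx : x < n) (hr : r + 2 < n) :
    (skip r x + 2) % (n + 1) = skip (r + 2) ((x + 2) % n) := by
  rw [add_two_mod hx (by omega), add_two_mod (by have := skip_le r x; omega) (by omega)]
  simp only [skip]
  split_ifs <;> omega

/-- Here the gap is at `b + 2`, but after a black blowup the endpoints are relabelled by `skip (b +
1)`. The two relabellings differ only at the endpoint `b + 1`, which belongs to the trip cut off by
the blowup. -/
theorem skip_add_two_mod' {n b x : ℕ} (hx : x < n) (hb : 1 ≤ b) (hbn : b + 1 < n) :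
    (skip b x + 2) % (n + 1) =
      if (x + 2) % n = b + 1 then b + 1 else skip (b + 1) ((x + 2) % n) := by
  rw [add_two_mod hx (by omega), add_two_mod (by have := skip_le b x; omega) (by omega)]
  simp only [skip]
  split_ifs <;> omega

theorem insertFixed_injective {σ : ℕ → ℕ} (h : Function.Injective σ) (c : ℕ) :
    Function.Injective (insertFixed c σ) := by
  have key : ∀ s, skip c s ≠ c := by intro s; simp only [skip]; split_ifs <;> omega
  intro x y hxy
  rcases cases_skip c x with hx | ⟨s, rfl, -⟩ <;> rcases cases_skip c y with hy | ⟨t, rfl, -⟩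
  · rw [hx, hy]
  · rw [hx, insertFixed_self, insertFixed_skip] at hxy
    exact absurd hxy.symm (key _)
  · subst hy
    rw [insertFixed_self, insertFixed_skip] at hxy
    exact absurd hxy (key _)
  · rw [insertFixed_skip, insertFixed_skip] at hxy
    rw [h (skip_injective _ hxy)]

theorem addRow_injective {σ : ℕ → ℕ} (h : Function.Injective σ) {r N : ℕ} (hr : r + 3 < N) :
    Function.Injective (addRow r N σ) := by
  refine (insertFixed_injective h r).comp (g := insertFixed r σ) (f := rowCycle r N) ?_
  intro x y hxy
  simp only [rowCycle] at hxy
  split_ifs at hxy <;> omega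

-- Trips in the strand state of a path pair

namespace PathPair

variable {U L : List Letter} {b : ℕ} {σ : ℕ → ℕ} {S : StrandState}

theorem injective (h : PathPair U L b σ S) : Function.Injective σ := by
  induction h with
  | nil => exact Function.injective_id
  | black _ ih => exact insertFixed_injective ih _
  | white _ ih => exact addRow_injective ih (by omega)

theorem next_mapsTo_injOn (h : PathPair U L b σ S) :
    Set.MapsTo S.next {x | x.1 < L.length + 4} {x | x.1 < L.length + 4} ∧
      Set.InjOn S.next {x | x.1 < L.length + 4} := by
  induction h with
  | nil =>
    constructor
    · rintro ⟨s, u⟩ h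
      simp at h
      cases u <;> simp [init]
      · split_ifs <;> omega
      · omega
    · rintro ⟨s, u⟩ h ⟨t, v⟩ h' hst
      simp at h h'
      cases u <;> cases v <;> simp [init] at hst ⊢
      · split_ifs at hst <;> omega
      · omega
  | @black U L b σ S h ih =>
    have := h.bound_le
    simp only [List.length_append, List.length_singleton,
      show L.length + 1 + 4 = L.length + 4 + 1 by omega]
    exact ⟨blow_mapsTo (by omega) ih.1, blow_injOn (by omega) ih.2⟩
  | @white U w t b σ S h ih =>
    simp only [List.length_append, List.length_cons, List.length_replicate] at ih ⊢
    simp only [show w.length + (t + 1) + 4 = w.length + t + 4 + 1 by omega]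
    exact ⟨blow_mapsTo (by omega) ih.1, blow_injOn (by omega) ih.2⟩

/-- The vertices beyond `b` form a ladder: the strand from the last boundary vertex passes the inner
marks in decreasing order and comes out at `b`. Both kinds of step preserve this shape. -/
theorem next_last (h : PathPair U L b σ S) :
    S.next (L.length + 3, false) = (L.length + 2, true) ∧ S.next (b, true) = (b + 1, false) ∧
    S.next (b + 1, true) = (b, false) ∧
    ∀ j, b < j → j < L.length + 2 → S.next (j + 1, true) = (j, true) := by
  induction h with
  | nil => refine ⟨by simp [init], by simp [init], by simp [init], by simp; omega⟩
  | @black U L b σ S h ih =>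
    have hb := h.bound_le
    obtain ⟨h1, h2, h3, h4⟩ := ih
    simp only [List.length_append, List.length_singleton]
    refine ⟨?_, next_blow_fst _ _, next_blow_snd _ _, fun j hj hj' => ?_⟩
    · rw [next_blow_of_gt _ _ (by omega), show L.length + 1 + 3 - 1 = L.length + 3 by omega, h1,
        push_of_gt _ _ (by omega)]
    · rw [next_blow_of_gt _ _ (by omega), Nat.add_sub_cancel]
      rcases (by omega : j = b + 1 ∨ b + 1 < j) with rfl | h5
      · rw [h3, push_self, h.white_last.1]; simp
      · have := h4 (j - 1) (by omega) (by omega)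
        rw [Nat.sub_add_cancel (by omega)] at this
        rw [this, push_of_gt _ _ (by omega), Nat.sub_add_cancel (by omega)]
  | @white U w t b σ S h ih =>
    have hb := h.bound_le_of_append
    obtain ⟨h1, h2, h3, h4⟩ := ih
    simp only [List.length_append, List.length_cons, List.length_replicate] at h1 h2 h3 h4 ⊢
    have hw : S.white (w.length + 2) = true := h.white_last.2 _ (by omega) (by simp)
    refine ⟨?_, next_blow_fst _ _, next_blow_snd _ _, fun j hj hj' => ?_⟩
    · rw [next_blow_of_gt _ _ (by omega),
        show w.length + (t + 1) + 3 - 1 = w.length + t + 3 by omega, h1]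
      rcases Nat.eq_zero_or_pos t with rfl | ht
      · rw [Nat.add_zero, push_self, hw]; simp
      · rw [push_of_gt _ _ (by omega)]; rfl
    · rw [next_blow_of_gt _ _ (by omega), Nat.add_sub_cancel]
      have h6 := h4 (j - 1) (by omega) (by omega)
      rw [Nat.sub_add_cancel (by omega)] at h6
      rw [h6]
      rcases (by omega : j = w.length + 2 + 1 ∨ w.length + 2 + 1 < j) with rfl | h5
      · rw [Nat.add_sub_cancel, push_self, hw]; simp
      · rw [push_of_gt _ _ (by omega), Nat.sub_add_cancel (by omega)]

/-- Cuts the trip of the last boundary vertex at vertex `i`, where a white blowup will interrupt it.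
-/
theorem trailing_hits (h : PathPair U L b σ S) {i : ℕ} (hb : b < i) (hi : i < L.length + 3) :
    FirstHit S.next (insert (i, true) boundary) (L.length + 3, false) (i, true) ∧
      FirstHit S.next (insert (i, true) boundary) (i, true) (b, false) := by
  obtain ⟨h1, -, h3, h4⟩ := h.next_last
  have down : ∀ j, i ≤ j → j < L.length + 2 →
      FirstHit S.next (insert (i, true) boundary) (j + 1, true) (i, true) := by
    intro j hij
    induction j, hij using Nat.le_induction with
    | base =>
      intro hj
      have := h4 i hb hj
      have h5 : FirstHit S.next (insert (i, true) boundary) (i + 1, true) _ :=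
        .hit (by rw [this]; exact Or.inl rfl)
      rwa [this] at h5
    | succ j hij ih =>
      intro hj
      have := h4 (j + 1) (by omega) hj
      refine .step ?_ ?_ <;> rw [this]
      · simp [boundary]; omega
      · exact ih (by omega)
  have up : ∀ m, b + 1 ≤ m → m ≤ i →
      FirstHit S.next (insert (i, true) boundary) (m, true) (b, false) := by
    intro m hm
    induction m, hm using Nat.le_induction with
    | base =>
      intro hj
      have h5 : FirstHit S.next (insert (i, true) boundary) (b + 1, true) _ :=
        .hit (by rw [h3]; exact Or.inr rfl)
      rwa [h3] at h5
    | succ m hm ih =>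
      intro hj
      have := h4 m (by omega) (by omega)
      refine .step ?_ ?_ <;> rw [this]
      · simp [boundary]; omega
      · exact ih (by omega)
  refine ⟨?_, up i hb le_rfl⟩
  rcases (by omega : i = L.length + 2 ∨ i ≤ L.length + 1) with rfl | hlt
  · have h5 : FirstHit S.next (insert (L.length + 2, true) boundary) (L.length + 3, false) _ :=
      .hit (by rw [h1]; exact Or.inl rfl)
    rwa [h1] at h5
  · refine .step ?_ ?_ <;> rw [h1]
    · simp [boundary]; omega
    · exact down _ hlt (by omega)

/-- The permutation of a pair of lattice paths describes the trips in the associated graph. -/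
theorem firstHit_boundary (h : PathPair U L b σ S) : ∀ s < L.length + 4,
    FirstHit S.next boundary (s, false) ((σ s + 2) % (L.length + 4), false) := by
  induction h with
  | nil =>
    intro s hs
    simp at hs
    have key : ∀ x y z, init.next x = y → init.next y = z → y ∉ boundary → z ∈ boundary →
        FirstHit init.next boundary x z := by
      rintro x _ _ rfl rfl hy hz
      exact .step hy (.hit hz)
    interval_cases s <;> exact key _ _ _ rfl rfl (by simp [init, boundary]) rfl
  | @black U L b σ S h ih =>
    have hb := h.bound_le
    have hb1 := h.one_le
    have hw := h.white_last.1
    obtain ⟨-, hn, -, -⟩ := h.next_last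
    obtain ⟨hm, hinj⟩ := h.next_mapsTo_injOn
    intro u hu
    simp only [List.length_append, List.length_singleton] at hu ⊢
    rw [show L.length + 1 + 4 = L.length + 4 + 1 by omega]
    rcases cases_skip b u with rfl | ⟨s, rfl, hs⟩
    -- Since the vertex is black, the new trip from it continues along the old strand from `(u,
    -- true)`.
    · have h1 : FirstHit S.next (insert (u, true) boundary) (u, true) (u + 1, false) := by
        rw [← hn]
        exact .hit (by rw [hn]; exact Or.inr rfl)
      have := S.firstHit_blow u (x' := (u, false)) h1 (by simp) (by simp) (by rw [pull_self, hw]; rfl)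
      rw [insertFixed_self, Nat.mod_eq_of_lt (by omega)]
      simpa [hw, skip] using this
    · have hs' := hs _ (by omega) hu
      have h1 := ih s hs'
      have src : (skip b s, false) ≠ (b, true) ∧ (skip b s, false) ≠ (b + 1, true) ∧
          pull (S.white b) b (skip b s, false) = (s, false) := by
        refine ⟨by simp, by simp, ?_⟩
        rw [hw]
        rcases lt_trichotomy s b with h2 | rfl | h2
        · rw [skip_of_lt h2, pull_of_lt _ _ h2]
        · rw [skip_of_le le_rfl, pull_succ]
        · rw [skip_of_le h2.le, pull_of_gt _ _ (by omega), Nat.add_sub_cancel]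
      rw [insertFixed_skip, skip_add_two_mod' (h.perm_lt s hs') hb1 (by omega)]
      split_ifs with hc
      · rw [hc] at h1
        -- By injectivity of `next`, boundary vertex `b + 1` is reached only from `(b, true)`, so
        -- the trip ending there is the one that the blowup cuts off.
        have h2 := h1.insert_of_apply_eq hm hinj (by simpa using hs')
          (by simp; omega : (b, true) ∈ {x : ℕ × Bool | x.1 < L.length + 4}) (by simp) hn
        simpa [hw] using S.firstHit_blow b h2 src.1 src.2.1 src.2.2
      · rcases h1.insert_cases (b, true) with h2 | ⟨-, h2⟩
        · simpa [hw] using S.firstHit_blow b h2 src.1 src.2.1 src.2.2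
        · have h3 : FirstHit S.next boundary (b, true) (b + 1, false) := by
            rw [← hn]
            exact .hit (by rw [hn]; rfl)
          have := h2.unique h3
          simp at this
          exact absurd this hc
  | @white U w t b σ S h ih =>
    have hb := h.bound_le_of_append
    have hb1 := h.one_le
    have hw := h.white_last.2 (w.length + 2) (by omega) (by simp)
    obtain ⟨hd, hu⟩ := h.trailing_hits (i := w.length + 2) (by omega) (by simp)
    have hlt := h.perm_lt
    simp only [List.length_append, List.length_cons, List.length_replicate] at ih hd hlt ⊢
    rw [show w.length + (t + 1) + 4 = w.length + t + 4 + 1 by omega]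
    -- Joining the two pieces shows that the old trip of the last boundary vertex ends at `b`.
    have hlast := (hd.trans (s := boundary) (Set.subset_insert _ _) (by simp [boundary])
      (hu.of_subset (Set.subset_insert _ _) rfl)).unique (ih _ (by omega))
    simp only [Prod.mk.injEq, and_true] at hlast
    intro u hu'
    rcases cases_addRow (r := w.length) (N := w.length + t + 4) (by omega) hu' with
      rfl | rfl | ⟨s, hs, rfl⟩
    · rw [addRow_last (by omega), Nat.mod_eq_of_lt (by omega)]
      have := S.firstHit_blow (w.length + 2) (x' := (w.length + t + 4, false)) hd (by simp)
        (by simp) (by rw [pull_of_gt _ _ (by omega)]; rfl)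
      simpa [hw] using this
    · rw [addRow_add_three (by omega), skip_add_two_mod (hlt _ (by omega)) (by omega),
        show w.length + t + 4 - 1 = w.length + t + 3 by omega, ← hlast]
      have := S.firstHit_blow (w.length + 2) (x' := (w.length + 2 + 1, false)) hu (by simp)
        (by simp) (by rw [pull_succ, hw])
      simpa [hw] using this
    · have hs' : s < w.length + t + 4 := by omega
      rw [addRow_skip hs, skip_add_two_mod (hlt _ hs') (by omega)]
      have src : pull (S.white (w.length + 2)) (w.length + 2) (skip (w.length + 3) s, false) =
          (s, false) := by
        rw [hw]
        rcases lt_trichotomy s (w.length + 2) with h2 | rfl | h2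
        · rw [skip_of_lt (by omega), pull_of_lt _ _ h2]
        · rw [skip_of_lt (by omega), pull_self]; rfl
        · rw [skip_of_le (by omega), pull_of_gt _ _ (by omega), Nat.add_sub_cancel]
      rcases (ih s hs').insert_cases (w.length + 2, true) with h2 | ⟨-, h2⟩
      · simpa [hw] using S.firstHit_blow (w.length + 2) h2 (by simp) (by simp) src
      -- A trip through the interrupted strand would end where the trip of the last boundary vertex
      -- ends; since σ is injective, it would be that trip.
      · have h3 := h2.unique (hu.of_subset (Set.subset_insert _ _) rfl)
        simp only [Prod.mk.injEq, and_true] at h3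
        have h4 : (σ s + 2) % (w.length + t + 4) =
            (σ (w.length + t + 3) + 2) % (w.length + t + 4) := h3.trans hlast
        have h5 := Nat.ModEq.add_right_cancel' 2 h4
        have h6 := h.injective (h5.eq_of_lt_of_lt (hlt _ hs') (hlt _ (by omega)))
        omega

end PathPair

end BCFW


namespace BCFW

open Letter StrandState

/-! ### Strands in plabic graphs -/

namespace PlabicGraph

variable {n : ℕ} (G : PlabicGraph n)

/-- The marked half-edges: those at the boundary vertices, and for each vertex adjacent to a
boundary vertex the one through which the trip that avoids this boundary vertex leaves. -/
def mark (x : Fin n × Bool) : G.Dart :=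
  if x.2 then (if G.isWhite (G.port x.1) then G.rot (G.rot (G.port x.1)) else G.rot (G.port x.1))
  else G.bd x.1

theorem walk_apply (d : G.Dart) : G.walk d =
    if G.isWhite (G.edge d) then G.rot (G.edge d) else G.rot.symm (G.edge d) := rfl

theorem edge_port (i : Fin n) : G.edge (G.port i) = G.bd i := G.edge_edge _

theorem rot_symm_bd (i : Fin n) : G.rot.symm (G.bd i) = G.bd i := by
  rw [Equiv.symm_apply_eq, G.rot_bd]

theorem walk_port (i : Fin n) : G.walk (G.port i) = G.bd i := by
  rw [walk_apply, edge_port, rot_bd, rot_symm_bd, ite_self]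

/-- The strand state `S` describes the graph `G`. -/
structure Realizes (S : StrandState) : Prop where
  trivalent : ∀ j, G.TrivalentAt j
  distinct : ∀ i j, i ≠ j → G.port j ≠ G.port i ∧ G.port j ≠ G.rot (G.port i) ∧
    G.port j ≠ G.rot (G.rot (G.port i))
  color : ∀ j : Fin n, G.isWhite (G.port j) = S.white j
  hits : ∀ (s : Fin n) (u : Bool), ∃ t : Fin n, (t : ℕ) = (S.next (s, u)).1 ∧
    FirstHit G.walk (Set.range G.mark) (G.mark (s, u)) (G.mark (t, (S.next (s, u)).2))

theorem firstHit_iterate {α : Type*} {f : α → α} {s : Set α} {x y : α} (h : FirstHit f s x y) :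
    ∃ m : ℕ, f^[m + 1] x = y ∧ ∀ j < m, f^[j + 1] x ∉ s := by
  induction h with
  | hit h => exact ⟨0, rfl, by simp⟩
  | @step x y h hy ih =>
    obtain ⟨m, h1, h2⟩ := ih
    refine ⟨m + 1, h1, fun j hj => ?_⟩
    rcases j with _ | j
    · exact h
    · exact h2 j (by omega)

theorem tripEnd_eq {s t : Fin n} (h : FirstHit G.walk (Set.range G.bd) (G.bd s) (G.bd t)) :
    G.tripEnd s = t := by
  obtain ⟨m, h1, h2⟩ := firstHit_iterate h
  have h3 : G.tripLength s = m := by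
    rw [tripLength, Nat.find_eq_iff]
    refine ⟨⟨t, by rw [← h1, Equiv.Perm.iterate_eq_pow]⟩, fun j hj ⟨l, hl⟩ => h2 j hj ⟨l, ?_⟩⟩
    rw [← hl, Equiv.Perm.iterate_eq_pow]
  apply G.bd_injective
  rw [← G.walk_trip, h3, ← h1, Equiv.Perm.iterate_eq_pow]

variable {G}

/-- Inner marks are mere intermediate stops of the walk; they are not boundary half-edges, because
those are fixed by `rot`. So the strand segments can be joined to the trip. -/
theorem Realizes.trip_eq {S : StrandState} (h : G.Realizes S) {s t : Fin n}
    (hst : FirstHit S.next boundary (s, false) (t, false)) : G.trip s = t := by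
  have key : ∀ x y, FirstHit S.next boundary x y → ∀ (s : Fin n) (u : Bool), x = (↑s, u) →
      ∃ (t : Fin n) (v : Bool), y = (↑t, v) ∧
        FirstHit G.walk (Set.range G.bd) (G.mark (s, u)) (G.mark (t, v)) := by
    have hsub : Set.range G.bd ⊆ Set.range G.mark := by
      rintro _ ⟨i, rfl⟩
      exact ⟨(i, false), rfl⟩
    intro x y hxy
    induction hxy with
    | @hit x hx =>
      rintro s u rfl
      obtain ⟨t, h1, h2⟩ := h.hits s u
      refine ⟨t, _, Prod.ext h1.symm rfl, h2.of_subset hsub ⟨t, ?_⟩⟩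
      rw [show (S.next (↑s, u)).2 = false from hx]
      rfl
    | @step x y hx hy ih =>
      rintro s u rfl
      obtain ⟨t, h1, h2⟩ := h.hits s u
      have h3 : (S.next (↑s, u)).2 = true := by simpa [boundary] using hx
      obtain ⟨t', v, rfl, h4⟩ := ih t _ (Prod.ext h1.symm rfl)
      refine ⟨t', v, rfl, h2.trans hsub ?_ h4⟩
      rintro ⟨l, hl⟩
      rw [h3] at hl
      obtain ⟨g1, g2⟩ := h.trivalent t
      have g3 := G.rot_bd l
      simp only [mark, if_true] at hl
      split_ifs at hl <;> rw [hl] at g3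
      · rw [g2] at g3
        exact g1 (by rw [← g3] at g2; exact g2)
      · exact g1 (G.rot.injective g3)
  obtain ⟨t', v, h1, h2⟩ := key _ _ hst s false rfl
  simp only [Prod.mk.injEq] at h1
  obtain ⟨h1, rfl⟩ := h1
  obtain rfl := Fin.ext h1
  exact G.tripEnd_eq h2

theorem square_realizes : square.Realizes .init where
  trivalent := by unfold TrivalentAt; decide
  distinct := by decide
  color := by decide
  hits := by
    -- In the square every segment between consecutive marks consists of exactly two steps of the
    -- walk.
    have key : ∀ (s : Fin 4) (u : Bool), ∃ t : Fin 4, (t : ℕ) = (init.next (s, u)).1 ∧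
        (∀ l, square.mark l ≠ square.walk (square.mark (s, u))) ∧
        square.walk (square.walk (square.mark (s, u))) = square.mark (t, (init.next (s, u)).2) := by
      decide
    intro s u
    obtain ⟨t, h1, h2, h3⟩ := key s u
    refine ⟨t, h1, .step (fun ⟨l, hl⟩ => h2 l hl) ?_⟩
    rw [← h3]
    exact .hit ⟨_, h3.symm⟩

-- Walks in a blown up graph

section Blowup

variable (i : Fin n) (h : G.TrivalentAt i)

theorem rot_rot_port_ne (h : G.TrivalentAt i) : G.rot (G.rot (G.port i)) ≠ G.port i := by
  obtain ⟨h1, h2⟩ := h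
  intro hc
  rw [hc] at h2
  exact h1 h2

/-- The half-edges of `G` as half-edges of a blowup. -/
def old (x : G.Dart) : (G.blowup i h).Dart := Sum.inl x

/-- The new half-edges of a blowup. -/
def sq (x : SquareDart) : (G.blowup i h).Dart := Sum.inr x

theorem old_injective : Function.Injective (old i h) := Sum.inl_injective

theorem old_ne_sq (x : G.Dart) (y : SquareDart) : old i h x ≠ sq i h y := Sum.inl_ne_inr

theorem sq_injective : Function.Injective (sq i h) := Sum.inr_injective

theorem edge_old (x : G.Dart) : (G.blowup i h).edge (old i h x) = old i h (G.edge x) := rfl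

theorem edge_sq (x : SquareDart) : (G.blowup i h).edge (sq i h x) = sq i h x.opp := rfl

theorem bd_succAbove (j : Fin n) : (G.blowup i h).bd (i.succ.succAbove j) = old i h (G.bd j) :=
  Fin.insertNth_apply_succAbove (α := fun _ => G.Dart ⊕ SquareDart) i.succ (Sum.inr .new)
    (fun j => Sum.inl (G.bd j)) j

theorem bd_succ : (G.blowup i h).bd i.succ = sq i h .new :=
  Fin.insertNth_apply_same (α := fun _ => G.Dart ⊕ SquareDart) i.succ (Sum.inr .new)
    (fun j => Sum.inl (G.bd j))

theorem port_succAbove (j : Fin n) :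
    (G.blowup i h).port (i.succ.succAbove j) = old i h (G.port j) := by
  rw [port, bd_succAbove, edge_old, port]

theorem port_succ : (G.blowup i h).port i.succ = sq i h .out := by
  rw [port, bd_succ, edge_sq, SquareDart.opp]

theorem rot_old_eq (x : G.Dart) : (G.blowup i h).rot (old i h x) =
    if x = G.port i then sq i h .cd else if x = G.rot (G.port i) then sq i h .ab
    else if x = G.rot (G.rot (G.port i)) then sq i h .bc else old i h (G.rot x) := rfl

theorem rot_symm_old_eq (x : G.Dart) : (G.blowup i h).rot.symm (old i h x) =
    if x = G.port i then sq i h .cb else if x = G.rot (G.port i) then sq i h .ad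
    else if x = G.rot (G.rot (G.port i)) then sq i h .ba else old i h (G.rot.symm x) := rfl

theorem isWhite_old_eq (x : G.Dart) : (G.blowup i h).isWhite (old i h x) =
    if x = G.port i then false else if x = G.rot (G.port i) then false
    else if x = G.rot (G.rot (G.port i)) then true else G.isWhite x := rfl

variable {i h}

theorem rot_old {x : G.Dart} (h1 : x ≠ G.port i) (h2 : x ≠ G.rot (G.port i))
    (h3 : x ≠ G.rot (G.rot (G.port i))) : (G.blowup i h).rot (old i h x) = old i h (G.rot x) := by
  rw [rot_old_eq, if_neg h1, if_neg h2, if_neg h3]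

theorem isWhite_old {x : G.Dart} (h1 : x ≠ G.port i) (h2 : x ≠ G.rot (G.port i))
    (h3 : x ≠ G.rot (G.rot (G.port i))) : (G.blowup i h).isWhite (old i h x) = G.isWhite x := by
  rw [isWhite_old_eq, if_neg h1, if_neg h2, if_neg h3]

theorem walk_old {x : G.Dart} (h1 : G.edge x ≠ G.port i)
    (h2 : G.edge x ≠ G.rot (G.port i)) (h3 : G.edge x ≠ G.rot (G.rot (G.port i))) :
    (G.blowup i h).walk (old i h x) = old i h (G.walk x) := by
  rw [walk_apply, walk_apply, edge_old, rot_old h1 h2 h3, isWhite_old h1 h2 h3, rot_symm_old_eq,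
    if_neg h1, if_neg h2, if_neg h3]
  split_ifs <;> rfl

theorem walk_old_of_port {x : G.Dart} (hx : G.edge x = G.port i) :
    (G.blowup i h).walk (old i h x) = sq i h .cb := by
  rw [walk_apply, edge_old, isWhite_old_eq, rot_symm_old_eq, if_pos hx, if_pos hx]
  rfl

theorem walk_old_of_rot_port {x : G.Dart} (hx : G.edge x = G.rot (G.port i)) :
    (G.blowup i h).walk (old i h x) = sq i h .ad := by
  have h1 : G.edge x ≠ G.port i := by rw [hx]; exact h.1
  rw [walk_apply, edge_old, isWhite_old_eq, rot_symm_old_eq, if_neg h1, if_neg h1, if_pos hx,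
    if_pos hx]
  rfl

theorem walk_old_of_rot_rot_port {x : G.Dart} (hx : G.edge x = G.rot (G.rot (G.port i))) :
    (G.blowup i h).walk (old i h x) = sq i h .bc := by
  have h1 : G.edge x ≠ G.port i := by rw [hx]; exact rot_rot_port_ne i h
  have h2 : G.edge x ≠ G.rot (G.port i) := by rw [hx]; exact fun hc => h.1 (G.rot.injective hc)
  rw [walk_apply, edge_old, isWhite_old_eq, rot_old_eq, if_neg h1, if_neg h1, if_neg h2,
    if_neg h2, if_pos hx, if_pos hx]
  rfl

variable (i h)

/-- This and the next lemmas list the four strands of the square: the one from `i` leaves along the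
old edge after the port, the one from `i + 1` along the old edge before it, and the strands entering
along these two edges leave at `i` and at `i + 1` respectively. -/
theorem walk_cb : (G.blowup i h).walk (sq i h .cb) = sq i h .ba := rfl

theorem walk_ba : (G.blowup i h).walk (sq i h .ba) = old i h (G.rot (G.port i)) := rfl

theorem walk_ad : (G.blowup i h).walk (sq i h .ad) = sq i h .dc := rfl

theorem walk_dc : (G.blowup i h).walk (sq i h .dc) = old i h (G.port i) := rfl

theorem walk_bc : (G.blowup i h).walk (sq i h .bc) = sq i h .cd := rfl

theorem walk_cd : (G.blowup i h).walk (sq i h .cd) = sq i h .out := rfl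

theorem walk_out : (G.blowup i h).walk (sq i h .out) = sq i h .new := rfl

theorem walk_new : (G.blowup i h).walk (sq i h .new) = sq i h .da := rfl

theorem walk_da : (G.blowup i h).walk (sq i h .da) = sq i h .ab := rfl

theorem walk_ab : (G.blowup i h).walk (sq i h .ab) = old i h (G.rot (G.rot (G.port i))) := rfl

theorem walk_old_port : (G.blowup i h).walk (old i h (G.port i)) = old i h (G.bd i) := by
  have h1 := walk_port (G := G.blowup i h) (i.succ.succAbove i)
  rwa [port_succAbove, bd_succAbove] at h1

theorem mark_false (j : Fin n) : G.mark (j, false) = G.bd j := rfl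

theorem mark_true (j : Fin n) : G.mark (j, true) =
    if G.isWhite (G.port j) then G.rot (G.rot (G.port j)) else G.rot (G.port j) := rfl

theorem mark_succAbove_false (j : Fin n) :
    (G.blowup i h).mark (i.succ.succAbove j, false) = old i h (G.mark (j, false)) :=
  bd_succAbove i h j

theorem mark_succ_false : (G.blowup i h).mark (i.succ, false) = sq i h .new :=
  bd_succ i h

theorem mark_succ_true : (G.blowup i h).mark (i.succ, true) = sq i h .dc := by
  rw [mark_true, port_succ]
  rfl

theorem mark_self_true : (G.blowup i h).mark (i.succ.succAbove i, true) = sq i h .cd := by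
  rw [mark_true, port_succAbove, isWhite_old_eq, if_pos rfl, rot_old_eq, if_pos rfl]
  rfl

end Blowup

/-- The targets of strands in a blowup that correspond to given ones in the original graph. -/
def pushFin (c : Bool) (i : Fin n) (x : Fin n × Bool) : Fin (n + 1) × Bool :=
  if x.1 = i then (if x.2 = c then i.succ else i.succ.succAbove i, true)
  else (i.succ.succAbove x.1, x.2)

theorem succAbove_succ_val (i j : Fin n) : (i.succ.succAbove j : ℕ) = skip (i + 1) j := by
  simp only [Fin.succAbove, Fin.lt_def, skip, Fin.val_castSucc, Fin.val_succ]
  split_ifs <;> rfl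

theorem pushFin_val (c : Bool) (i : Fin n) (x : Fin n × Bool) :
    push c i (x.1, x.2) = (((pushFin c i x).1 : ℕ), (pushFin c i x).2) := by
  obtain ⟨t, v⟩ := x
  rcases lt_trichotomy t i with hlt | rfl | hlt
  · rw [push_of_lt _ _ hlt]
    simp only [pushFin, hlt.ne, if_false, succAbove_succ_val]
    rw [skip_of_lt (by have := Fin.lt_def.1 hlt; omega)]
  · rw [push_self]
    simp only [pushFin, if_true]
    split_ifs
    · simp
    · rw [succAbove_succ_val, skip_of_lt (by omega)]
  · rw [push_of_gt _ _ hlt]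
    simp only [pushFin, hlt.ne', if_false, succAbove_succ_val]
    rw [skip_of_le (by have := Fin.lt_def.1 hlt; omega)]

-- Blown up graphs are described by blown up strand states

namespace Realizes

variable {S : StrandState}

/-- The vertices next to `i` and `j` are different 3-cycles of `rot`, hence disjoint. -/
theorem orbit_ne (hG : G.Realizes S) {i j : Fin n} (hj : j ≠ i) :
    (G.port j ≠ G.port i ∧ G.port j ≠ G.rot (G.port i) ∧ G.port j ≠ G.rot (G.rot (G.port i))) ∧
    (G.rot (G.port j) ≠ G.port i ∧ G.rot (G.port j) ≠ G.rot (G.port i) ∧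
      G.rot (G.port j) ≠ G.rot (G.rot (G.port i))) ∧
    (G.rot (G.rot (G.port j)) ≠ G.port i ∧ G.rot (G.rot (G.port j)) ≠ G.rot (G.port i) ∧
      G.rot (G.rot (G.port j)) ≠ G.rot (G.rot (G.port i))) := by
  obtain ⟨a1, a2, a3⟩ := hG.distinct i j hj.symm
  obtain ⟨b1, b2, b3⟩ := hG.distinct j i hj
  refine ⟨⟨a1, a2, a3⟩, ⟨b2.symm, fun hc => a1 (G.rot.injective hc),
    fun hc => a2 (G.rot.injective hc)⟩, ⟨b3.symm, fun hc => b2 (G.rot.injective hc).symm,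
    fun hc => a1 (G.rot.injective (G.rot.injective hc))⟩⟩

theorem mark_cases (j : Fin n) : G.mark (j, true) = G.rot (G.port j) ∨
    G.mark (j, true) = G.rot (G.rot (G.port j)) := by
  rw [mark_true]
  split_ifs
  · exact Or.inr rfl
  · exact Or.inl rfl

theorem bd_ne (hG : G.Realizes S) (i j : Fin n) :
    G.bd j ≠ G.port i ∧ G.bd j ≠ G.rot (G.port i) ∧ G.bd j ≠ G.rot (G.rot (G.port i)) := by
  obtain ⟨h1, h2⟩ := hG.trivalent i
  have e1 : G.bd j ≠ G.port i := fun hc => h1 (by rw [← hc, G.rot_bd])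
  have e2 : G.bd j ≠ G.rot (G.port i) := fun hc => e1 (G.rot.injective ((G.rot_bd j).trans hc))
  exact ⟨e1, e2, fun hc => e2 (G.rot.injective ((G.rot_bd j).trans hc))⟩

theorem mark_ne (hG : G.Realizes S) {i : Fin n} {x : Fin n × Bool} (hx : x ≠ (i, true)) :
    G.mark x ≠ G.port i ∧ G.mark x ≠ G.rot (G.port i) ∧ G.mark x ≠ G.rot (G.rot (G.port i)) := by
  obtain ⟨j, u⟩ := x
  cases u
  · exact hG.bd_ne i j
  · have hj : j ≠ i := fun hc => hx (by rw [hc])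
    obtain ⟨-, h2, h3⟩ := hG.orbit_ne hj
    rcases mark_cases (G := G) j with h | h <;> rw [h] <;> assumption

theorem mark_ne_port (hG : G.Realizes S) (i : Fin n) (x : Fin n × Bool) : G.mark x ≠ G.port i := by
  by_cases hx : x = (i, true)
  · subst hx
    rcases mark_cases (G := G) i with h | h <;> rw [h]
    · exact (hG.trivalent i).1
    · exact rot_rot_port_ne i (hG.trivalent i)
  · exact (hG.mark_ne hx).1

variable {i : Fin n} {h : G.TrivalentAt i}

theorem mark_succAbove (hG : G.Realizes S) {j : Fin n} (hj : j ≠ i) (u : Bool) :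
    (G.blowup i h).mark (i.succ.succAbove j, u) = old i h (G.mark (j, u)) := by
  cases u
  · exact mark_succAbove_false i h j
  · obtain ⟨h1, h2, h3⟩ := hG.orbit_ne hj
    rw [mark_true, mark_true, port_succAbove, isWhite_old h1.1 h1.2.1 h1.2.2,
      rot_old h1.1 h1.2.1 h1.2.2, rot_old h2.1 h2.2.1 h2.2.2]
    split_ifs <;> rfl

/-- With `sq_not_mem`: the marks of the blowup are the old ones apart from `(i, true)`, together
with `cd`, `dc` and `new`. This makes it possible to check that a walk meets no mark too early. -/
theorem mem_mark_of_old (hG : G.Realizes S) {d : G.Dart}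
    (hd : old i h d ∈ Set.range (G.blowup i h).mark) :
    ∃ x : Fin n × Bool, x ≠ (i, true) ∧ G.mark x = d := by
  obtain ⟨⟨t, v⟩, ht⟩ := hd
  rcases Fin.eq_self_or_eq_succAbove i.succ t with rfl | ⟨j, rfl⟩
  · cases v
    · rw [mark_succ_false] at ht; exact absurd ht.symm (old_ne_sq _ _ _ _)
    · rw [mark_succ_true] at ht; exact absurd ht.symm (old_ne_sq _ _ _ _)
  · by_cases hj : j = i
    · subst hj
      cases v
      · rw [mark_succAbove_false] at ht
        exact ⟨(j, false), by simp, old_injective _ _ ht⟩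
      · rw [mark_self_true] at ht; exact absurd ht.symm (old_ne_sq _ _ _ _)
    · rw [hG.mark_succAbove hj] at ht
      exact ⟨(j, v), by simp [hj], old_injective _ _ ht⟩

theorem sq_not_mem (hG : G.Realizes S) {y : SquareDart} (h1 : y ≠ .cd) (h2 : y ≠ .dc)
    (h3 : y ≠ .new) : sq i h y ∉ Set.range (G.blowup i h).mark := by
  rintro ⟨⟨t, v⟩, ht⟩
  rcases Fin.eq_self_or_eq_succAbove i.succ t with rfl | ⟨j, rfl⟩
  · cases v
    · rw [mark_succ_false] at ht; exact h3 (sq_injective _ _ ht).symm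
    · rw [mark_succ_true] at ht; exact h2 (sq_injective _ _ ht).symm
  · by_cases hj : j = i
    · subst hj
      cases v
      · rw [mark_succAbove_false] at ht; exact absurd ht (old_ne_sq _ _ _ _)
      · rw [mark_self_true] at ht; exact h1 (sq_injective _ _ ht).symm
    · rw [hG.mark_succAbove hj] at ht
      exact absurd ht (old_ne_sq _ _ _ _)

theorem mark_injective (hG : G.Realizes S) : Function.Injective G.mark := by
  rintro ⟨j, u⟩ ⟨l, v⟩ hjl
  have hb : ∀ j l, G.mark (j, true) ≠ G.bd l := by
    intro j l hc
    obtain ⟨-, h2, h3⟩ := hG.bd_ne j l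
    rcases mark_cases (G := G) j with h | h <;> rw [h] at hc
    · exact h2 hc.symm
    · exact h3 hc.symm
  cases u <;> cases v
  · obtain rfl := G.bd_injective hjl
    rfl
  · exact absurd hjl.symm (hb _ _)
  · exact absurd hjl (hb _ _)
  · by_contra hne
    obtain ⟨-, h2, h3⟩ := hG.mark_ne (i := j) (x := (l, true)) (fun hc => hne hc.symm)
    rw [← hjl] at h2 h3
    rcases mark_cases (G := G) j with h | h
    · exact h2 h
    · exact h3 h

theorem firstHit_bd (i : Fin n) :
    FirstHit G.walk (Set.range G.mark) (G.port i) (G.mark (i, false)) := by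
  have : FirstHit G.walk (Set.range G.mark) (G.port i) _ :=
    .hit (by rw [walk_port]; exact ⟨(i, false), rfl⟩)
  rwa [walk_port] at this

/-- The strand that enters a blown up vertex through the half-edge after the port. -/
theorem firstHit_of_edge_eq_rot (hG : G.Realizes S) {d : G.Dart}
    (hd : G.edge d = G.rot (G.port i)) :
    FirstHit G.walk (Set.range G.mark) d (G.mark (i, G.isWhite (G.port i))) ∧
    FirstHit (G.blowup i h).walk (Set.range (G.blowup i h).mark) (old i h d)
      ((G.blowup i h).mark (i.succ, true)) := by
  constructor
  · have h1 : G.walk d = if G.isWhite (G.port i) then G.rot (G.rot (G.port i)) else G.port i := by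
      rw [walk_apply, hd, G.isWhite_rot, Equiv.symm_apply_apply]
    cases hw : G.isWhite (G.port i)
    · rw [hw, if_neg (by simp)] at h1
      refine .step ?_ ?_ <;> rw [h1]
      · rintro ⟨x, hx⟩
        exact hG.mark_ne_port i x hx
      · exact firstHit_bd i
    · rw [hw, if_pos rfl] at h1
      have h2 : G.mark (i, true) = G.walk d := by rw [h1, mark_true, hw, if_pos rfl]
      rw [h2]
      exact .hit ⟨_, h2⟩
  · rw [mark_succ_true]
    refine .step ?_ ?_ <;> rw [walk_old_of_rot_port hd]
    · exact hG.sq_not_mem (by simp) (by simp) (by simp)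
    · rw [← walk_ad]
      exact .hit (by rw [walk_ad, ← mark_succ_true]; exact ⟨_, rfl⟩)

/-- The strand that enters a blown up vertex through the half-edge before the port. -/
theorem firstHit_of_edge_eq_rot_rot (hG : G.Realizes S) {d : G.Dart}
    (hd : G.edge d = G.rot (G.rot (G.port i))) :
    FirstHit G.walk (Set.range G.mark) d (G.mark (i, !G.isWhite (G.port i))) ∧
    FirstHit (G.blowup i h).walk (Set.range (G.blowup i h).mark) (old i h d)
      ((G.blowup i h).mark (i.succ.succAbove i, true)) := by
  constructor
  · have h1 : G.walk d = if G.isWhite (G.port i) then G.port i else G.rot (G.port i) := by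
      rw [walk_apply, hd, G.isWhite_rot, G.isWhite_rot, Equiv.symm_apply_apply,
        (hG.trivalent i).2]
    cases hw : G.isWhite (G.port i)
    · rw [hw, if_neg (by simp)] at h1
      have h2 : G.mark (i, true) = G.walk d := by rw [h1, mark_true, hw, if_neg (by simp)]
      rw [Bool.not_false, h2]
      exact .hit ⟨_, h2⟩
    · rw [hw, if_pos rfl] at h1
      refine .step ?_ ?_ <;> rw [h1]
      · rintro ⟨x, hx⟩
        exact hG.mark_ne_port i x hx
      · exact firstHit_bd i
  · rw [mark_self_true]
    refine .step ?_ ?_ <;> rw [walk_old_of_rot_rot_port hd]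
    · exact hG.sq_not_mem (by simp) (by simp) (by simp)
    · rw [← walk_bc]
      exact .hit (by rw [walk_bc, ← mark_self_true]; exact ⟨_, rfl⟩)

/-- Strands that do not start next to the blown up vertex persist. -/
theorem firstHit_old (hG : G.Realizes S) {d d' : G.Dart}
    (hd : FirstHit G.walk (Set.range G.mark) d d') (h1 : d ≠ G.bd i) (h2 : d ≠ G.port i)
    {x : Fin n × Bool} (hx : d' = G.mark x) :
    FirstHit (G.blowup i h).walk (Set.range (G.blowup i h).mark) (old i h d)
      ((G.blowup i h).mark (pushFin (G.isWhite (G.port i)) i x)) := by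
  have edge_ne_port : ∀ {d}, d ≠ G.bd i → G.edge d ≠ G.port i := fun h1 hc =>
    h1 (G.edge_edge.injective hc)
  -- If the walk enters the blown up vertex now, the side of entry determines both the old and the
  -- new target.
  have special : ∀ {d d'}, FirstHit G.walk (Set.range G.mark) d d' → d' = G.mark x →
      (G.edge d = G.rot (G.port i) ∨ G.edge d = G.rot (G.rot (G.port i))) →
      FirstHit (G.blowup i h).walk (Set.range (G.blowup i h).mark) (old i h d)
        ((G.blowup i h).mark (pushFin (G.isWhite (G.port i)) i x)) := by
    rintro d d' hd rfl (he | he)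
    · obtain ⟨a1, a2⟩ := hG.firstHit_of_edge_eq_rot (h := h) he
      rw [hG.mark_injective (hd.unique a1)]
      simpa [pushFin] using a2
    · obtain ⟨a1, a2⟩ := hG.firstHit_of_edge_eq_rot_rot (h := h) he
      rw [hG.mark_injective (hd.unique a1)]
      simpa [pushFin] using a2
  -- A step that leaves through a half-edge of the blown up vertex has entered through one, as
  -- turning permutes its half-edges.
  have orbit : ∀ {d}, G.walk d = G.rot (G.port i) ∨ G.walk d = G.rot (G.rot (G.port i)) ∨
      G.walk d = G.port i → G.edge d = G.port i ∨ G.edge d = G.rot (G.port i) ∨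
      G.edge d = G.rot (G.rot (G.port i)) := by
    intro d hd
    obtain ⟨g1, g2⟩ := h
    rw [walk_apply] at hd
    split_ifs at hd
    · rcases hd with hd | hd | hd
      · exact Or.inl (G.rot.injective hd)
      · exact Or.inr (Or.inl (G.rot.injective hd))
      · exact Or.inr (Or.inr (G.rot.injective (hd.trans g2.symm)))
    · simp only [Equiv.symm_apply_eq] at hd
      rcases hd with hd | hd | hd
      · exact Or.inr (Or.inr hd)
      · exact Or.inl (hd.trans g2)
      · exact Or.inr (Or.inl hd)
  induction hd with
  | @hit d hd =>
    by_cases he : G.edge d = G.rot (G.port i) ∨ G.edge d = G.rot (G.rot (G.port i))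
    · exact special (.hit hd) hx he
    push Not at he
    have hw := walk_old (h := h) (edge_ne_port h1) he.1 he.2
    have hx1 : x.1 ≠ i := by
      obtain ⟨j, u⟩ := x
      rintro rfl
      cases u
      · exact h2 (G.walk.injective (hx.trans (G.walk_port j).symm))
      · have := orbit (d := d) (by
          rcases mark_cases (G := G) j with h | h <;> rw [hx, h] <;> simp)
        have := edge_ne_port h1
        tauto
    have h3 : (G.blowup i h).mark (pushFin (G.isWhite (G.port i)) i x) =
        (G.blowup i h).walk (old i h d) := by
      rw [hw, hx, pushFin, if_neg hx1, hG.mark_succAbove hx1]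
    rw [h3]
    exact .hit ⟨_, h3⟩
  | @step d d' hd hy ih =>
    by_cases he : G.edge d = G.rot (G.port i) ∨ G.edge d = G.rot (G.rot (G.port i))
    · exact special (.step hd hy) hx he
    push Not at he
    have hw := walk_old (h := h) (edge_ne_port h1) he.1 he.2
    refine .step ?_ ?_ <;> rw [hw]
    · intro hc
      obtain ⟨y, -, hy⟩ := hG.mem_mark_of_old hc
      exact hd ⟨y, hy⟩
    · refine ih (fun hc => hd ⟨(i, false), hc.symm⟩) (fun hc => ?_) hx
      have := orbit (d := d) (by simp [hc])
      have := edge_ne_port h1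
      tauto

theorem blowup (hG : G.Realizes S) (i : Fin n) (h : G.TrivalentAt i) :
    (G.blowup i h).Realizes (S.blow i) where
  trivalent := by
    intro t
    rcases Fin.eq_self_or_eq_succAbove i.succ t with rfl | ⟨j, rfl⟩
    · rw [TrivalentAt, port_succ]
      exact ⟨fun hc => SquareDart.noConfusion (sq_injective i h hc), rfl⟩
    · rw [TrivalentAt, port_succAbove]
      by_cases hj : j = i
      · subst hj
        rw [rot_old_eq, if_pos rfl]
        exact ⟨(old_ne_sq _ _ _ _).symm, rfl⟩
      · obtain ⟨h1, h2, h3⟩ := hG.orbit_ne hj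
        rw [rot_old h1.1 h1.2.1 h1.2.2, rot_old h2.1 h2.2.1 h2.2.2, rot_old h3.1 h3.2.1 h3.2.2]
        exact ⟨fun hc => (hG.trivalent j).1 (old_injective _ _ hc),
          congrArg _ (hG.trivalent j).2⟩
  distinct := by
    intro s t hst
    rcases Fin.eq_self_or_eq_succAbove i.succ s with rfl | ⟨j, rfl⟩ <;>
      rcases Fin.eq_self_or_eq_succAbove i.succ t with rfl | ⟨l, rfl⟩
    · contradiction
    · rw [port_succ, port_succAbove]
      exact ⟨old_ne_sq _ _ _ _, old_ne_sq _ _ _ .da, old_ne_sq _ _ _ .dc⟩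
    · rw [port_succ, port_succAbove]
      refine ⟨(old_ne_sq _ _ _ _).symm, ?_⟩
      by_cases hj : j = i
      · subst hj
        rw [rot_old_eq, if_pos rfl]
        exact ⟨fun hc => SquareDart.noConfusion (sq_injective j h hc),
          fun hc => SquareDart.noConfusion (sq_injective j h (a₂ := .cb) hc)⟩
      · obtain ⟨h1, h2, h3⟩ := hG.orbit_ne hj
        rw [rot_old h1.1 h1.2.1 h1.2.2, rot_old h2.1 h2.2.1 h2.2.2]
        exact ⟨(old_ne_sq _ _ _ _).symm, (old_ne_sq _ _ _ _).symm⟩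
    · have hjl : j ≠ l := fun hc => hst (by rw [hc])
      obtain ⟨a1, a2, a3⟩ := hG.distinct j l hjl
      rw [port_succAbove, port_succAbove]
      refine ⟨fun hc => a1 (old_injective _ _ hc), ?_⟩
      by_cases hj : j = i
      · subst hj
        rw [rot_old_eq, if_pos rfl]
        exact ⟨old_ne_sq _ _ _ _, old_ne_sq _ _ _ .cb⟩
      · obtain ⟨h1, h2, h3⟩ := hG.orbit_ne hj
        rw [rot_old h1.1 h1.2.1 h1.2.2, rot_old h2.1 h2.2.1 h2.2.2]
        exact ⟨fun hc => a2 (old_injective _ _ hc), fun hc => a3 (old_injective _ _ hc)⟩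
  color := by
    intro t
    rcases Fin.eq_self_or_eq_succAbove i.succ t with rfl | ⟨j, rfl⟩
    · rw [port_succ, Fin.val_succ, white_blow_succ]
      rfl
    · rw [port_succAbove, succAbove_succ_val]
      rcases lt_trichotomy j i with hj | rfl | hj
      · obtain ⟨h1, -, -⟩ := hG.orbit_ne hj.ne
        have := Fin.lt_def.1 hj
        rw [isWhite_old h1.1 h1.2.1 h1.2.2, skip_of_lt (by omega), white_blow_of_lt _ hj, hG.color]
      · rw [isWhite_old_eq, if_pos rfl, skip_of_lt (by omega), white_blow_self]
      · obtain ⟨h1, -, -⟩ := hG.orbit_ne hj.ne'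
        have := Fin.lt_def.1 hj
        rw [isWhite_old h1.1 h1.2.1 h1.2.2, skip_of_le (by omega), white_blow_of_gt _ (by omega),
          hG.color, Nat.add_sub_cancel]
  hits := by
    have lifted : ∀ (d : G.Dart) (y : ℕ × Bool) (t : Fin n), (t : ℕ) = y.1 →
        FirstHit G.walk (Set.range G.mark) d (G.mark (t, y.2)) → d ≠ G.bd i → d ≠ G.port i →
        ∃ t' : Fin (n + 1), (t' : ℕ) = (push (S.white i) i y).1 ∧
          FirstHit (G.blowup i h).walk (Set.range (G.blowup i h).mark) (old i h d)
            ((G.blowup i h).mark (t', (push (S.white i) i y).2)) := by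
      rintro d ⟨_, v⟩ t rfl hd h1 h2
      have := hG.firstHit_old (h := h) hd h1 h2 rfl
      rw [hG.color] at this
      rw [pushFin_val (S.white i) i (t, v)]
      exact ⟨_, rfl, this⟩
    have skip_step : ∀ {x y}, FirstHit G.walk (Set.range G.mark) x y →
        G.walk x ∉ Set.range G.mark → FirstHit G.walk (Set.range G.mark) (G.walk x) y := by
      intro x y hxy hx
      cases hxy with
      | hit hc => exact absurd hc hx
      | step _ h1 => exact h1
    have hbd : G.walk (G.bd i) =
        if S.white i then G.rot (G.port i) else G.rot (G.rot (G.port i)) := by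
      rw [walk_apply, ← hG.color, port]
      split_ifs
      · rfl
      · rw [Equiv.symm_apply_eq, ← port, (hG.trivalent i).2]
    -- The strand leaving along the edge after the port starts at the mark `(i, true)` if the vertex
    -- is black; if it is white, this is the trip from `i` after one step. In `second` the colours
    -- are exchanged.
    have first : ∃ t : Fin n, (t : ℕ) = (S.next (i, !S.white i)).1 ∧
        FirstHit G.walk (Set.range G.mark) (G.rot (G.port i))
          (G.mark (t, (S.next (i, !S.white i)).2)) := by
      obtain ⟨t, h1, h2⟩ := hG.hits i (!S.white i)
      refine ⟨t, h1, ?_⟩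
      cases hw : S.white i <;> rw [hw] at h2 hbd
      · rwa [Bool.not_false, mark_true, hG.color, hw] at h2
      · rw [if_pos rfl] at hbd
        rw [← hbd]
        refine skip_step h2 ?_
        rintro ⟨x, hx⟩
        rw [hbd] at hx
        by_cases hx1 : x = (i, true)
        · rw [hx1, mark_true, hG.color, hw, if_pos rfl] at hx
          exact (hG.trivalent i).1 (G.rot.injective hx)
        · exact (hG.mark_ne hx1).2.1 hx
    have second : ∃ t : Fin n, (t : ℕ) = (S.next (i, S.white i)).1 ∧
        FirstHit G.walk (Set.range G.mark) (G.rot (G.rot (G.port i)))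
          (G.mark (t, (S.next (i, S.white i)).2)) := by
      obtain ⟨t, h1, h2⟩ := hG.hits i (S.white i)
      refine ⟨t, h1, ?_⟩
      cases hw : S.white i <;> rw [hw] at h2 hbd
      · rw [if_neg (by simp)] at hbd
        rw [← hbd]
        refine skip_step h2 ?_
        rintro ⟨x, hx⟩
        rw [hbd] at hx
        by_cases hx1 : x = (i, true)
        · rw [hx1, mark_true, hG.color, hw, if_neg (by simp)] at hx
          exact (hG.trivalent i).1 (G.rot.injective hx).symm
        · exact (hG.mark_ne hx1).2.2 hx
      · rwa [mark_true, hG.color, hw, if_pos rfl] at h2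
    have old_not_mem : ∀ d, (∀ x : Fin n × Bool, x ≠ (i, true) → G.mark x ≠ d) →
        old i h d ∉ Set.range (G.blowup i h).mark := fun d hd hc => by
      obtain ⟨x, h1, h2⟩ := hG.mem_mark_of_old hc
      exact hd x h1 h2
    intro s u
    rcases Fin.eq_self_or_eq_succAbove i.succ s with rfl | ⟨j, rfl⟩
    · rw [Fin.val_succ]
      cases u
      · rw [next_blow_succ, mark_succ_false]
        obtain ⟨t, h1, h2⟩ := second
        obtain ⟨t', h3, h4⟩ := lifted _ _ t h1 h2 (hG.bd_ne i i).2.2.symm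
          (rot_rot_port_ne i h)
        refine ⟨t', h3, .step ?_ ?_⟩ <;> rw [walk_new]
        · exact hG.sq_not_mem (by simp) (by simp) (by simp)
        refine .step ?_ ?_ <;> rw [walk_da]
        · exact hG.sq_not_mem (by simp) (by simp) (by simp)
        refine .step ?_ ?_ <;> rw [walk_ab]
        · exact old_not_mem _ fun x hx => (hG.mark_ne hx).2.2
        · exact h4
      · rw [next_blow_snd, mark_succ_true]
        refine ⟨i.succ.succAbove i, by rw [succAbove_succ_val, skip_of_lt (by omega)], ?_⟩
        refine .step ?_ ?_ <;> rw [walk_dc]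
        · exact old_not_mem _ fun x hx => (hG.mark_ne hx).1
        · rw [mark_succAbove_false, mark_false, ← walk_old_port i h]
          exact .hit ⟨(i.succ.succAbove i, false), by
            rw [walk_old_port, mark_succAbove_false, mark_false]⟩
    · rw [succAbove_succ_val]
      by_cases hj : j = i
      · subst hj
        rw [skip_of_lt (by omega)]
        cases u
        · rw [next_blow_self, mark_succAbove_false, mark_false]
          obtain ⟨t, h1, h2⟩ := first
          obtain ⟨t', h3, h4⟩ := lifted _ _ t h1 h2 (hG.bd_ne j j).2.1.symm h.1
          refine ⟨t', h3, .step ?_ ?_⟩ <;> rw [walk_old_of_port rfl]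
          · exact hG.sq_not_mem (by simp) (by simp) (by simp)
          refine .step ?_ ?_ <;> rw [walk_cb]
          · exact hG.sq_not_mem (by simp) (by simp) (by simp)
          refine .step ?_ ?_ <;> rw [walk_ba]
          · exact old_not_mem _ fun x hx => (hG.mark_ne hx).2.1
          · exact h4
        · rw [next_blow_fst, mark_self_true]
          refine ⟨j.succ, rfl, ?_⟩
          refine .step ?_ ?_ <;> rw [walk_cd]
          · exact hG.sq_not_mem (by simp) (by simp) (by simp)
          · rw [mark_succ_false, ← walk_out]
            exact .hit ⟨(j.succ, false), by rw [mark_succ_false, walk_out]⟩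
      · have hnext : (S.blow i).next (skip (i + 1) j, u) =
            push (S.white i) i (S.next (j, u)) := by
          have hne : (j : ℕ) ≠ i := fun hc => hj (Fin.ext hc)
          rcases lt_or_gt_of_ne hne with hlt | hlt
          · rw [skip_of_lt (by omega), next_blow_of_lt _ _ hlt]
          · rw [skip_of_le (by omega), next_blow_of_gt _ _ (by omega), Nat.add_sub_cancel]
        rw [hnext, hG.mark_succAbove hj]
        obtain ⟨t, h1, h2⟩ := hG.hits j u
        refine lifted _ _ t h1 h2 (fun hc => ?_) (hG.mark_ne_port i _)
        exact hj (congrArg Prod.fst (hG.mark_injective (a₂ := (i, false)) hc))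

end Realizes

end PlabicGraph

-- BCFW permutations as permutations of path pairs

open PlabicGraph

theorem BCFWGraph.exists_family {n k : ℕ} {G : PlabicGraph n} (h : BCFWGraph n k G) :
    ∃ S, StrandFamily n k S ∧ G.Realizes S := by
  induction h with
  | square => exact ⟨_, .init, square_realizes⟩
  | black hG i first last h color ih =>
    obtain ⟨S, h1, h2⟩ := ih
    have := StrandFamily.blow h1 (i := i) (by omega) (by omega)
    rw [← h2.color, color] at this
    exact ⟨_, this, h2.blowup i h⟩
  | white hG i first last h color ih =>
    obtain ⟨S, h1, h2⟩ := ih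
    have := StrandFamily.blow h1 (i := i) (by omega) (by omega)
    rw [← h2.color, color] at this
    exact ⟨_, this, h2.blowup i h⟩

theorem StrandFamily.exists_graph {n k : ℕ} {S : StrandState} (h : StrandFamily n k S) :
    ∃ G, BCFWGraph n k G ∧ G.Realizes S := by
  induction h with
  | init => exact ⟨_, .square, square_realizes⟩
  | @blow n k S h i first last ih =>
    obtain ⟨G, h1, h2⟩ := ih
    have hc := h2.color ⟨i, by omega⟩
    refine ⟨_, ?_, h2.blowup ⟨i, by omega⟩ (h2.trivalent _)⟩
    cases hw : S.white i
    · exact .black h1 _ (by simp; omega) (by simp; omega) _ (hc.trans hw)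
    · exact .white h1 _ (by simp; omega) (by simp; omega) _ (hc.trans hw)

theorem longCycle_sq_apply {n : ℕ} (hn : 2 ≤ n) (x : Fin n) {s : ℕ} (hs : s < n)
    (hx : (x : ℕ) = (s + 2) % n) : ((longCycle n ^ 2) x : ℕ) = s := by
  obtain ⟨m, rfl⟩ : ∃ m, n = m + 2 := ⟨n - 2, by omega⟩
  suffices h : (longCycle (m + 2) ^ 2) x = ⟨s, hs⟩ by rw [h]
  rw [longCycle, inv_pow, Equiv.Perm.inv_eq_iff_eq]
  ext
  rw [pow_two, Equiv.Perm.mul_apply, finRotate_apply, finRotate_apply, hx]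
  simp [Fin.val_add]

/-- Passes from graphs to strand states and on to their sorted form. Different blowup sequences may
give the same strand state, but the trips depend on the state alone. -/
theorem mem_bcfwPerms_iff {k n : ℕ} {π : DecPerm n} : π ∈ bcfwPerms k n ↔
    ∃ U L b σ S, PathPair U L b σ S ∧ L.length + 4 = n ∧ L.count Letter.V = k ∧ π.white = ∅ ∧
      ∀ s : Fin n, (π.perm s : ℕ) = σ s := by
  have key : ∀ {U L : List Letter} {b : ℕ} {σ : ℕ → ℕ} {S : StrandState} {G : PlabicGraph n},
      PathPair U L b σ S → L.length + 4 = n → G.Realizes S → ∀ s : Fin n,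
      ((longCycle n ^ 2 * G.trip) s : ℕ) = σ s := by
    rintro U L b σ S G h rfl hG s
    have h1 := h.firstHit_boundary s s.2
    have h2 := hG.trip_eq (s := s) (t := ⟨_, Nat.mod_lt (σ s + 2) (by omega)⟩) h1
    rw [Equiv.Perm.mul_apply, h2]
    exact longCycle_sq_apply (by omega) _ (h.perm_lt s s.2) rfl
  constructor
  · rintro ⟨G, hG, rfl⟩
    obtain ⟨S, h1, h2⟩ := hG.exists_family
    obtain ⟨U, L, b, σ, h3, h4, h5⟩ := h1.exists_pathPair
    exact ⟨U, L, b, σ, S, h3, h4, by omega, rfl, key h3 h4 h2⟩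
  · rintro ⟨U, L, b, σ, S, h1, rfl, rfl, h2, h3⟩
    obtain ⟨G, h4, h5⟩ := h1.family.exists_graph
    refine ⟨G, h4, DecPerm.ext (Equiv.ext fun s => Fin.ext ?_) h2⟩
    rw [h3]
    exact (key h1 rfl h5 s).symm

end BCFW


namespace BCFW

open Letter

/-! ### The diagrams of pairs of lattice paths -/

theorem rowLengths_append (w v : List Letter) :
    rowLengths (w ++ v) = (rowLengths w).map (· + v.count H) ++ rowLengths v := by
  induction w with
  | nil => simp [rowLengths]
  | cons a w ih => cases a <;> simp [rowLengths, ih]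

theorem rowLengths_replicate (t : ℕ) : rowLengths (List.replicate t H) = [] := by
  induction t with
  | zero => rfl
  | succ t ih => simpa [List.replicate_succ, rowLengths] using ih

theorem rowLen_borderDiagram (m : ℕ) (w : List Letter) (i : ℕ) :
    (borderDiagram m w).rowLen i = if h : i < (rowLengths w).length then (rowLengths w)[i] + m
      else 0 := by
  split_ifs with h
  · have := YoungDiagram.rowLen_ofRowLens (hw := rowLengths_sorted m w) ⟨i, by simpa using h⟩
    simpa [borderDiagram] using this
  · by_contra hne
    have h1 : (i, 0) ∈ borderDiagram m w := YoungDiagram.mem_iff_lt_rowLen.2 (by omega)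
    obtain ⟨h2, -⟩ := YoungDiagram.mem_ofRowLens.1 h1
    simp at h2
    exact h h2

theorem rowLen_borderDiagram_append_H (m : ℕ) (w : List Letter) (i : ℕ) :
    (borderDiagram m (w ++ [H])).rowLen i =
      if i < w.count V then (borderDiagram m w).rowLen i + 1 else 0 := by
  rw [rowLen_borderDiagram, rowLen_borderDiagram]
  simp only [rowLengths_append, ← rowLengths_length]
  by_cases h : i < (rowLengths w).length
  · simp [h, rowLengths]; omega
  · simp [h, rowLengths]

theorem rowLen_borderDiagram_insert_V (m : ℕ) (w : List Letter) (t i : ℕ) :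
    (borderDiagram m (w ++ V :: List.replicate t H)).rowLen i =
      if i = w.count V then t + m else (borderDiagram m (w ++ List.replicate t H)).rowLen i := by
  rw [rowLen_borderDiagram, rowLen_borderDiagram]
  simp only [rowLengths_append, ← rowLengths_length]
  rcases lt_trichotomy i (rowLengths w).length with h | rfl | h
  · simp [h, rowLengths, rowLengths_replicate, h.ne, Nat.lt_succ_of_lt h]
  · simp [rowLengths, rowLengths_replicate]
  · simp [rowLengths, rowLengths_replicate, h.ne', show ¬ i < (rowLengths w).length by omega,
      show ¬ i < (rowLengths w).length + 1 by omega]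

theorem rowLen_borderDiagram_of_le (m : ℕ) (w : List Letter) {i : ℕ} (h : w.count V ≤ i) :
    (borderDiagram m w).rowLen i = 0 := by
  rw [rowLen_borderDiagram, dif_neg (by rw [rowLengths_length]; omega)]

theorem le_rowLen_borderDiagram (m : ℕ) (w : List Letter) {i : ℕ} (h : i < w.count V) :
    m ≤ (borderDiagram m w).rowLen i := by
  rw [rowLen_borderDiagram, dif_pos (by rw [rowLengths_length]; omega)]
  omega

theorem rowLen_borderDiagram_le (m : ℕ) (w : List Letter) (i : ℕ) :
    (borderDiagram m w).rowLen i ≤ w.count H + m := by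
  rw [rowLen_borderDiagram]
  split_ifs with h
  · have := rowLengths_le w _ (List.getElem_mem h)
    omega
  · omega

theorem youngDiagram_ext_rowLen {μ ν : YoungDiagram} (h : ∀ i, μ.rowLen i = ν.rowLen i) : μ = ν := by
  ext ⟨i, j⟩
  rw [YoungDiagram.mem_cells, YoungDiagram.mem_cells, YoungDiagram.mem_iff_lt_rowLen,
    YoungDiagram.mem_iff_lt_rowLen, h]

/-- A final south step only adds a row of length 0, so a south step of the upper path leaves the
prescribed columns of zeros unchanged. -/
theorem borderDiagram_append_V (w : List Letter) :
    borderDiagram 0 (w ++ [V]) = borderDiagram 0 w := by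
  refine youngDiagram_ext_rowLen fun i => ?_
  have := rowLen_borderDiagram_insert_V 0 w 0 i
  simp only [List.replicate_zero, List.append_nil] at this
  rw [this]
  split_ifs with h
  · rw [rowLen_borderDiagram_of_le _ _ h.ge]
  · rfl

theorem colLen_eq_of_mem_iff {μ ν : YoungDiagram} {x y : ℕ}
    (h : ∀ r, (r, x) ∈ μ ↔ (r, y) ∈ ν) : μ.colLen x = ν.colLen y := by
  refine eq_of_forall_lt_iff fun r => ?_
  rw [← YoungDiagram.mem_iff_lt_colLen, ← YoungDiagram.mem_iff_lt_colLen, h]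

/-- The boxes that contain a `+` in the diagram with shape `μ`, where the zeros are
prescribed by `ν`. -/
def plusBoxes (μ ν : YoungDiagram) : Finset (ℕ × ℕ) := endBoxes μ ∪ innerBoxes μ ν

theorem mem_endBoxes {μ : YoungDiagram} {r x : ℕ} :
    (r, x) ∈ endBoxes μ ↔ x < μ.rowLen r ∧ (x = 0 ∨ x + 1 = μ.rowLen r) := by
  simp [endBoxes, YoungDiagram.mem_iff_lt_rowLen]

/-- The column that receives the next zeros. -/
def nextColumn (μ : YoungDiagram) (F : Finset (ℕ × ℕ)) (h : ℕ) : ℕ :=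
  ((Finset.range (μ.rowLen 0)).filter fun x => ∀ r < h, (r, x) ∈ μ.cells ∧ (r, x) ∉ F).sup id

theorem mem_placeColumn {μ : YoungDiagram} {F : Finset (ℕ × ℕ)} {h r x : ℕ} :
    (r, x) ∈ placeColumn μ F h ↔ (r, x) ∈ F ∨ (r < h ∧ x = nextColumn μ F h) := by
  simp only [placeColumn, nextColumn, Finset.mem_union, Finset.mem_image, Finset.mem_range,
    Prod.mk.injEq]
  constructor
  · rintro (h | ⟨_, h1, rfl, rfl⟩)
    · exact Or.inl h
    · exact Or.inr ⟨h1, rfl⟩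
  · rintro (h | ⟨h1, rfl⟩)
    · exact Or.inl h
    · exact Or.inr ⟨_, h1, rfl, rfl⟩

theorem mem_innerBoxes {μ ν : YoungDiagram} {r x : ℕ} :
    (r, x) ∈ innerBoxes μ ν ↔ (r, x) ∈ μ.cells \ filledBoxes μ ν ∧
      ((μ.cells \ filledBoxes μ ν).filter fun c' => c'.1 = r ∧ x < c'.2).card < 2 := by
  simp [innerBoxes]

theorem colLen_pos {ν : YoungDiagram} {h : ℕ} (hh : h ∈ (List.range (ν.rowLen 0)).map ν.colLen) :
    1 ≤ h := by
  simp only [List.mem_map, List.mem_range] at hh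
  obtain ⟨j, hj, rfl⟩ := hh
  exact YoungDiagram.mem_iff_lt_colLen.1 (YoungDiagram.mem_iff_lt_rowLen.2 hj)

-- Adding a bottom row to a diagram

section AddRow

variable {μ μ' : YoungDiagram} {k t : ℕ}

/-- Adding a row at the bottom of the shape. -/
structure IsRowAdded (μ μ' : YoungDiagram) (k t : ℕ) : Prop where
  bottom : μ'.rowLen k = t + 4
  other : ∀ r, r ≠ k → μ'.rowLen r = μ.rowLen r
  old : ∀ r, k ≤ r → μ.rowLen r = 0

/-- Columns of height at most `k` involve only rows above row `k`, so they are placed as before and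
the new row keeps only its two end boxes filled. -/
theorem IsRowAdded.foldl (hμ : IsRowAdded μ μ' k t) (l : List ℕ) (hl : ∀ h ∈ l, 1 ≤ h ∧ h ≤ k)
    {F F' : Finset (ℕ × ℕ)} (h1 : ∀ r x, r ≠ k → ((r, x) ∈ F' ↔ (r, x) ∈ F))
    (h2 : ∀ x, (k, x) ∈ F' ↔ x = 0 ∨ x = t + 3) :
    (∀ r x, r ≠ k → ((r, x) ∈ l.foldl (placeColumn μ') F' ↔ (r, x) ∈ l.foldl (placeColumn μ) F)) ∧
      ∀ x, (k, x) ∈ l.foldl (placeColumn μ') F' ↔ x = 0 ∨ x = t + 3 := by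
  induction l generalizing F F' with
  | nil => exact ⟨h1, h2⟩
  | cons h l ih =>
    obtain ⟨hh, hk⟩ := hl h (by simp)
    have hx : nextColumn μ' F' h = nextColumn μ F h := by
      rw [nextColumn, nextColumn, hμ.other 0 (by omega)]
      congr 1
      refine Finset.filter_congr fun x _ => forall₂_congr fun r hr => ?_
      rw [h1 r x (by omega), YoungDiagram.mem_cells, YoungDiagram.mem_cells,
        YoungDiagram.mem_iff_lt_rowLen, YoungDiagram.mem_iff_lt_rowLen, hμ.other r (by omega)]
    refine ih (fun h' hh' => hl h' (by simp [hh'])) (fun r x hr => ?_) (fun x => ?_)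
    · rw [mem_placeColumn, mem_placeColumn, h1 r x hr, hx]
    · rw [mem_placeColumn, h2 x, or_iff_left (by omega)]

theorem IsRowAdded.mem_plusBoxes (hμ : IsRowAdded μ μ' k t) {ν : YoungDiagram}
    (hν : ν.rowLen k = 0) :
    (∀ r x, r ≠ k → ((r, x) ∈ plusBoxes μ' ν ↔ (r, x) ∈ plusBoxes μ ν)) ∧
      ∀ x, (k, x) ∈ plusBoxes μ' ν ↔ x = 0 ∨ x = t + 1 ∨ x = t + 2 ∨ x = t + 3 := by
  have e1 : ∀ r x, r ≠ k → ((r, x) ∈ endBoxes μ' ↔ (r, x) ∈ endBoxes μ) := by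
    intro r x hr
    rw [mem_endBoxes, mem_endBoxes, hμ.other r hr]
  have e2 : ∀ x, (k, x) ∈ endBoxes μ' ↔ x = 0 ∨ x = t + 3 := by
    intro x
    rw [mem_endBoxes, hμ.bottom]
    omega
  obtain ⟨f1, f2⟩ := hμ.foldl ((List.range (ν.rowLen 0)).map ν.colLen) (fun h hh => by
    refine ⟨colLen_pos hh, ?_⟩
    simp only [List.mem_map] at hh
    obtain ⟨j, -, rfl⟩ := hh
    by_contra hlt
    have := YoungDiagram.mem_iff_lt_rowLen.1 (YoungDiagram.mem_iff_lt_colLen.2 (not_le.1 hlt))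
    omega) e1 e2
  change ∀ r x, r ≠ k → ((r, x) ∈ filledBoxes μ' ν ↔ (r, x) ∈ filledBoxes μ ν) at f1
  change ∀ x, (k, x) ∈ filledBoxes μ' ν ↔ x = 0 ∨ x = t + 3 at f2
  have g1 : ∀ r x, r ≠ k → ((r, x) ∈ μ'.cells \ filledBoxes μ' ν ↔
      (r, x) ∈ μ.cells \ filledBoxes μ ν) := by
    intro r x hr
    rw [Finset.mem_sdiff, Finset.mem_sdiff, f1 r x hr, YoungDiagram.mem_cells,
      YoungDiagram.mem_cells, YoungDiagram.mem_iff_lt_rowLen, YoungDiagram.mem_iff_lt_rowLen,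
      hμ.other r hr]
  have g2 : ∀ x, (k, x) ∈ μ'.cells \ filledBoxes μ' ν ↔ 1 ≤ x ∧ x ≤ t + 2 := by
    intro x
    rw [Finset.mem_sdiff, f2 x, YoungDiagram.mem_cells, YoungDiagram.mem_iff_lt_rowLen, hμ.bottom]
    omega
  constructor
  · intro r x hr
    rw [plusBoxes, plusBoxes, Finset.mem_union, Finset.mem_union, e1 r x hr, mem_innerBoxes,
      mem_innerBoxes, g1 r x hr]
    congr! 4
    ext ⟨r', x'⟩
    simp only [Finset.mem_filter]
    by_cases h : r' = r
    · subst h; rw [g1 _ _ hr]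
    · simp [h]
  · intro x
    have hc : ((μ'.cells \ filledBoxes μ' ν).filter fun c' => c'.1 = k ∧ x < c'.2).card =
        t + 2 - x ∨ x = 0 := by
      by_cases hx : x = 0
      · exact Or.inr hx
      left
      rw [show (μ'.cells \ filledBoxes μ' ν).filter (fun c' => c'.1 = k ∧ x < c'.2) =
        (Finset.Ioc x (t + 2)).image fun y => (k, y) by
          ext ⟨r', x'⟩
          simp only [Finset.mem_filter, Finset.mem_image, Finset.mem_Ioc, Prod.mk.injEq]
          constructor
          · rintro ⟨h1, rfl, h2⟩
            have := (g2 x').1 h1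
            exact ⟨x', by omega, rfl, rfl⟩
          · rintro ⟨y, h1, rfl, rfl⟩
            exact ⟨(g2 y).2 (by omega), rfl, h1.1⟩,
        Finset.card_image_of_injective _ (fun a b h => by simpa using h), Nat.card_Ioc]
    rw [plusBoxes, Finset.mem_union, e2, mem_innerBoxes, g2]
    omega

end AddRow

end BCFW


namespace BCFW

open Letter

-- Adding a full column of zeros to a diagram

section AddColumn

variable {μ μ' ν ν' : YoungDiagram} {k : ℕ}

theorem skip_strictMono (c : ℕ) : StrictMono (skip c) := by
  intro a b h
  simp only [skip]
  split_ifs <;> omega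

theorem skip_ne (c s : ℕ) : skip c s ≠ c := by
  simp only [skip]
  split_ifs <;> omega

theorem forall_skip (c : ℕ) (p : ℕ → Prop) (hc : p c) (h : ∀ s, p (skip c s)) (x : ℕ) : p x := by
  rcases cases_skip c x with rfl | ⟨s, rfl, -⟩
  exacts [hc, h s]

/-- Lengthening all rows by one box. -/
structure IsColumnAdded (μ μ' : YoungDiagram) (k : ℕ) : Prop where
  pos : 0 < k
  row : ∀ r < k, μ'.rowLen r = μ.rowLen r + 1
  two_le : ∀ r < k, 2 ≤ μ.rowLen r
  below : ∀ r, k ≤ r → μ'.rowLen r = 0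
  below_old : ∀ r, k ≤ r → μ.rowLen r = 0

/-- A set of boxes is obtained from another one by insertion of a column. -/
structure IsShifted (c k : ℕ) (F F' : Finset (ℕ × ℕ)) : Prop where
  skip : ∀ r y, (r, skip c y) ∈ F' ↔ (r, y) ∈ F
  new : ∀ r, (r, c) ∈ F' ↔ r < k

/-- The distinguished column `c` is that of the last box of the old bottom row. It meets every row
of both shapes, so lengthening each row at its end has the same effect on the shape as inserting a
column at `c`. -/
theorem IsColumnAdded.mem_skip (hμ : IsColumnAdded μ μ' k) (r y : ℕ) :
    (r, skip (μ.rowLen (k - 1) - 1) y) ∈ μ' ↔ (r, y) ∈ μ := by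
  rw [YoungDiagram.mem_iff_lt_rowLen, YoungDiagram.mem_iff_lt_rowLen]
  rcases lt_or_ge r k with h | h
  · have h1 := hμ.row r h
    have h2 := hμ.two_le r h
    have h3 := μ.rowLen_anti r (k - 1) (by omega)
    simp only [skip]
    split_ifs <;> omega
  · rw [hμ.below r h, hμ.below_old r h]
    omega

theorem IsColumnAdded.mem_new (hμ : IsColumnAdded μ μ' k) (r : ℕ) :
    (r, μ.rowLen (k - 1) - 1) ∈ μ' ↔ r < k := by
  rw [YoungDiagram.mem_iff_lt_rowLen]
  rcases lt_or_ge r k with h | h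
  · have h1 := hμ.row r h
    have h3 := μ.rowLen_anti r (k - 1) (by omega)
    omega
  · rw [hμ.below r h]
    omega

theorem IsColumnAdded.isShifted (hμ : IsColumnAdded μ μ' k) :
    IsShifted (μ.rowLen (k - 1) - 1) k μ.cells μ'.cells :=
  ⟨fun r y => by simpa using hμ.mem_skip r y, fun r => by simpa using hμ.mem_new r⟩

theorem IsColumnAdded.isShifted_endBoxes (hμ : IsColumnAdded μ μ' k) :
    IsShifted (μ.rowLen (k - 1) - 1) 0 (endBoxes μ) (endBoxes μ') := by
  have hk := hμ.two_le (k - 1) (by have := hμ.pos; omega)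
  constructor
  · intro r y
    rw [mem_endBoxes, mem_endBoxes]
    rcases lt_or_ge r k with h | h
    · have h1 := hμ.row r h
      have h3 := μ.rowLen_anti r (k - 1) (by omega)
      simp only [skip]
      split_ifs <;> try simp only [false_or]
      all_goals omega
    · rw [hμ.below r h, hμ.below_old r h]
      omega
  · intro r
    rw [mem_endBoxes]
    rcases lt_or_ge r k with h | h
    · have h1 := hμ.row r h
      have h3 := μ.rowLen_anti r (k - 1) (by omega)
      omega
    · rw [hμ.below r h]
      omega

/-- A column of full height must fit into the bottom row, which ends at `c + 1` with a box already
filled. Column `c` is the next candidate, and no row has an end box there. -/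
theorem IsColumnAdded.isShifted_first (hμ : IsColumnAdded μ μ' k) :
    IsShifted (μ.rowLen (k - 1) - 1) k (endBoxes μ) (placeColumn μ' (endBoxes μ') k) := by
  have hs := hμ.isShifted_endBoxes
  have hk := hμ.two_le (k - 1) (by have := hμ.pos; omega)
  have hx : nextColumn μ' (endBoxes μ') k = μ.rowLen (k - 1) - 1 := by
    apply le_antisymm
    · refine Finset.sup_le fun x hx => ?_
      rw [Finset.mem_filter] at hx
      obtain ⟨h1, h2⟩ := hx.2 (k - 1) (by have := hμ.pos; omega)
      have h3 := hμ.row (k - 1) (by have := hμ.pos; omega)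
      rw [mem_endBoxes] at h2
      rw [YoungDiagram.mem_cells, YoungDiagram.mem_iff_lt_rowLen] at h1
      simp only [id]
      omega
    · refine Finset.le_sup (f := id) (b := μ.rowLen (k - 1) - 1) ?_
      rw [Finset.mem_filter, Finset.mem_range, ← YoungDiagram.mem_iff_lt_rowLen]
      exact ⟨(hμ.mem_new 0).2 hμ.pos, fun r hr => ⟨by simpa using (hμ.mem_new r).2 hr,
        fun h => by simpa using (hs.new r).1 h⟩⟩
  constructor
  · intro r y
    rw [mem_placeColumn, hs.skip, hx, or_iff_left]
    exact fun h => skip_ne _ _ h.2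
  · intro r
    rw [mem_placeColumn, hs.new, hx]
    simp

/-- The new column is already filled in its top row, so no further column can be placed there; the
other candidates correspond under `skip c`, which preserves the rightmost one. -/
theorem IsColumnAdded.isShifted_placeColumn (hμ : IsColumnAdded μ μ' k) {F F' : Finset (ℕ × ℕ)}
    (hs : IsShifted (μ.rowLen (k - 1) - 1) k F F') {h : ℕ} (hh : 1 ≤ h) :
    IsShifted (μ.rowLen (k - 1) - 1) k (placeColumn μ F h) (placeColumn μ' F' h) := by
  have hk := hμ.two_le (k - 1) (by have := hμ.pos; omega)
  set c := μ.rowLen (k - 1) - 1 with hc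
  have hx : nextColumn μ' F' h = skip c (nextColumn μ F h) := by
    -- The default 0 of an empty supremum is respected, because `c > 0` and hence `skip c 0 = 0`.
    rw [nextColumn, nextColumn, Finset.apply_sup_eq_sup_comp_of_linearOrder (skip c)
      (skip_strictMono c).monotone (skip_of_lt (by change 0 < c; omega))]
    rw [show (Finset.range (μ'.rowLen 0)).filter
        (fun x => ∀ r < h, (r, x) ∈ μ'.cells ∧ (r, x) ∉ F') =
        ((Finset.range (μ.rowLen 0)).filter
          (fun x => ∀ r < h, (r, x) ∈ μ.cells ∧ (r, x) ∉ F)).image (skip c) by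
      ext x
      induction x using forall_skip c with
      | hc =>
        rw [Finset.mem_filter, Finset.mem_image]
        constructor
        · rintro ⟨-, h2⟩
          exact absurd ((hs.new 0).2 hμ.pos) (h2 0 hh).2
        · rintro ⟨y, -, hy⟩
          exact absurd hy (skip_ne _ _)
      | h y =>
        rw [(skip_injective c).mem_finset_image, Finset.mem_filter, Finset.mem_filter,
          Finset.mem_range, Finset.mem_range, ← YoungDiagram.mem_iff_lt_rowLen,
          ← YoungDiagram.mem_iff_lt_rowLen, hμ.mem_skip]
        have e : ∀ r, (r, skip c y) ∈ μ'.cells ↔ (r, y) ∈ μ.cells := fun r =>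
          hμ.isShifted.skip r y
        simp only [hs.skip, e]]
    rw [Finset.sup_image]
    rfl
  constructor
  · intro r y
    rw [mem_placeColumn, mem_placeColumn, hs.skip, hx, (skip_injective c).eq_iff]
  · intro r
    rw [mem_placeColumn, hs.new, hx, or_iff_left]
    exact fun h => skip_ne _ _ h.2.symm

theorem IsColumnAdded.isShifted_foldl (hμ : IsColumnAdded μ μ' k) (l : List ℕ)
    (hl : ∀ h ∈ l, 1 ≤ h) {F F' : Finset (ℕ × ℕ)}
    (hs : IsShifted (μ.rowLen (k - 1) - 1) k F F') :
    IsShifted (μ.rowLen (k - 1) - 1) k (l.foldl (placeColumn μ) F)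
      (l.foldl (placeColumn μ') F') := by
  induction l generalizing F F' with
  | nil => exact hs
  | cons h l ih =>
    exact ih (fun h' hh' => hl h' (by simp [hh'])) (hμ.isShifted_placeColumn hs (hl h (by simp)))

theorem colLen_heights (hk : 0 < k) (h1 : ∀ r < k, ν'.rowLen r = ν.rowLen r + 1)
    (h2 : ∀ r, k ≤ r → ν'.rowLen r = 0) (h3 : ∀ r, k ≤ r → ν.rowLen r = 0) :
    (List.range (ν'.rowLen 0)).map ν'.colLen =
      k :: (List.range (ν.rowLen 0)).map ν.colLen := by
  rw [h1 0 hk, List.range_succ_eq_map, List.map_cons, List.map_map]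
  congr 1
  · refine eq_of_forall_lt_iff fun r => ?_
    rw [← YoungDiagram.mem_iff_lt_colLen, YoungDiagram.mem_iff_lt_rowLen]
    rcases lt_or_ge r k with h | h
    · rw [h1 r h]; omega
    · rw [h2 r h]; omega
  · congr 1
    funext j
    refine colLen_eq_of_mem_iff fun r => ?_
    rw [YoungDiagram.mem_iff_lt_rowLen, YoungDiagram.mem_iff_lt_rowLen]
    rcases lt_or_ge r k with h | h
    · rw [h1 r h]; omega
    · rw [h2 r h, h3 r h]; omega

/-- The new column has no empty boxes left for step 3, and the relative order of the other boxes in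
a row is unchanged, so the same ones receive a +. -/
theorem IsColumnAdded.isShifted_plusBoxes (hμ : IsColumnAdded μ μ' k)
    (hν : (List.range (ν'.rowLen 0)).map ν'.colLen =
      k :: (List.range (ν.rowLen 0)).map ν.colLen) :
    IsShifted (μ.rowLen (k - 1) - 1) 0 (plusBoxes μ ν) (plusBoxes μ' ν') := by
  have he := hμ.isShifted_endBoxes
  have hf : IsShifted (μ.rowLen (k - 1) - 1) k (filledBoxes μ ν) (filledBoxes μ' ν') := by
    rw [filledBoxes, filledBoxes, hν, List.foldl_cons]
    exact hμ.isShifted_foldl _ (fun h hh => colLen_pos hh) hμ.isShifted_first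
  set c := μ.rowLen (k - 1) - 1
  have hs : IsShifted c 0 (μ.cells \ filledBoxes μ ν) (μ'.cells \ filledBoxes μ' ν') :=
    ⟨fun r y => by rw [Finset.mem_sdiff, Finset.mem_sdiff, hμ.isShifted.skip, hf.skip],
      fun r => by rw [Finset.mem_sdiff, hμ.isShifted.new, hf.new]; omega⟩
  constructor
  · intro r y
    rw [plusBoxes, plusBoxes, Finset.mem_union, Finset.mem_union, he.skip, mem_innerBoxes,
      mem_innerBoxes, hs.skip]
    rw [show (μ'.cells \ filledBoxes μ' ν').filter (fun c' => c'.1 = r ∧ skip c y < c'.2) =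
      ((μ.cells \ filledBoxes μ ν).filter (fun c' => c'.1 = r ∧ y < c'.2)).image
        (Prod.map id (skip c)) by
      ext ⟨r', x⟩
      induction x using forall_skip c with
      | hc =>
        rw [Finset.mem_filter, hs.new, Finset.mem_image]
        constructor
        · rintro ⟨h, -⟩
          omega
        · rintro ⟨⟨_, x⟩, -, hx⟩
          exact absurd (congrArg Prod.snd hx) (skip_ne _ _)
      | h y' =>
        rw [show (r', skip c y') = Prod.map id (skip c) (r', y') from rfl,
          (Function.injective_id.prodMap (skip_injective c)).mem_finset_image,
          Finset.mem_filter, Finset.mem_filter]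
        simp [hs.skip, (skip_strictMono c).lt_iff_lt],
      Finset.card_image_of_injective _ (Function.injective_id.prodMap (skip_injective c))]
  · intro r
    rw [plusBoxes, Finset.mem_union, he.new, mem_innerBoxes, hs.new]
    simp

end AddColumn

end BCFW


namespace BCFW

open Letter

/-! ### The permutation of a diagram -/

/-- The labels of the edges of the northwest border, with `m` columns in the rectangle. -/
def edgeLabel (m : ℕ) (μ : YoungDiagram) : ℕ ⊕ ℕ → ℕ
  | Sum.inl i => i + (m - μ.rowLen i)
  | Sum.inr j => (m - 1 - j) + μ.colLen j

/-- The pipes of a filling connect labels according to a given permutation. -/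
structure Connects (k m : ℕ) (μ : YoungDiagram) (P : Finset (ℕ × ℕ)) (σ : ℕ → ℕ) : Prop where
  row : ∀ i < k, edgeLabel m μ (exitWest P i (μ.rowLen i)) = σ (edgeLabel m μ (Sum.inl i))
  col : ∀ j < m, edgeLabel m μ (exitNorth P (μ.colLen j) j) = σ (edgeLabel m μ (Sum.inr j))

theorem exitWest_succ_of_mem {P : Finset (ℕ × ℕ)} {i j : ℕ} (h : (i, j) ∈ P) :
    exitWest P i (j + 1) = exitNorth P i j := by
  rw [exitWest, if_pos h]

theorem exitWest_succ_of_notMem {P : Finset (ℕ × ℕ)} {i j : ℕ} (h : (i, j) ∉ P) :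
    exitWest P i (j + 1) = exitWest P i j := by
  rw [exitWest, if_neg h]

theorem exitNorth_succ_of_mem {P : Finset (ℕ × ℕ)} {i j : ℕ} (h : (i, j) ∈ P) :
    exitNorth P (i + 1) j = exitWest P i j := by
  rw [exitNorth, if_pos h]

theorem exitNorth_succ_of_notMem {P : Finset (ℕ × ℕ)} {i j : ℕ} (h : (i, j) ∉ P) :
    exitNorth P (i + 1) j = exitNorth P i j := by
  rw [exitNorth, if_neg h]

/-- Pipes running west cross the inserted column straight, so every pipe follows its old course with
the column indices relabelled. -/
theorem IsShifted.exit {c : ℕ} {P P' : Finset (ℕ × ℕ)} (hs : IsShifted c 0 P P') (hc : 0 < c)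
    (N : ℕ) : ∀ i j, i + j = N →
      exitWest P' i (BCFW.skip c j) = Sum.map id (BCFW.skip c) (exitWest P i j) ∧
      exitNorth P' i (BCFW.skip c j) = Sum.map id (BCFW.skip c) (exitNorth P i j) := by
  induction N using Nat.strong_induction_on with
  | _ N ih =>
    intro i j hN
    constructor
    · rcases j with _ | j
      · rw [skip_of_lt hc]
        simp [exitWest]
      -- When `j + 1 = c`, the step from `c + 1` first crosses the zero in column `c`.
      · have e : exitWest P' i (BCFW.skip c (j + 1)) = if (i, BCFW.skip c j) ∈ P' then
            exitNorth P' i (BCFW.skip c j) else exitWest P' i (BCFW.skip c j) := by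
          rcases lt_trichotomy (j + 1) c with h | rfl | h
          · rw [skip_of_lt h, skip_of_lt (by omega), exitWest]
          · rw [skip_of_le le_rfl, skip_of_lt (by omega),
              exitWest_succ_of_notMem fun h => absurd ((hs.new i).1 h) (by omega), exitWest]
          · rw [skip_of_le h.le, skip_of_le (by omega), exitWest]
        obtain ⟨h1, h2⟩ := ih (i + j) (by omega) i j rfl
        rw [e, exitWest]
        simp only [hs.skip, h1, h2]
        split_ifs <;> rfl
    · rcases i with _ | i
      · simp [exitNorth]
      · obtain ⟨h1, h2⟩ := ih (i + j) (by omega) i j rfl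
        rw [exitNorth, exitNorth]
        simp only [hs.skip, h1, h2]
        split_ifs <;> rfl

theorem IsShifted.exitNorth_new {c : ℕ} {P P' : Finset (ℕ × ℕ)} (hs : IsShifted c 0 P P')
    (i : ℕ) : exitNorth P' i c = Sum.inr c := by
  induction i with
  | zero => rw [exitNorth]
  | succ i ih =>
    rw [exitNorth_succ_of_notMem fun h => absurd ((hs.new i).1 h) (by omega), ih]

theorem exit_congr {k : ℕ} {P P' : Finset (ℕ × ℕ)} (h : ∀ r x, r < k → ((r, x) ∈ P' ↔ (r, x) ∈ P))
    (N : ℕ) : ∀ i j, i + j = N → (i < k → exitWest P' i j = exitWest P i j) ∧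
      (i ≤ k → exitNorth P' i j = exitNorth P i j) := by
  induction N using Nat.strong_induction_on with
  | _ N ih =>
    intro i j hN
    constructor
    · intro hi
      rcases j with _ | j
      · rw [exitWest, exitWest]
      · obtain ⟨h1, h2⟩ := ih (i + j) (by omega) i j rfl
        rw [exitWest, exitWest, h1 hi, h2 hi.le]
        simp only [h _ _ hi]
    · intro hi
      rcases i with _ | i
      · rw [exitNorth, exitNorth]
      · obtain ⟨h1, h2⟩ := ih (i + j) (by omega) i j rfl
        rw [exitNorth, exitNorth, h1 (by omega), h2 (by omega)]
        simp only [h i _ (by omega)]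

theorem lt_colLen_iff {μ : YoungDiagram} {r x : ℕ} : r < μ.colLen x ↔ x < μ.rowLen r := by
  rw [← YoungDiagram.mem_iff_lt_colLen, YoungDiagram.mem_iff_lt_rowLen]

theorem colLen_le_of_rowLen {μ : YoungDiagram} {k : ℕ} (h : μ.rowLen k = 0) (x : ℕ) :
    μ.colLen x ≤ k := by
  by_contra hlt
  have := lt_colLen_iff.1 (not_le.1 hlt)
  omega

theorem colLen_eq_of_lt {μ : YoungDiagram} {k x : ℕ} (h : μ.rowLen k = 0)
    (hx : ∀ r < k, x < μ.rowLen r) : μ.colLen x = k := by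
  refine le_antisymm (colLen_le_of_rowLen h x) ?_
  by_contra hlt
  exact lt_irrefl _ (lt_colLen_iff.2 (hx _ (not_le.1 hlt)))

-- The permutation of the pipes after adding a column or a row

section Steps

variable {μ μ' : YoungDiagram} {P P' : Finset (ℕ × ℕ)} {k m b t : ℕ} {σ : ℕ → ℕ}

/-- Columns to the left of the new one get their labels raised, since labels of columns count from
the right; rows and columns to its right keep theirs. The hypothesis `hb` says that `b` is the label
of the new column. -/
theorem IsColumnAdded.edgeLabel_skip (hμ : IsColumnAdded μ μ' k) (hm : ∀ r, μ.rowLen r ≤ m)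
    (hb : b + μ.rowLen (k - 1) = k + m + 1) (e : ℕ ⊕ ℕ) (he : ∀ i, e = Sum.inl i → i < k) :
    edgeLabel (m + 1) μ' (Sum.map id (skip (μ.rowLen (k - 1) - 1)) e) =
      skip b (edgeLabel m μ e) := by
  have hk := hμ.two_le (k - 1) (by have := hμ.pos; omega)
  have hm' := hm (k - 1)
  have hpos := hμ.pos
  rcases e with i | j
  · have hi := he i rfl
    have h1 := hμ.row i hi
    have h3 := μ.rowLen_anti i (k - 1) (by omega)
    have := hm i
    simp only [edgeLabel, Sum.map_inl, id]
    rw [skip_of_lt (by omega)]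
    omega
  · simp only [edgeLabel, Sum.map_inr]
    rw [colLen_eq_of_mem_iff fun r => hμ.mem_skip r j]
    have h1 := colLen_le_of_rowLen (hμ.below_old k le_rfl) j
    rcases lt_or_ge j (μ.rowLen (k - 1) - 1) with h | h
    · have h2 : μ.colLen j = k := colLen_eq_of_lt (hμ.below_old k le_rfl) fun r hr => by
        have := μ.rowLen_anti r (k - 1) (by omega)
        omega
      rw [skip_of_lt h, skip_of_le (by omega)]
      omega
    · rw [skip_of_le h, skip_of_lt (by omega)]
      omega

theorem Connects.columnAdded (h : Connects k m μ P σ) (hμ : IsColumnAdded μ μ' k)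
    (hs : IsShifted (μ.rowLen (k - 1) - 1) 0 P P') (hm : ∀ r, μ.rowLen r ≤ m)
    (hb : b + μ.rowLen (k - 1) = k + m + 1) :
    Connects k (m + 1) μ' P' (insertFixed b σ) := by
  have hk := hμ.two_le (k - 1) (by have := hμ.pos; omega)
  have lab := hμ.edgeLabel_skip hm hb
  constructor
  · intro i hi
    have h1 := μ.rowLen_anti i (k - 1) (by omega)
    have e1 := lab (Sum.inl i) (by simpa using hi)
    rw [Sum.map_inl, id] at e1
    rw [e1, insertFixed_skip, ← h.row i hi, hμ.row i hi, ← lab]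
    · rw [show μ.rowLen i + 1 = skip (μ.rowLen (k - 1) - 1) (μ.rowLen i) by
        rw [skip_of_le (by omega)], (hs.exit (by omega) _ _ _ rfl).1]
    · intro a ha
      exact ((exit_bounds P _ i _ rfl).1.1 a ha).trans_lt hi
  · intro j hj
    rcases cases_skip (μ.rowLen (k - 1) - 1) j with rfl | ⟨j, rfl, hj'⟩
    · rw [hs.exitNorth_new]
      have h2 : edgeLabel (m + 1) μ' (Sum.inr (μ.rowLen (k - 1) - 1)) = b := by
        have := hm (k - 1)
        simp only [edgeLabel]
        rw [show μ'.colLen (μ.rowLen (k - 1) - 1) = k from eq_of_forall_lt_iff fun r => by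
          rw [← YoungDiagram.mem_iff_lt_colLen, hμ.mem_new]]
        omega
      rw [h2, insertFixed_self]
    · have := hm (k - 1)
      have hj := hj' m (by omega) hj
      have e1 := lab (Sum.inr j) (by simp)
      rw [Sum.map_inr] at e1
      rw [e1, insertFixed_skip, ← h.col j hj, ← lab, (hs.exit (by omega) _ _ _ rfl).2.symm,
        colLen_eq_of_mem_iff fun r => hμ.mem_skip r j]
      intro a ha
      have := (exit_bounds P _ (μ.colLen j) j rfl).2.1 a ha
      have := colLen_le_of_rowLen (hμ.below_old k le_rfl) j
      omega

theorem IsRowAdded.colLen_of_lt (hμ : IsRowAdded μ μ' k t) {j : ℕ} (hj : j < t + 4) :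
    μ.colLen j = k ∧ μ'.colLen j = k + 1 := by
  have h1 := hμ.bottom
  constructor
  · refine colLen_eq_of_lt (hμ.old k le_rfl) fun r hr => ?_
    rw [← hμ.other r hr.ne]
    have := μ'.rowLen_anti r k hr.le
    omega
  · refine colLen_eq_of_lt ((hμ.other _ (by omega)).trans (hμ.old _ (by omega))) fun r hr => ?_
    have := μ'.rowLen_anti r k (by omega)
    omega

theorem IsRowAdded.colLen_of_le (hμ : IsRowAdded μ μ' k t) {j : ℕ} (hj : t + 4 ≤ j) :
    μ'.colLen j = μ.colLen j := by
  refine eq_of_forall_lt_iff fun r => ?_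
  rw [lt_colLen_iff, lt_colLen_iff]
  by_cases h : r = k
  · subst h
    rw [hμ.bottom, hμ.old r le_rfl]
    omega
  · rw [hμ.other r h]

theorem IsRowAdded.edgeLabel_inl (hμ : IsRowAdded μ μ' k t) (hm : ∀ r, μ'.rowLen r ≤ m) {i : ℕ}
    (hi : i < k) : edgeLabel m μ' (Sum.inl i) = edgeLabel m μ (Sum.inl i) ∧
      edgeLabel m μ (Sum.inl i) + t + 4 < k + m := by
  have h1 := hμ.bottom
  have h2 := hm i
  have h3 := μ'.rowLen_anti i k hi.le
  have h4 := hμ.other i hi.ne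
  simp only [edgeLabel]
  omega

theorem IsRowAdded.edgeLabel_inr_of_lt (hμ : IsRowAdded μ μ' k t) (hm : ∀ r, μ'.rowLen r ≤ m)
    {j : ℕ} (hj : j < t + 4) : edgeLabel m μ' (Sum.inr j) = k + m - j ∧
      edgeLabel m μ (Sum.inr j) = k + m - 1 - j := by
  have h1 := hμ.bottom
  have h2 := hm k
  simp only [edgeLabel, hμ.colLen_of_lt hj]
  omega

theorem IsRowAdded.edgeLabel_inr_of_le (hμ : IsRowAdded μ μ' k t) {j : ℕ} (hj : t + 4 ≤ j)
    (hjm : j < m) : edgeLabel m μ' (Sum.inr j) = edgeLabel m μ (Sum.inr j) ∧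
      edgeLabel m μ (Sum.inr j) + t + 4 < k + m := by
  have := colLen_le_of_rowLen (hμ.old k le_rfl) j
  simp only [edgeLabel, hμ.colLen_of_le hj, true_and]
  omega

theorem IsRowAdded.edgeLabel_skip (hμ : IsRowAdded μ μ' k t) (hm : ∀ r, μ'.rowLen r ≤ m)
    (e : ℕ ⊕ ℕ) (he : ∀ i, e = Sum.inl i → i < k) (he' : ∀ j, e = Sum.inr j → j < m) :
    edgeLabel m μ' e = skip (k + m - (t + 4)) (edgeLabel m μ e) := by
  have h1 := hμ.bottom
  have h2 := hm k
  rcases e with i | j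
  · have := hμ.edgeLabel_inl hm (he i rfl)
    rw [skip_of_lt (by omega)]
    omega
  · rcases lt_or_ge j (t + 4) with h | h
    · have := hμ.edgeLabel_inr_of_lt hm h
      rw [skip_of_le (by omega)]
      omega
    · have := hμ.edgeLabel_inr_of_le h (he' j rfl)
      rw [skip_of_lt (by omega)]
      omega

/-- In the bottom row, the pipe from the row edge turns up in the last column, the pipes from the
last three columns each turn west and then up at the next + to the left, and the pipe from the first
column leaves at the left of the row. The other columns pass straight through. Above this row the
old pipes take over, which is the cycle in `addRow`. -/
theorem Connects.rowAdded (h : Connects k m μ P σ) (hμ : IsRowAdded μ μ' k t)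
    (hm : ∀ r, μ'.rowLen r ≤ m) (hP : ∀ r x, r ≠ k → ((r, x) ∈ P' ↔ (r, x) ∈ P))
    (hP' : ∀ x, (k, x) ∈ P' ↔ x = 0 ∨ x = t + 1 ∨ x = t + 2 ∨ x = t + 3) :
    Connects (k + 1) m μ' P' (addRow (k + m - (t + 4)) (k + m) σ) := by
  have h2 := hm k
  rw [hμ.bottom] at h2
  have lab := hμ.edgeLabel_skip hm
  set r := k + m - (t + 4) with hr
  -- The label of the new row is `r`; the columns `t + 3`, `t + 2`, `t + 1` and `0` carry the labels
  -- `r + 1`, `r + 2`, `r + 3` and `k + m`.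
  have hN : k + m = r + t + 4 := by omega
  have cong := fun i j => exit_congr (fun r x hr => hP r x (ne_of_lt hr)) _ i j rfl
  have north : ∀ j < m, edgeLabel m μ' (exitNorth P (μ.colLen j) j) =
      skip r (σ (edgeLabel m μ (Sum.inr j))) := by
    intro j hj
    rw [← h.col j hj]
    have h3 := colLen_le_of_rowLen (hμ.old k le_rfl) j
    have h4 := (exit_bounds P _ (μ.colLen j) j rfl).2
    exact lab _ (fun i hi => by have := h4.1 i hi; omega) (fun i hi => by have := h4.2 i hi; omega)
  have bottom : ∀ j < t + 4, edgeLabel m μ' (exitNorth P' k j) = skip r (σ (k + m - 1 - j)) := by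
    intro j hj
    have := north j (by omega)
    rw [(hμ.colLen_of_lt hj).1, (hμ.edgeLabel_inr_of_lt hm hj).2] at this
    rw [(cong k j).2 le_rfl, this]
  -- Going west from column `t + 1`, a pipe crosses the zeros of the new row up to the + in its
  -- first box.
  have west : ∀ x ≤ t, exitWest P' k (x + 1) = exitNorth P' k 0 := by
    intro x
    induction x with
    | zero => exact fun _ => exitWest_succ_of_mem ((hP' 0).2 (by simp))
    | succ x ih =>
      intro hx
      rw [exitWest_succ_of_notMem fun hc => by have := (hP' _).1 hc; omega, ih (by omega)]
  constructor
  · intro i hi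
    rcases Nat.lt_succ_iff_lt_or_eq.1 hi with hi | rfl
    · obtain ⟨e1, e2⟩ := hμ.edgeLabel_inl hm hi
      have e3 := addRow_skip (r := r) (N := k + m) (s := edgeLabel m μ (Sum.inl i)) (by omega) σ
      rw [skip_of_lt (by omega), ← h.row i hi] at e3
      rw [e1, e3, hμ.other i hi.ne, (cong i _).1 hi]
      have h4 := (exit_bounds P _ i (μ.rowLen i) rfl).1
      have h5 := hm i
      rw [hμ.other i hi.ne] at h5
      exact lab _ (fun a ha => by have := h4.1 a ha; omega) (fun a ha => by have := h4.2 a ha; omega)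
    · have e1 : edgeLabel m μ' (Sum.inl i) = r := by
        simp only [edgeLabel, hμ.bottom]
        omega
      have e3 := addRow_skip (r := r) (N := i + m) (s := r) (by omega) σ
      rw [skip_of_lt (by omega)] at e3
      rw [e1, e3, hμ.bottom, exitWest_succ_of_mem ((hP' _).2 (by simp)), bottom _ (by omega)]
      congr 2
      omega
  · intro j hj
    rcases lt_or_ge j (t + 4) with hjt | hjt
    · rw [(hμ.colLen_of_lt hjt).2, (hμ.edgeLabel_inr_of_lt hm hjt).1]
      by_cases hjP : (k, j) ∈ P'
      · rw [exitNorth_succ_of_mem hjP]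
        have key : ∀ s, s + 1 < k + m → s < r + 3 → addRow r (k + m) σ s = skip r (σ s) := by
          intro s h1 h2
          have := addRow_skip (r := r) h1 σ
          rwa [skip_of_lt h2] at this
        rcases (hP' j).1 hjP with rfl | rfl | rfl | rfl
        · rw [Nat.sub_zero, addRow_last (by omega), exitWest]
          simp only [edgeLabel, hμ.bottom]
          omega
        · rw [west t le_rfl, bottom 0 (by omega), show k + m - (t + 1) = r + 3 by omega,
            addRow_add_three (by omega), Nat.sub_zero]
        · rw [exitWest_succ_of_mem ((hP' _).2 (by simp)), bottom _ (by omega),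
            key _ (by omega) (by omega)]
          congr 2
          omega
        · rw [exitWest_succ_of_mem ((hP' _).2 (by simp)), bottom _ (by omega),
            key _ (by omega) (by omega)]
          congr 2
          omega
      · have h3 := mt (hP' j).2 hjP
        have e3 := addRow_skip (r := r) (N := k + m) (s := k + m - 1 - j) (by omega) σ
        rw [skip_of_le (by omega)] at e3
        rw [exitNorth_succ_of_notMem hjP, bottom j hjt, ← e3]
        congr 1
        omega
    · obtain ⟨e1, e2⟩ := hμ.edgeLabel_inr_of_le hjt hj
      have e3 := addRow_skip (r := r) (N := k + m) (s := edgeLabel m μ (Sum.inr j)) (by omega) σ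
      rw [skip_of_lt (by omega)] at e3
      rw [e1, e3, hμ.colLen_of_le hjt, (cong _ j).2 (colLen_le_of_rowLen (hμ.old k le_rfl) j),
        north j hj]

end Steps

theorem length_eq_count (w : List Letter) : w.length = w.count V + w.count H := by
  induction w with
  | nil => rfl
  | cons a w ih => cases a <;> simp [ih] <;> omega

-- The pipes in the diagram of a path pair

section PathPair

variable {U L : List Letter} {b : ℕ} {σ : ℕ → ℕ} {S : StrandState}

theorem isColumnAdded_borderDiagram (h : 0 < L.count V) :
    IsColumnAdded (borderDiagram 4 L) (borderDiagram 4 (L ++ [H])) (L.count V) where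
  pos := h
  row r hr := by rw [rowLen_borderDiagram_append_H, if_pos hr]
  two_le r hr := by have := le_rowLen_borderDiagram 4 L hr; omega
  below r hr := by rw [rowLen_borderDiagram_append_H, if_neg (by omega)]
  below_old r hr := rowLen_borderDiagram_of_le 4 L hr

theorem isRowAdded_borderDiagram (w : List Letter) (t : ℕ) :
    IsRowAdded (borderDiagram 4 (w ++ List.replicate t H))
      (borderDiagram 4 (w ++ V :: List.replicate t H)) (w.count V) t where
  bottom := by rw [rowLen_borderDiagram_insert_V, if_pos rfl]
  other r hr := by rw [rowLen_borderDiagram_insert_V, if_neg hr]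
  old r hr := rowLen_borderDiagram_of_le _ _ (by simpa [List.count_replicate] using hr)

/-- Identifies `b`, defined through the lower path, with the label of the column of zeros that a
west step adds; both sides grow by one under a west step. -/
theorem PathPair.bound_add_rowLen (h : PathPair U L b σ S) (hk : 0 < L.count V) :
    b + (borderDiagram 4 L).rowLen (L.count V - 1) = L.length + 5 := by
  induction h with
  | nil => simp at hk
  | @black U L b σ S h ih =>
    have hk' : 0 < L.count V := by simpa using hk
    have := ih hk'
    have e : (L ++ [H]).count V = L.count V := by simp
    rw [e, rowLen_borderDiagram_append_H, if_pos (by omega), List.length_append,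
      List.length_singleton]
    omega
  | @white U w t b σ S h ih =>
    rw [rowLen_borderDiagram_insert_V, if_pos (by simp [List.count_replicate])]
    simp
    omega

/-- The pipes in the diagram of a pair of lattice paths. -/
theorem PathPair.connects (h : PathPair U L b σ S) :
    Connects (L.count V) (L.count H + 4) (borderDiagram 4 L)
      (plusBoxes (borderDiagram 4 L) (borderDiagram 0 U)) σ := by
  -- Without rows there is no bottom row to locate the new column, but then all pipes are trivial
  -- and σ is the identity.
  have noRow : ∀ {U L : List Letter} {b σ S}, PathPair U L b σ S → L.count V = 0 →
      Connects (L.count V) (L.count H + 4) (borderDiagram 4 L)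
        (plusBoxes (borderDiagram 4 L) (borderDiagram 0 U)) σ := by
    intro U L b σ S h hk
    have hσ : ∀ s, σ s = s := by
      rcases h.perm_last with ⟨-, -, h1⟩ | ⟨h1, -⟩
      · exact h1
      · omega
    refine ⟨fun i hi => by omega, fun j hj => ?_⟩
    rw [hσ, Nat.le_zero.1 (colLen_le_of_rowLen (rowLen_borderDiagram_of_le 4 L hk.le) j), exitNorth]
  induction h with
  | nil => exact noRow .nil rfl
  | @black U L b σ S h ih =>
    rcases Nat.eq_zero_or_pos (L.count V) with hk | hk
    · exact noRow (.black h) (by simpa using hk)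
    · have hb := h.bound_add_rowLen hk
      have hL := length_eq_count L
      have hc := h.count_eq
      have e := ih.columnAdded (b := b) (isColumnAdded_borderDiagram hk)
        ((isColumnAdded_borderDiagram hk).isShifted_plusBoxes
          (ν := borderDiagram 0 U) (ν' := borderDiagram 0 (U ++ [H]))
          (colLen_heights hk (fun r hr => by rw [rowLen_borderDiagram_append_H, if_pos (by omega)])
            (fun r hr => by rw [rowLen_borderDiagram_append_H, if_neg (by omega)])
            (fun r hr => rowLen_borderDiagram_of_le 0 U (by omega))))
        (rowLen_borderDiagram_le 4 L) (by omega)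
      have e1 : (L ++ [H]).count V = L.count V := by simp
      have e2 : (L ++ [H]).count H + 4 = L.count H + 4 + 1 := by simp
      rw [e1, e2]
      exact e
  | @white U w t b σ S h ih =>
    have hc := h.count_eq
    have hL := length_eq_count w
    have e1 : (w ++ List.replicate t H).count V = w.count V := by simp [List.count_replicate]
    have e2 : (w ++ List.replicate t H).count H + 4 = w.count H + t + 4 := by simp
    have e3 : (w ++ V :: List.replicate t H).count V = w.count V + 1 := by
      simp [List.count_replicate]
    have e4 : (w ++ V :: List.replicate t H).count H + 4 = w.count H + t + 4 := by simp
    rw [e1] at hc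
    rw [e1, e2] at ih
    rw [e3, e4, borderDiagram_append_V]
    have hp := (isRowAdded_borderDiagram w t).mem_plusBoxes
      (rowLen_borderDiagram_of_le 0 U hc.le)
    have e := ih.rowAdded (isRowAdded_borderDiagram w t)
      (fun r => (rowLen_borderDiagram_le 4 _ r).trans e4.le) hp.1 hp.2
    rwa [show w.count V + (w.count H + t + 4) - (t + 4) = w.length by omega,
      show w.count V + (w.count H + t + 4) = w.length + t + 4 by omega] at e

end PathPair

end BCFW


namespace BCFW

open Letter

-- Decorated permutations of the diagrams

namespace OplusDiagram

variable {k n : ℕ} (D : OplusDiagram k n)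

theorem edgeLabel_eq (e : Fin k ⊕ Fin (n - k)) :
    edgeLabel (n - k) D.shape (Sum.map Fin.val Fin.val e) = D.label e := by
  rcases e with i | j <;> rfl

theorem label_pipe (e : Fin k ⊕ Fin (n - k)) :
    (D.label (D.pipe e) : ℕ) =
      edgeLabel (n - k) D.shape ((D.start e).exit D.plus) := by
  rw [← edgeLabel_eq, pipe_val]

theorem decPerm_label (e : Fin k ⊕ Fin (n - k)) :
    D.decPerm.perm (D.label e) = D.label (D.pipe e) := by
  simp [decPerm, Equiv.ofBijective_symm_apply_apply]

theorem decPerm_apply_of_connects {σ : ℕ → ℕ} (h : Connects k (n - k) D.shape D.plus σ)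
    (s : Fin n) : (D.decPerm.perm s : ℕ) = σ s := by
  obtain ⟨e, rfl⟩ := D.label_bijective.2 s
  rw [decPerm_label, label_pipe, ← edgeLabel_eq]
  rcases e with i | j
  · exact h.row i i.2
  · exact h.col j j.2

/-- A pipe entering a row at a + turns north at once and can leave only through a higher row or a
column, so no row label is fixed. -/
theorem white_decPerm (h : ∀ i < k, ∃ j, D.shape.rowLen i = j + 1 ∧ (i, j) ∈ D.plus) :
    D.decPerm.white = ∅ := by
  refine Set.eq_empty_iff_forall_notMem.2 ?_
  rintro _ ⟨r, rfl, hr⟩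
  obtain ⟨j, h1, h2⟩ := h r r.2
  have h3 := D.pipe_val (Sum.inl r)
  rw [hr] at h3
  change Sum.inl (r : ℕ) = exitWest D.plus r (D.shape.rowLen r) at h3
  rw [h1, exitWest_succ_of_mem h2] at h3
  exact lt_irrefl _ ((exit_bounds D.plus _ r j rfl).2.1 r h3.symm)

end OplusDiagram

theorem PathPair.decPerm {k n : ℕ} (hkn : k + 4 ≤ n) {U L : LatticePath k (n - k - 4)} {b : ℕ}
    {σ : ℕ → ℕ} {S : StrandState} (h : PathPair U.word L.word b σ S) :
    (omegaLD hkn U L).decPerm.white = ∅ ∧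
      ∀ s : Fin n, ((omegaLD hkn U L).decPerm.perm s : ℕ) = σ s := by
  constructor
  · refine (omegaLD hkn U L).white_decPerm fun i hi => ?_
    have h1 := le_rowLen_borderDiagram 4 L.word (i := i) (by rw [L.count_V]; exact hi)
    refine ⟨(borderDiagram 4 L.word).rowLen i - 1, ?_, ?_⟩
    · change (borderDiagram 4 L.word).rowLen i = _
      omega
    · change _ ∈ plusBoxes _ _
      rw [plusBoxes, Finset.mem_union, mem_endBoxes]
      omega
  · refine (omegaLD hkn U L).decPerm_apply_of_connects ?_
    have := h.connects
    rwa [L.count_V, L.count_H, show n - k - 4 + 4 = n - k by omega] at this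

end BCFW


namespace BCFW

/-! ### Realizations of decorated permutations by vectors -/

/-- `l` precedes `j` in the cyclic order that starts with `r`. -/
def Before (r l j : ℕ) : Prop := (r ≤ l ∧ l < j) ∨ (j < r ∧ r ≤ l) ∨ (l < j ∧ j < r)

theorem before_iff {n : ℕ} (r l j : Fin n) : l - r < j - r ↔ Before r l j := by
  have key : ∀ x : Fin n, ((x - r : Fin n) : ℕ) = if r ≤ x then (x : ℕ) - r else n + x - r := by
    intro x
    split_ifs with h
    · exact Fin.sub_val_of_le h
    · exact Fin.coe_sub_iff_lt.2 (not_le.1 h)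
  have h1 := r.2
  have h2 := l.2
  have h3 := j.2
  rw [Fin.lt_def, key, key, Before]
  simp only [Fin.le_def]
  split_ifs <;> omega

theorem before_succAbove {n : ℕ} (p : Fin (n + 1)) (r : ℕ) (l j : Fin n) :
    Before r (p.succAbove l) (p.succAbove j) ↔ Before (if r ≤ p then r else r - 1) l j := by
  have key : ∀ x : Fin n, (p.succAbove x : ℕ) = if (x : ℕ) < p then (x : ℕ) else x + 1 := by
    intro x
    simp only [Fin.succAbove, Fin.lt_def]
    split_ifs <;> simp_all
  simp only [Before, key]
  split_ifs <;> omega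

/-- The vector `v j` is not in the span of those before it, in the order that starts with `r`. -/
def IsPivot {n : ℕ} {E : Type*} [AddCommGroup E] [Module ℝ E] (v : Fin n → E) (r : ℕ)
    (j : Fin n) : Prop :=
  v j ∉ Submodule.span ℝ (v '' {l | Before r l j})

/-- The necklace of a decorated permutation. -/
def DecPerm.Pivot {n : ℕ} (π : DecPerm n) (r : ℕ) (j : Fin n) : Prop :=
  j ∈ π.white ∨ Before r j (π.perm⁻¹ j)

/-- The vectors span, have nonnegative maximal minors, and their necklace is that of `π`. -/
structure DecPerm.IsRealizedBy {n k : ℕ} (π : DecPerm n) (v : Fin n → Fin k → ℝ) : Prop where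
  span_eq : Submodule.span ℝ (Set.range v) = ⊤
  minor_nonneg : ∀ f : Fin k ↪o Fin n, 0 ≤ (Matrix.of fun i j => v (f j) i).det
  isPivot_iff : ∀ r j, IsPivot v r j ↔ π.Pivot r j

theorem exists_orderEmbedding_succAbove {n k : ℕ} (p : Fin (n + 1)) (f : Fin k ↪o Fin (n + 1))
    (h : ∀ j, f j ≠ p) : ∃ g : Fin k ↪o Fin n, ∀ j, p.succAbove (g j) = f j := by
  choose g hg using fun j => Fin.exists_succAbove_eq (h j)
  refine ⟨OrderEmbedding.ofStrictMono g fun a b hab => ?_, hg⟩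
  rw [← Fin.succAbove_lt_succAbove_iff (p := p), hg, hg]
  exact f.strictMono hab

-- Fixed points of decorated permutations: zero vectors and coloops

section Insert

variable {n : ℕ}

/-- The map `Q` kills the extra vector and inverts `T`, and the scalars are nonzero, so dependences
among the remaining vectors are unchanged. Serves for zero vectors (`T = Q = id`) and for coloops.
-/
theorem isPivot_succAbove {E E' : Type*} [AddCommGroup E] [Module ℝ E] [AddCommGroup E']
    [Module ℝ E'] (T : E' →ₗ[ℝ] E) (Q : E →ₗ[ℝ] E') (hQ : ∀ x, Q (T x) = x) (p : Fin (n + 1))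
    (v' : Fin n → E') (v : Fin (n + 1) → E) (ε : Fin n → ℝ) (hε : ∀ y, ε y ≠ 0)
    (hp : Q (v p) = 0) (hv : ∀ y, v (p.succAbove y) = ε y • T (v' y)) (r : ℕ) (y : Fin n) :
    IsPivot v r (p.succAbove y) ↔ IsPivot v' (if r ≤ p then r else r - 1) y := by
  refine not_congr ⟨fun h => ?_, fun h => ?_⟩
  · have h1 := Submodule.mem_map_of_mem (f := Q) h
    rw [hv, map_smul, hQ, Submodule.smul_mem_iff _ (hε y), Submodule.map_span] at h1
    refine Submodule.span_le.2 ?_ h1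
    rintro _ ⟨_, ⟨l, hl, rfl⟩, rfl⟩
    by_cases hlp : l = p
    · rw [hlp, hp]
      exact zero_mem _
    · obtain ⟨l, rfl⟩ := Fin.exists_succAbove_eq hlp
      rw [hv, map_smul, hQ]
      exact Submodule.smul_mem _ _ (Submodule.subset_span ⟨l, (before_succAbove p r l y).1 hl, rfl⟩)
  · have h1 := Submodule.mem_map_of_mem (f := T) h
    rw [hv]
    refine Submodule.smul_mem _ _ ?_
    rw [Submodule.map_span] at h1
    refine Submodule.span_le.2 ?_ h1
    rintro _ ⟨_, ⟨l, hl, rfl⟩, rfl⟩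
    rw [SetLike.mem_coe, ← Submodule.smul_mem_iff _ (hε l), ← hv]
    exact Submodule.subset_span ⟨_, (before_succAbove p r l y).2 hl, rfl⟩

theorem DecPerm.exists_delete (π : DecPerm (n + 1)) (p : Fin (n + 1)) (hp : π.perm p = p) :
    ∃ π' : DecPerm n, (∀ x, p.succAbove (π'.perm x) = π.perm (p.succAbove x)) ∧
      ∀ x, x ∈ π'.white ↔ p.succAbove x ∈ π.white := by
  have h : ∀ x, π.perm x ≠ p ↔ x ≠ p := by
    intro x
    rw [not_iff_not]
    exact ⟨fun h => π.perm.injective (h.trans hp.symm), fun h => by rw [h, hp]⟩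
  have e : ∀ x, p.succAbove (((finSuccAboveEquiv p).symm.permCongr
      (π.perm.subtypePerm h)) x) = π.perm (p.succAbove x) := by
    intro x
    exact congrArg Subtype.val ((finSuccAboveEquiv p).apply_symm_apply
      (π.perm.subtypePerm h (finSuccAboveEquiv p x)))
  refine ⟨⟨_, {x | p.succAbove x ∈ π.white}, fun x hx => ?_⟩, e, fun x => Iff.rfl⟩
  apply p.succAbove_right_injective
  rw [e, π.white_fixed _ hx]

theorem DecPerm.pivot_succAbove {π : DecPerm (n + 1)} {π' : DecPerm n} {p : Fin (n + 1)}
    (h : ∀ x, p.succAbove (π'.perm x) = π.perm (p.succAbove x))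
    (hw : ∀ x, x ∈ π'.white ↔ p.succAbove x ∈ π.white) (r : ℕ) (y : Fin n) :
    π.Pivot r (p.succAbove y) ↔ π'.Pivot (if r ≤ p then r else r - 1) y := by
  have e : π.perm⁻¹ (p.succAbove y) = p.succAbove (π'.perm⁻¹ y) := by
    rw [Equiv.Perm.inv_eq_iff_eq, ← h]
    simp
  rw [Pivot, Pivot, hw, e, before_succAbove]

theorem DecPerm.IsRealizedBy.insert_zero {k : ℕ} {π : DecPerm (n + 1)} {π' : DecPerm n}
    {p : Fin (n + 1)} (h : ∀ x, p.succAbove (π'.perm x) = π.perm (p.succAbove x))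
    (hw : ∀ x, x ∈ π'.white ↔ p.succAbove x ∈ π.white) (hp : π.perm p = p) (hpw : p ∉ π.white)
    {v : Fin n → Fin k → ℝ} (hv : π'.IsRealizedBy v) :
    π.IsRealizedBy (p.insertNth (α := fun _ => Fin k → ℝ) 0 v) := by
  constructor
  · rw [eq_top_iff, ← hv.span_eq]
    refine Submodule.span_mono ?_
    rintro _ ⟨y, rfl⟩
    exact ⟨p.succAbove y, by simp⟩
  · intro f
    by_cases hf : ∃ j, f j = p
    · obtain ⟨j, hj⟩ := hf
      rw [Matrix.det_eq_zero_of_column_eq_zero j fun i => by simp [hj]]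
    · obtain ⟨g, hg⟩ := exists_orderEmbedding_succAbove p f (not_exists.1 hf)
      simp only [← hg, Fin.insertNth_apply_succAbove]
      exact hv.minor_nonneg g
  · intro r j
    refine Fin.succAboveCases p ?_ (fun y => ?_) j
    · have e : π.perm⁻¹ p = p := by rw [Equiv.Perm.inv_eq_iff_eq, hp]
      simp [IsPivot, Pivot, hpw, e, Before]
    · rw [pivot_succAbove h hw, ← hv.isPivot_iff]
      exact isPivot_succAbove .id .id (by simp) p v _ 1 (by simp) (by simp) (by simp) r y

/-- Prepend a zero. -/
def consZero (k : ℕ) : (Fin k → ℝ) →ₗ[ℝ] (Fin (k + 1) → ℝ) where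
  toFun x := Fin.cons 0 x
  map_add' x y := by ext i; refine Fin.cases ?_ (fun i => ?_) i <;> simp
  map_smul' c x := by ext i; refine Fin.cases ?_ (fun i => ?_) i <;> simp

theorem prod_neg_one_ite {k a : ℕ} (h : a ≤ k) :
    ∏ j : Fin k, (if (j : ℕ) < a then (-1 : ℝ) else 1) = (-1) ^ a := by
  rw [Fin.prod_univ_eq_prod_range (fun j => if j < a then (-1 : ℝ) else 1), Finset.prod_ite,
    Finset.prod_const, Finset.prod_const_one, mul_one]
  congr 1
  rw [show (Finset.range k).filter (· < a) = Finset.range a by ext; simp; omega, Finset.card_range]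

/-- A new coordinate is used by the new vector only. Expanding a minor along it gives an old minor
times `(-1) ^ a`, where `a` is the number of chosen vectors before `p`; the signs `ε` on these
vectors cancel this factor. Minors that avoid `p` vanish. -/
theorem DecPerm.IsRealizedBy.insert_coloop {k : ℕ} {π : DecPerm (n + 1)} {π' : DecPerm n}
    {p : Fin (n + 1)} (h : ∀ x, p.succAbove (π'.perm x) = π.perm (p.succAbove x))
    (hw : ∀ x, x ∈ π'.white ↔ p.succAbove x ∈ π.white) (hpw : p ∈ π.white)
    {v : Fin n → Fin k → ℝ} (hv : π'.IsRealizedBy v) :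
    π.IsRealizedBy (p.insertNth (α := fun _ => Fin (k + 1) → ℝ) (Pi.single 0 1) fun y =>
      (if p.succAbove y < p then (-1 : ℝ) else 1) • consZero k (v y)) := by
  set ε : Fin n → ℝ := fun y => if p.succAbove y < p then (-1 : ℝ) else 1 with hε
  have hε0 : ∀ y, ε y ≠ 0 := fun y => by simp only [hε]; split_ifs <;> norm_num
  set u : Fin (n + 1) → Fin (k + 1) → ℝ := p.insertNth (α := fun _ => Fin (k + 1) → ℝ)
    (Pi.single 0 1) fun y => ε y • consZero k (v y) with hu
  have up : u p = Pi.single 0 1 := by simp [hu]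
  have us : ∀ y, u (p.succAbove y) = ε y • consZero k (v y) := fun y => by simp [hu]
  constructor
  · rw [eq_top_iff]
    rintro x -
    have h1 : ∀ y : Fin k → ℝ, consZero k y ∈ Submodule.span ℝ (Set.range u) := by
      intro y
      have h2 : y ∈ Submodule.span ℝ (Set.range v) := by rw [hv.span_eq]; trivial
      have h3 := Submodule.mem_map_of_mem (f := consZero k) h2
      rw [Submodule.map_span] at h3
      refine Submodule.span_le.2 ?_ h3
      rintro _ ⟨_, ⟨l, rfl⟩, rfl⟩
      rw [SetLike.mem_coe, ← Submodule.smul_mem_iff _ (hε0 l), ← us]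
      exact Submodule.subset_span ⟨_, rfl⟩
    have h2 : x = x 0 • u p + consZero k (Fin.tail x) := by
      rw [up]
      ext i
      refine Fin.cases ?_ (fun i => ?_) i <;> simp [consZero, Fin.tail]
    rw [h2]
    exact add_mem (Submodule.smul_mem _ _ (Submodule.subset_span ⟨_, rfl⟩)) (h1 _)
  · intro f
    rw [Matrix.det_succ_row_zero]
    have hz : ∀ j, f j ≠ p → u (f j) 0 = 0 := by
      intro j hj
      obtain ⟨y, hy⟩ := Fin.exists_succAbove_eq hj
      rw [← hy, us]
      simp [consZero]
    by_cases hf : ∃ a, f a = p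
    · obtain ⟨a, ha⟩ := hf
      obtain ⟨g, hg⟩ := exists_orderEmbedding_succAbove p (a.succAboveOrderEmb.trans f) fun j hj =>
        a.succAbove_ne j (f.injective (hj.trans ha.symm))
      rw [Finset.sum_eq_single a (fun j _ hj => by
        simp [hz j fun hc => hj (f.injective (hc.trans ha.symm))]) (by simp)]
      have e : ((Matrix.of fun i j => u (f j) i).submatrix Fin.succ a.succAbove) =
          Matrix.of fun i j => ε (g j) * (Matrix.of fun i j => v (g j) i) i j := by
        ext i j
        have := hg j
        simp only [RelEmbedding.coe_trans, Function.comp_apply, Fin.succAboveOrderEmb_apply] at this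
        simp [← this, us, consZero]
      have e' : ∏ j, ε (g j) = (-1) ^ (a : ℕ) := by
        rw [← prod_neg_one_ite (Nat.lt_succ_iff.1 a.2)]
        refine Finset.prod_congr rfl fun j _ => ?_
        have := hg j
        simp only [RelEmbedding.coe_trans, Function.comp_apply, Fin.succAboveOrderEmb_apply] at this
        simp only [hε, this]
        refine if_congr ?_ rfl rfl
        rw [← ha, f.lt_iff_lt, Fin.succAbove_lt_iff_castSucc_lt, Fin.lt_def, Fin.val_castSucc]
      rw [e, Matrix.det_mul_row, e']
      have h1 := hv.minor_nonneg g
      simp only [Matrix.of_apply, ha, up, Pi.single_eq_same, mul_one]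
      rw [← mul_assoc, ← mul_pow]
      simpa using h1
    · rw [Finset.sum_eq_zero]
      intro j _
      simp [hz j fun hc => hf ⟨j, hc⟩]
  · intro r j
    have hQ : ∀ x, LinearMap.funLeft ℝ ℝ Fin.succ (consZero k x) = x := fun x => by
      ext i; simp [consZero, LinearMap.funLeft]
    refine Fin.succAboveCases p ?_ (fun y => ?_) j
    · refine iff_of_true (fun hc => ?_) (Or.inl hpw)
      have h1 : u p ∈ LinearMap.ker (LinearMap.proj (R := ℝ) (φ := fun _ => ℝ) (0 : Fin (k + 1))) := by
        refine Submodule.span_le.2 ?_ hc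
        rintro _ ⟨l, hl, rfl⟩
        have hlp : l ≠ p := by
          rintro rfl
          simp [Before] at hl
          omega
        obtain ⟨y, rfl⟩ := Fin.exists_succAbove_eq hlp
        simp [us, consZero]
      simp [up] at h1
    · rw [pivot_succAbove h hw, ← hv.isPivot_iff]
      exact isPivot_succAbove (consZero k) (LinearMap.funLeft ℝ ℝ Fin.succ) hQ p v u ε hε0
        (by rw [up]; ext i; simp [LinearMap.funLeft]) us r y

end Insert

end BCFW


namespace BCFW

-- Necklaces of vector configurations

section Pivot

variable {n : ℕ} {E : Type*} [AddCommGroup E] [Module ℝ E]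

theorem before_insert {i j : ℕ} (h : j ≠ i) (l : ℕ) : Before i l j ↔ l = i ∨ Before (i + 1) l j := by
  simp only [Before]
  omega

theorem span_le_span_before (v : Fin n → E) {r j r' j' : ℕ}
    (h : ∀ l, Before r l j → Before r' l j') :
    Submodule.span ℝ (v '' {l | Before r l j}) ≤ Submodule.span ℝ (v '' {l | Before r' l j'}) :=
  Submodule.span_mono (Set.image_mono fun l hl => h l hl)

theorem not_isPivot_iff {v : Fin n → E} {i j : Fin n} (h : j ≠ i) :
    ¬ IsPivot v i j ↔
      v j ∈ Submodule.span ℝ (insert (v i) (v '' {l | Before (i + 1) l j})) := by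
  rw [IsPivot, not_not, ← Set.image_insert_eq]
  rw [show {l : Fin n | Before i l j} = insert i {l : Fin n | Before (i + 1) l j} by
    ext l
    simp [before_insert (fun hc => h (Fin.ext hc)), Fin.ext_iff]]

/-- A single step around a necklace. -/
theorem isPivot_succ_iff {v : Fin n → E} {i a : Fin n} (ha : a ≠ i → ¬ IsPivot v i a)
    (ha' : IsPivot v (i + 1) a) (j : Fin n) :
    IsPivot v (i + 1) j ↔ j = a ∨ (j ≠ i ∧ IsPivot v i j) := by
  constructor
  · intro hj
    by_contra! hc
    obtain ⟨hja, hji⟩ := hc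
    have hja' : (j : ℕ) ≠ a := fun h => hja (Fin.ext h)
    -- the vectors up to `b`, in the order that ends with `i`
    have hle : ∀ b d : Fin n, Before (i + 1) b d →
        Submodule.span ℝ (insert (v b) (v '' {l | Before (i + 1) l b})) ≤
          Submodule.span ℝ (v '' {l | Before (i + 1) l d}) := by
      intro b d hbd
      rw [← Set.image_insert_eq]
      refine Submodule.span_mono (Set.image_mono ?_)
      rintro l (rfl | hl)
      · exact hbd
      · simp only [Set.mem_ofPred_eq, Before] at hl hbd ⊢
        omega
    by_cases hi : j = i
    · subst hi
      -- As `a` becomes a pivot only once `v i` is moved to the end, exchange puts `v i` in the span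
      -- of the vectors up to `a`, so `i` itself is no pivot in the new order.
      have h1 := mem_span_insert_exchange ((not_isPivot_iff (Ne.symm hja)).1 (ha (Ne.symm hja))) ha'
      exact hj (hle a j (by simp only [Before]; omega) h1)
    · have hi' : (j : ℕ) ≠ i := fun h => hi (Fin.ext h)
      have h1 := mem_span_insert_exchange ((not_isPivot_iff hi).1 (hji hi)) hj
      -- Both `a` and `j` would become pivots when `v i` is moved. Exchange puts `v i` in the span
      -- up to the earlier of the two, and then the later one gains nothing from the removal of `v
      -- i`.
      by_cases hlt : Before (i + 1) j a
      · have h2 := hle j a hlt h1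
        by_cases hai : a = i
        · rw [hai] at h2
          rw [hai] at ha'
          exact ha' h2
        · have h3 := (not_isPivot_iff hai).1 (ha hai)
          rw [Submodule.span_insert_eq_span h2] at h3
          exact ha' h3
      · have hlt' : Before (i + 1) a j := by
          simp only [Before] at hlt ⊢
          omega
        have hai : a ≠ i := by
          rintro rfl
          simp only [Before] at hlt'
          omega
        have h3 := hle a j hlt' (mem_span_insert_exchange ((not_isPivot_iff hai).1 (ha hai)) ha')
        have h4 := (not_isPivot_iff hi).1 (hji hi)
        rw [Submodule.span_insert_eq_span h3] at h4
        exact hj h4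
  · rintro (rfl | ⟨hji, hj⟩)
    · exact ha'
    · exact fun h => hj (span_le_span_before v
        (fun l hl => (before_insert (fun hc => hji (Fin.ext hc)) l).2 (Or.inr hl)) h)

/-- Unless the order starts at `i + 1`, an initial segment that contains `i + 1` also contains `i`,
so its span is not affected by the addition. With `t = 1` and `t = -1` this gives an equivalence. -/
theorem not_isPivot_of_add {u v : Fin n → E} {i i' : Fin n} (hi : (i' : ℕ) = i + 1) (t : ℝ)
    (h : ∀ j, j ≠ i' → v j = u j) (h' : v i' = u i' + t • u i) {r : ℕ} (hr : r ≠ i + 1)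
    {j : Fin n} (hj : ¬ IsPivot u r j) : ¬ IsPivot v r j := by
  have hii : i ≠ i' := fun hc => by simp [hc] at hi
  rw [IsPivot, not_not] at hj ⊢
  have hle : Submodule.span ℝ (u '' {l | Before r l j}) ≤
      Submodule.span ℝ (v '' {l | Before r l j}) := by
    rw [Submodule.span_le]
    rintro _ ⟨l, hl, rfl⟩
    by_cases hli : l = i'
    · subst hli
      rw [show u l = v l - t • v i by rw [h', h i hii]; abel]
      refine sub_mem (Submodule.subset_span ⟨l, hl, rfl⟩)
        (Submodule.smul_mem _ _ (Submodule.subset_span ⟨i, ?_, rfl⟩))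
      simp only [Set.mem_ofPred_eq, Before] at hl ⊢
      omega
    · rw [← h l hli]
      exact Submodule.subset_span ⟨l, hl, rfl⟩
  by_cases hji : j = i'
  · subst hji
    rw [h', ← h i hii]
    refine add_mem (hle hj) (Submodule.smul_mem _ _ (Submodule.subset_span ⟨i, ?_, rfl⟩))
    simp only [Set.mem_ofPred_eq, Before]
    omega
  · rw [h j hji]
    exact hle hj

end Pivot

-- Bridges

section Bridge

variable {n : ℕ} {π : DecPerm n} {i i' : Fin n}

/-- Exchange the images of `i` and `i'`, where a fixed point `i` becomes white. -/
def DecPerm.bridge (π : DecPerm n) (i i' : Fin n) : DecPerm n where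
  perm := π.perm * Equiv.swap i i'
  white := {x | x = i ∧ π.perm i' = i}
  white_fixed := by
    rintro x ⟨rfl, h⟩
    simpa using h

theorem DecPerm.pivot_bridge_iff {r : ℕ} {j : Fin n} :
    (π.bridge i i').Pivot r j ↔
      (j = i ∧ π.perm i' = i) ∨ Before r j (Equiv.swap i i' (π.perm⁻¹ j)) := by
  simp [Pivot, bridge, mul_inv_rev]

/-- In an order that does not start at `i + 1`, the elements `i` and `i + 1` are adjacent, so
another element compares with both in the same way. The cases of `i` and `i + 1` themselves are
settled by the absence of fixed points in `π` and by the white colour of a new fixed point `i`. -/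
theorem DecPerm.pivot_bridge_of_ne (hw : π.white = ∅) (hi : (i' : ℕ) = i + 1)
    (h1 : π.perm i ≠ i) (h2 : π.perm i' ≠ i') {r : ℕ} (hr : r ≠ i + 1) {j : Fin n} :
    (π.bridge i i').Pivot r j ↔ π.Pivot r j := by
  rw [pivot_bridge_iff, Pivot, hw]
  obtain ⟨q, rfl⟩ := π.perm.surjective j
  rw [show π.perm⁻¹ (π.perm q) = q by simp]
  rw [Ne, Fin.ext_iff] at h1 h2
  simp only [Set.mem_empty_iff_false, false_or, Fin.ext_iff]
  by_cases hq1 : q = i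
  · subst hq1
    rw [Equiv.swap_apply_left]
    simp only [Before]
    omega
  by_cases hq2 : q = i'
  · subst hq2
    rw [Equiv.swap_apply_right]
    simp only [Before]
    omega
  rw [Equiv.swap_apply_of_ne_of_ne hq1 hq2, or_iff_right]
  rintro ⟨h3, h4⟩
  exact hq2 (π.perm.injective (Fin.ext (h3.trans h4.symm)))

theorem DecPerm.pivot_succ_iff (hw : π.white = ∅) (h1 : π.perm i ≠ i) {j : Fin n} :
    π.Pivot (i + 1) j ↔ j = π.perm i ∨ (j ≠ i ∧ π.Pivot i j) := by
  rw [Pivot, Pivot, hw]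
  obtain ⟨q, rfl⟩ := π.perm.surjective j
  rw [show π.perm⁻¹ (π.perm q) = q by simp]
  rw [Ne, Fin.ext_iff] at h1
  simp only [Set.mem_empty_iff_false, false_or, EmbeddingLike.apply_eq_iff_eq, Ne, Fin.ext_iff]
  by_cases hq : q = i
  · subst hq
    simp only [Before, true_or, iff_true]
    omega
  · rw [Fin.ext_iff] at hq
    simp only [Before]
    omega

/-- The effect of adding a vector to the next one. -/
theorem isPivot_succ_of_bridge {E : Type*} [AddCommGroup E] [Module ℝ E] {u v : Fin n → E}
    (hi : (i' : ℕ) = i + 1) (h1 : π.perm i ≠ i) (h2 : π.perm i' ≠ i')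
    (hlt : Before (i + 1) (π.perm i) (π.perm i'))
    (hu : ∀ r j, IsPivot u r j ↔ (π.bridge i i').Pivot r j)
    (hv : ∀ j, j ≠ i' → v j = u j) (hv' : v i' = u i' + u i) :
    IsPivot v (i + 1) (π.perm i) := by
  have hii : i ≠ i' := fun hc => by simp [hc] at hi
  have pa : ∀ r, IsPivot u r (π.perm i) ↔ Before r (π.perm i) i' := by
    intro r
    rw [hu, DecPerm.pivot_bridge_iff, or_iff_right fun h => h1 h.1]
    simp
  have pc : ∀ r, IsPivot u r (π.perm i') ↔ π.perm i' = i ∨ Before r (π.perm i') i := by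
    intro r
    rw [hu, DecPerm.pivot_bridge_iff]
    simp
  set a := π.perm i with ha
  set c := π.perm i' with hc
  have h1' : (a : ℕ) ≠ i := fun h => h1 (Fin.ext h)
  have h2' : (c : ℕ) ≠ i' := fun h => h2 (Fin.ext h)
  intro hmem
  -- If `π i = i + 1`, this is a black fixed point after the bridge, so `u i' = 0` and `v i' = u i`,
  -- which is nonzero because `i` is a pivot at `i`.
  by_cases hai : a = i'
  · have e1 : u i' = 0 := by
      have := (pa (i + 1)).not.2 (by rw [hai]; simp only [Before]; omega)
      rw [IsPivot, not_not, hai, show {l : Fin n | Before (i + 1) l i'} = ∅ by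
        ext l; simp [Before]; omega] at this
      simpa using this
    have e2 : u i ≠ 0 := by
      intro h0
      refine (hu i i).2 ?_ (by rw [h0]; exact zero_mem _)
      rw [DecPerm.pivot_bridge_iff]
      by_cases hci : c = i
      · exact Or.inl ⟨rfl, hci⟩
      · right
        have : Equiv.swap i i' (π.perm⁻¹ i) ≠ i := by
          rw [Ne, Equiv.swap_apply_eq_iff, Equiv.swap_apply_left, Equiv.Perm.inv_eq_iff_eq]
          exact fun h => hci h.symm
        rw [Ne, Fin.ext_iff] at this
        simp only [Before]
        omega
    rw [hai, show {l : Fin n | Before (i + 1) l i'} = ∅ by ext l; simp [Before]; omega, hv',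
      e1, zero_add] at hmem
    exact e2 (by simpa using hmem)
  · have hai' : (a : ℕ) ≠ i' := fun h => hai (Fin.ext h)
    have hW : {l : Fin n | Before (i + 1) l a} = insert i' {l : Fin n | Before (i + 2) l a} := by
      ext l
      simp only [Set.mem_ofPred_eq, Set.mem_insert_iff, Fin.ext_iff, Before]
      omega
    have hvW : v '' {l : Fin n | Before (i + 2) l a} = u '' {l : Fin n | Before (i + 2) l a} := by
      refine Set.image_congr fun l hl => hv l ?_
      rintro rfl
      simp only [Set.mem_ofPred_eq, Before] at hl
      omega
    rw [hW, Set.image_insert_eq, hvW, hv a hai, hv'] at hmem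
    have e1 : u a ∉ Submodule.span ℝ (u '' {l : Fin n | Before (i + 2) l a}) :=
      (pa (i + 2)).2 (by simp only [Before]; omega)
    have e2 := mem_span_insert_exchange hmem e1
    have e3 : u a ∈ Submodule.span ℝ (u '' {l : Fin n | Before (i + 1) l a}) := by
      have := (pa (i + 1)).not.2 (by simp only [Before]; omega)
      rwa [IsPivot, not_not] at this
    -- Exchange puts `u i' + u i` in this span, which contains `u i'` since `a` lies beyond `i'`.
    have e4 : u i ∈ Submodule.span ℝ (u '' {l : Fin n | Before (i + 1) l a}) := by
      have e5 : Submodule.span ℝ (insert (u a) (u '' {l : Fin n | Before (i + 2) l a})) ≤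
          Submodule.span ℝ (u '' {l : Fin n | Before (i + 1) l a}) := by
        refine Submodule.span_le.2 (Set.insert_subset e3 ?_)
        rw [hW]
        exact (Set.image_mono (Set.subset_insert _ _)).trans Submodule.subset_span
      have e6 : u i' ∈ Submodule.span ℝ (u '' {l : Fin n | Before (i + 1) l a}) :=
        Submodule.subset_span ⟨i', by simp only [Set.mem_ofPred_eq, Before]; omega, rfl⟩
      simpa using sub_mem (e5 e2) e6
    have e7 : u i ∈ Submodule.span ℝ (u '' {l : Fin n | Before (i + 1) l c}) :=
      span_le_span_before u (fun l hl => by simp only [Before] at hl hlt ⊢; omega) e4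
    -- By `hlt` the span before `c` contains `u i` as well, so `c` is a pivot at `i` if and only if
    -- at `i + 1`. But after the bridge `i` has image `c`, which therefore becomes a pivot only at
    -- `i + 1`; if `c = i`, it is a coloop.
    by_cases hci : c = i
    · rw [hci] at e7 pc
      exact (pc (i + 1)).2 (Or.inl rfl) e7
    · have hci' : (c : ℕ) ≠ i := fun h => hci (Fin.ext h)
      have e8 := (pc i).not.2 (by simp only [Before]; omega)
      rw [not_isPivot_iff hci, Submodule.span_insert_eq_span e7] at e8
      exact (pc (i + 1)).2 (by simp only [Before]; omega) e8

/-- Adding column `i` to the adjacent column `i + 1` preserves total nonnegativity and changes the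
necklace only at `i + 1`; there `isPivot_succ_iff` reduces the claim to the single new pivot `π i`.
-/
theorem DecPerm.IsRealizedBy.bridge {k : ℕ} (hw : π.white = ∅) (hi : (i' : ℕ) = i + 1)
    (h1 : π.perm i ≠ i) (h2 : π.perm i' ≠ i') (hlt : Before (i + 1) (π.perm i) (π.perm i'))
    {u : Fin n → Fin k → ℝ} (hu : (π.bridge i i').IsRealizedBy u) :
    π.IsRealizedBy (Function.update u i' (u i' + u i)) := by
  have hii : i ≠ i' := fun hc => by simp [hc] at hi
  set v := Function.update u i' (u i' + u i) with hvdef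
  have hv : ∀ j, j ≠ i' → v j = u j := fun j hj => Function.update_of_ne hj _ _
  have hv' : v i' = u i' + u i := Function.update_self _ _ _
  constructor
  · rw [eq_top_iff, ← hu.span_eq, Submodule.span_le]
    rintro _ ⟨l, rfl⟩
    by_cases hli : l = i'
    · subst hli
      rw [show u l = v l - v i by rw [hv', hv i hii]; abel]
      exact sub_mem (Submodule.subset_span ⟨l, rfl⟩) (Submodule.subset_span ⟨i, rfl⟩)
    · rw [← hv l hli]
      exact Submodule.subset_span ⟨l, rfl⟩
  · intro f
    by_cases hf : ∃ a, f a = i'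
    · obtain ⟨a, ha⟩ := hf
      have hne : ∀ j, j ≠ a → f j ≠ i' := fun j hj hc => hj (f.injective (hc.trans ha.symm))
      have e : (Matrix.of fun x j => v (f j) x) = (Matrix.of fun x j => u (f j) x).updateCol a
          ((fun x => u i' x) + fun x => u i x) := by
        ext x j
        by_cases hj : j = a
        · subst hj
          simp [ha, hv']
        · simp [hj, hv _ (hne j hj)]
      -- The minor is the old one plus the one with column `i'` replaced by column `i`. The latter
      -- has two equal columns if `i` is also chosen; otherwise it is a minor of `u`, as `i` and
      -- `i'` are consecutive.
      rw [e, Matrix.det_updateCol_add]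
      refine add_nonneg ?_ ?_
      · rw [show (fun x => u i' x) = fun x => (Matrix.of fun x j => u (f j) x) x a by
          ext x; simp [ha], Matrix.updateCol_eq_self]
        exact hu.minor_nonneg f
      · by_cases hb : ∃ b, f b = i
        · obtain ⟨b, hb⟩ := hb
          have hba : b ≠ a := by
            rintro rfl
            exact hii (hb.symm.trans ha)
          rw [Matrix.det_zero_of_column_eq hba fun x => by simp [hba, hb]]
        · have hmono : StrictMono (Function.update f a i) := by
            intro x y hxy
            have h3 := f.strictMono hxy
            by_cases hx : x = a
            · subst hx
              rw [Function.update_self, Function.update_of_ne hxy.ne']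
              rw [ha] at h3
              rw [Fin.lt_def] at h3 ⊢
              omega
            · rw [Function.update_of_ne hx]
              by_cases hy : y = a
              · subst hy
                rw [Function.update_self]
                rw [ha] at h3
                have h4 : (f x : ℕ) ≠ i := fun hc => hb ⟨x, Fin.ext hc⟩
                rw [Fin.lt_def] at h3 ⊢
                omega
              · rwa [Function.update_of_ne hy]
          have h3 := hu.minor_nonneg (OrderEmbedding.ofStrictMono _ hmono)
          rw [show (Matrix.of fun x j => u (f j) x).updateCol a (fun x => u i x) =
            Matrix.of fun x j => u (OrderEmbedding.ofStrictMono _ hmono j) x by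
              ext x j
              by_cases hj : j = a
              · subst hj
                simp
              · simp [hj]]
          exact h3
    · have e : (Matrix.of fun x j => v (f j) x) = Matrix.of fun x j => u (f j) x := by
        ext x j
        simp [hv _ (not_exists.1 hf j)]
      rw [e]
      exact hu.minor_nonneg f
  · have hne : ∀ r, r ≠ (i : ℕ) + 1 → ∀ j, IsPivot v r j ↔ π.Pivot r j := by
      intro r hr j
      rw [← pivot_bridge_of_ne hw hi h1 h2 hr, ← hu.isPivot_iff, ← not_iff_not]
      exact ⟨not_isPivot_of_add hi (-1) (fun j hj => (hv j hj).symm)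
          (by rw [hv', hv i hii, neg_one_smul]; abel) hr,
        not_isPivot_of_add hi 1 hv (by rw [hv', one_smul]) hr⟩
    intro r j
    by_cases hr : r = i + 1
    · subst hr
      rw [pivot_succ_iff hw h1, ← hne i (by omega)]
      refine isPivot_succ_iff (fun _ => ?_)
        (isPivot_succ_of_bridge hi h1 h2 hlt hu.isPivot_iff hv hv') j
      rw [hne i (by omega), Pivot, hw]
      simp [Before]
    · exact hne r hr j

end Bridge

end BCFW


namespace BCFW

-- Every decorated permutation has a totally nonnegative realization

section Existence

open Classical in
/-- The dimension of the subspaces with a given decorated permutation. -/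
noncomputable def DecPerm.rank {n : ℕ} (π : DecPerm n) : ℕ :=
  ∑ s, if π.perm s < s ∨ s ∈ π.white then 1 else 0

variable {n : ℕ}

/-- The value of the bounded affine permutation, except at white fixed points. -/
def DecPerm.lift (π : DecPerm n) (s : Fin n) : ℕ :=
  if π.perm s < s then π.perm s + n else π.perm s

theorem DecPerm.rank_delete {π : DecPerm (n + 1)} {π' : DecPerm n} {p : Fin (n + 1)}
    (h : ∀ x, p.succAbove (π'.perm x) = π.perm (p.succAbove x))
    (hw : ∀ x, x ∈ π'.white ↔ p.succAbove x ∈ π.white) (hp : π.perm p = p) [Decidable (p ∈ π.white)] :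
    π.rank = (if p ∈ π.white then 1 else 0) + π'.rank := by
  classical
  rw [rank, rank, Fin.sum_univ_succAbove _ p]
  congr 1
  · simp [hp]
  · refine Finset.sum_congr rfl fun x _ => if_congr ?_ rfl rfl
    rw [← h, Fin.succAbove_lt_succAbove_iff, hw]

theorem sum_pair_add {i i' : Fin n} (h : i ≠ i') (F : Fin n → ℕ) :
    ∑ s, F s = F i + F i' + ∑ s ∈ Finset.univ \ {i, i'}, F s := by
  rw [← Finset.sum_pair h, add_comm, Finset.sum_sdiff (Finset.subset_univ _)]

theorem DecPerm.bridge_apply_of_notMem (π : DecPerm n) {i i' s : Fin n}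
    (hs : s ∈ Finset.univ \ {i, i'}) : (π.bridge i i').perm s = π.perm s := by
  simp only [Finset.mem_sdiff, Finset.mem_univ, true_and, Finset.mem_insert,
    Finset.mem_singleton, not_or] at hs
  simp [bridge, Equiv.swap_apply_of_ne_of_ne hs.1 hs.2]

theorem DecPerm.rank_bridge {π : DecPerm n} {i i' : Fin n} (hw : π.white = ∅)
    (hi : (i' : ℕ) = i + 1) (h1 : π.perm i ≠ i) (h2 : π.perm i' ≠ i') :
    (π.bridge i i').rank = π.rank := by
  classical
  have hii : i ≠ i' := fun hc => by simp [hc] at hi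
  rw [rank, rank, sum_pair_add hii, sum_pair_add hii]
  congr 1
  · rw [add_comm]
    rw [Ne, Fin.ext_iff] at h1 h2
    congr 1
    · refine if_congr ?_ rfl rfl
      simp only [bridge, Equiv.Perm.mul_apply, Equiv.swap_apply_right, Set.mem_ofPred_eq, hw,
        Fin.lt_def, Fin.ext_iff, Set.mem_empty_iff_false, or_false]
      omega
    · refine if_congr ?_ rfl rfl
      simp only [bridge, Equiv.Perm.mul_apply, Equiv.swap_apply_left, Set.mem_ofPred_eq, hw,
        Fin.lt_def, Fin.ext_iff, Set.mem_empty_iff_false, or_false, true_and]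
      omega
  · refine Finset.sum_congr rfl fun s hs => if_congr ?_ rfl rfl
    rw [bridge_apply_of_notMem _ hs, hw]
    simp only [Finset.mem_sdiff, Finset.mem_univ, true_and, Finset.mem_insert,
      Finset.mem_singleton, not_or] at hs
    simp [bridge, hs.1]

/-- The measure for the induction: moving the larger value to the earlier position lowers the
weighted sum. -/
theorem DecPerm.sum_lift_bridge {π : DecPerm n} {i i' : Fin n} (hi : (i' : ℕ) = i + 1)
    (h1 : π.perm i ≠ i) (hlt : π.lift i < π.lift i') :
    ∑ s : Fin n, (s : ℕ) * (π.bridge i i').lift s < ∑ s : Fin n, (s : ℕ) * π.lift s := by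
  have hii : i ≠ i' := fun hc => by simp [hc] at hi
  rw [sum_pair_add hii, sum_pair_add hii]
  -- Strict only if `i` becomes a white fixed point, whose `lift` is `i` instead of `i + n`.
  have e1 : (π.bridge i i').lift i ≤ π.lift i' := by
    simp only [lift, bridge, Equiv.Perm.mul_apply, Equiv.swap_apply_left, Fin.lt_def]
    split_ifs <;> omega
  have e2 : (π.bridge i i').lift i' = π.lift i := by
    rw [Ne, Fin.ext_iff] at h1
    simp only [lift, bridge, Equiv.Perm.mul_apply, Equiv.swap_apply_right, Fin.lt_def]
    split_ifs <;> omega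
  have e3 : ∑ s ∈ Finset.univ \ {i, i'}, (s : ℕ) * (π.bridge i i').lift s =
      ∑ s ∈ Finset.univ \ {i, i'}, (s : ℕ) * π.lift s :=
    Finset.sum_congr rfl fun s hs => by rw [lift, lift, bridge_apply_of_notMem _ hs]
  rw [e2, e3, hi]
  have := Nat.mul_le_mul_left (i : ℕ) e1
  nlinarith

theorem DecPerm.before_of_lift_lt {π : DecPerm n} {i i' : Fin n} (hi : (i' : ℕ) = i + 1)
    (h1 : π.perm i ≠ i) (h2 : π.perm i' ≠ i') (hlt : π.lift i < π.lift i') :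
    Before (i + 1) (π.perm i) (π.perm i') := by
  rw [Ne, Fin.ext_iff] at h1 h2
  simp only [lift, Fin.lt_def] at hlt
  simp only [Before]
  split_ifs at hlt <;> omega

/-- Without fixed points the last value drops, so its lift is at least `n + 1`, whereas the lift of
the first value is smaller; somewhere the lift must ascend. -/
theorem DecPerm.exists_lift_lt {π : DecPerm (n + 1)} (h : ∀ p, π.perm p ≠ p) :
    ∃ i : Fin n, π.lift i.castSucc < π.lift i.succ := by
  by_contra! hc
  have h1 := Fin.antitone_iff_succ_le.2 hc (Fin.zero_le (Fin.last n))
  have h2 : π.perm (Fin.last n) < Fin.last n := Fin.lt_last_iff_ne_last.2 (h _)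
  have h3 := (π.perm 0).2
  rw [lift, lift, if_pos h2, if_neg (by simp)] at h1
  omega

/-- Double induction: a fixed point is deleted, as a zero vector or a coloop, which lowers `n`;
without fixed points a bridge at an ascent of `lift` lowers the weighted sum. -/
theorem DecPerm.exists_isRealizedBy (π : DecPerm n) :
    ∃ v : Fin n → Fin π.rank → ℝ, π.IsRealizedBy v := by
  suffices H : ∀ n : ℕ, ∀ π : DecPerm n, ∀ k, π.rank = k →
      ∃ v : Fin n → Fin k → ℝ, π.IsRealizedBy v from H n π _ rfl
  intro n
  induction n with
  | zero =>
    intro π k hk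
    have hk0 : k = 0 := by simpa [rank] using hk.symm
    subst hk0
    exact ⟨fun _ _ => 0, Subsingleton.elim _ _, fun f => by simp, fun r j => j.elim0⟩
  | succ n ih =>
    intro π
    induction hM : ∑ s : Fin (n + 1), (s : ℕ) * π.lift s using Nat.strong_induction_on generalizing π with
    | _ M ihM =>
      intro k hk
      classical
      by_cases hfix : ∃ p, π.perm p = p
      · obtain ⟨p, hp⟩ := hfix
        obtain ⟨π', h, hw⟩ := π.exists_delete p hp
        have hr := rank_delete h hw hp
        by_cases hpw : p ∈ π.white
        · obtain ⟨v, hv⟩ := ih π' _ rfl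
          rw [if_pos hpw] at hr
          obtain rfl : π'.rank + 1 = k := by omega
          exact ⟨_, hv.insert_coloop h hw hpw⟩
        · rw [if_neg hpw, zero_add] at hr
          obtain ⟨v, hv⟩ := ih π' k (hr.symm.trans hk)
          exact ⟨_, hv.insert_zero h hw hp hpw⟩
      · rw [not_exists] at hfix
        have hw : π.white = ∅ := Set.eq_empty_iff_forall_notMem.2 fun x hx =>
          hfix x (π.white_fixed x hx)
        obtain ⟨i, hi⟩ := exists_lift_lt hfix
        have hs : (i.succ : ℕ) = i.castSucc + 1 := by simp
        obtain ⟨u, hu⟩ := ihM _ (hM ▸ sum_lift_bridge hs (hfix _) hi) _ rfl k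
          ((rank_bridge hw hs (hfix _) (hfix _)).trans hk)
        exact ⟨_, hu.bridge hw hs (hfix _) (hfix _) (before_of_lift_lt hs (hfix _) (hfix _) hi)⟩

end Existence

-- From vectors to points of positroid cells

section Cell

variable {n : ℕ}

theorem DecPerm.hasDecPerm_of_necklace {V : Submodule ℝ (Fin n → ℝ)} {π : DecPerm n}
    (h : ∀ r j : Fin n, j ∈ necklace V r ↔ π.Pivot r j) : HasDecPerm V π := by
  intro i
  have hrot : ∀ j q : Fin n, Before (finRotate n i) j q ↔ Before (i + 1) j q := by
    intro j q
    have hn := i.2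
    obtain ⟨n, rfl⟩ : ∃ m, n = m + 1 := ⟨n - 1, by omega⟩
    rw [coe_finRotate]
    have := j.2
    have := q.2
    simp only [Before, Fin.ext_iff, Fin.val_last]
    split_ifs <;> omega
  have hpre : ∀ q, π.perm q ∈ π.white ↔ q ∈ π.white := by
    intro q
    constructor
    · intro hq
      rwa [← π.perm.injective (π.white_fixed _ hq)]
    · intro hq
      rwa [π.white_fixed _ hq]
  have hwi := π.white_fixed i
  by_cases hi : i ∈ necklace V i
  · refine Or.inl ⟨hi, ?_, fun hfix => ?_⟩
    · ext j
      rw [Set.mem_insert_iff, Set.mem_sdiff, h, h, DecPerm.Pivot, DecPerm.Pivot, hrot]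
      rw [h, DecPerm.Pivot] at hi
      obtain ⟨q, rfl⟩ := π.perm.surjective j
      rw [show π.perm⁻¹ (π.perm q) = q by simp, hpre]
      by_cases hq : q = i
      · subst hq
        refine iff_of_true ?_ (Or.inl rfl)
        by_cases hw : q ∈ π.white
        · exact Or.inl hw
        · right
          have hne : π.perm q ≠ q := by
            intro hc
            rw [show π.perm⁻¹ q = q by rw [Equiv.Perm.inv_eq_iff_eq, hc]] at hi
            rcases hi with hi | hi
            · exact hw hi
            · simp only [Before] at hi
              omega
          rw [Ne, Fin.ext_iff] at hne
          simp only [Before]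
          omega
      · have hq' : (q : ℕ) ≠ i := fun hc => hq (Fin.ext hc)
        have hqi : q ∈ π.white → (π.perm q : ℕ) ≠ i := fun hw => by rwa [π.white_fixed q hw]
        simp only [EmbeddingLike.apply_eq_iff_eq, Set.mem_singleton_iff, Fin.ext_iff, Before]
        by_cases hw : q ∈ π.white
        · simp [hw, hqi hw]
        · simp only [hw, false_or]
          omega
    · by_contra hw
      rw [h, DecPerm.Pivot, show π.perm⁻¹ i = i by rw [Equiv.Perm.inv_eq_iff_eq, hfix]] at hi
      rcases hi with hi | hi
      · exact hw hi
      · simp only [Before] at hi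
        omega
  · have hi' := hi
    rw [h, DecPerm.Pivot, not_or] at hi'
    have hfix : π.perm⁻¹ i = i := by
      by_contra hne
      rw [Fin.ext_iff] at hne
      exact hi'.2 (by simp only [Before]; omega)
    have hfix' : π.perm i = i := (Equiv.Perm.inv_eq_iff_eq.1 hfix).symm
    refine Or.inr ⟨hi, ?_, hfix', hi'.1⟩
    ext j
    rw [h, h, DecPerm.Pivot, DecPerm.Pivot, hrot]
    refine or_congr_right ?_
    by_cases hj : j = i
    · rw [hj, hfix]
      simp only [Before]
      omega
    · have hq : π.perm⁻¹ j ≠ i := by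
        rw [Ne, Equiv.Perm.inv_eq_iff_eq, hfix']
        exact hj
      rw [Fin.ext_iff] at hj
      rw [Ne, Fin.ext_iff] at hq
      simp only [Before]
      omega

/-- Combining rows maps `ℝᵏ` onto the row span. Pulling back functionals along this map is injective
and turns the coordinate functions into dot products with the columns of the matrix, so both
families have the same linear relations. -/
theorem mem_necklace_span_iff {k : ℕ} (a : Fin k → Fin n → ℝ) (r j : Fin n) :
    j ∈ necklace (Submodule.span ℝ (Set.range a)) r ↔ IsPivot (fun j i => a i j) r j := by
  set W := Submodule.span ℝ (Set.range a) with hW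
  let φ : (Fin k → ℝ) →ₗ[ℝ] W := LinearMap.codRestrict W (Fintype.linearCombination ℝ a)
    (fun c => by
      rw [Fintype.linearCombination_apply]
      exact Submodule.sum_mem _ fun i _ => Submodule.smul_mem _ _ (Submodule.subset_span ⟨i, rfl⟩))
  have hφ : Function.Surjective φ := by
    rintro ⟨x, hx⟩
    have hx' := hx
    rw [hW, ← Fintype.range_linearCombination] at hx'
    obtain ⟨c, rfl⟩ := hx'
    exact ⟨c, rfl⟩
  have hΦ : Function.Injective (LinearMap.lcomp ℝ ℝ φ) := fun f g hfg =>
    LinearMap.ext fun w => by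
      obtain ⟨c, rfl⟩ := hφ w
      exact LinearMap.congr_fun hfg c
  have hψ := (dotProductEquiv ℝ (Fin k)).injective
  have key : ∀ l, LinearMap.lcomp ℝ ℝ φ (column W l) = dotProductEquiv ℝ (Fin k) fun i => a i l := by
    intro l
    refine LinearMap.ext fun c => ?_
    change (Fintype.linearCombination ℝ a c) l = _
    rw [Fintype.linearCombination_apply]
    simp [dotProduct, mul_comm]
  have himage : LinearMap.lcomp ℝ ℝ φ '' (column W '' {l | l - r < j - r}) =
      (dotProductEquiv ℝ (Fin k)).toLinearMap '' ((fun j i => a i j) '' {l | Before r l j}) := by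
    rw [Set.image_image, Set.image_image]
    simp only [key, before_iff]
    rfl
  refine not_congr ?_
  rw [← Submodule.apply_mem_span_image_iff_mem_span hΦ, himage, key]
  exact Submodule.apply_mem_span_image_iff_mem_span
    (f := (dotProductEquiv ℝ (Fin k)).toLinearMap) hψ

theorem DecPerm.IsRealizedBy.mem_positroidCell {k : ℕ} {π : DecPerm n} {v : Fin n → Fin k → ℝ}
    (hv : π.IsRealizedBy v) :
    Submodule.span ℝ (Set.range (Matrix.of fun i j => v j i)) ∈ positroidCell k π := by
  refine ⟨⟨?_, _, rfl, fun f => ?_⟩, DecPerm.hasDecPerm_of_necklace fun r j => ?_⟩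
  · have h1 := Matrix.rank_eq_finrank_span_row (Matrix.of fun i j => v j i)
    rw [Matrix.rank_eq_finrank_span_cols] at h1
    refine h1.symm.trans ?_
    change Module.finrank ℝ (Submodule.span ℝ (Set.range v)) = k
    rw [hv.span_eq, finrank_top, Module.finrank_fin_fun]
  · exact hv.minor_nonneg f
  · exact (mem_necklace_span_iff (fun i j => v j i) r j).trans (hv.isPivot_iff r j)

theorem DecPerm.positroidCell_nonempty (π : DecPerm n) : (positroidCell π.rank π).Nonempty := by
  obtain ⟨v, hv⟩ := π.exists_isRealizedBy
  exact ⟨_, hv.mem_positroidCell⟩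

/-- A subspace has at most one decorated permutation. -/
theorem HasDecPerm.unique {V : Submodule ℝ (Fin n → ℝ)} {π π' : DecPerm n}
    (h : HasDecPerm V π) (h' : HasDecPerm V π') : π = π' := by
  -- No step around the necklace increases the size, and going around returns to the start, so all
  -- terms have equal size. Hence an added element is really new, which makes it unique.
  have hle : ∀ i, (necklace V (finRotate n i)).ncard ≤ (necklace V i).ncard := by
    intro i
    rcases h i with ⟨h1, h2, -⟩ | ⟨-, h2, -⟩
    · rw [h2]
      refine (Set.ncard_insert_le _ _).trans ?_
      rw [Set.ncard_sdiff_singleton_add_one h1]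
    · rw [h2]
  have heq : ∀ i, (necklace V (finRotate n i)).ncard = (necklace V i).ncard := by
    have := (Finset.sum_eq_sum_iff_of_le (s := Finset.univ) fun i _ => hle i).1
      (Equiv.sum_comp (finRotate n) fun i => (necklace V i).ncard)
    simpa using this
  have hperm : ∀ i, π.perm i = π'.perm i := by
    intro i
    rcases h i with ⟨h1, h2, -⟩ | ⟨h1, -, h2, -⟩ <;> rcases h' i with ⟨g1, g2, -⟩ | ⟨g1, -, g2, -⟩
    · have h3 : π.perm i ∉ necklace V i \ {i} := by
        intro hc
        have := heq i
        rw [h2, Set.insert_eq_of_mem hc] at this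
        have := Set.ncard_sdiff_singleton_add_one h1
        omega
      have h4 : π.perm i ∈ insert (π'.perm i) (necklace V i \ {i}) := by
        rw [← g2, h2]
        exact Set.mem_insert _ _
      exact (Set.mem_insert_iff.1 h4).resolve_right h3
    · exact absurd h1 g1
    · exact absurd g1 h1
    · rw [h2, g2]
  have hwhite : ∀ {π : DecPerm n}, HasDecPerm V π → ∀ i,
      i ∈ π.white ↔ π.perm i = i ∧ i ∈ necklace V i := by
    intro π h i
    constructor
    · intro hw
      refine ⟨π.white_fixed i hw, ?_⟩
      rcases h i with ⟨h1, -⟩ | ⟨-, -, -, h1⟩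
      · exact h1
      · exact absurd hw h1
    · rintro ⟨h1, h2⟩
      rcases h i with ⟨-, -, h3⟩ | ⟨h3, -⟩
      · exact h3 h1
      · exact absurd h2 h3
  refine DecPerm.ext (Equiv.ext hperm) (Set.ext fun i => ?_)
  rw [hwhite h, hwhite h', hperm]

end Cell

end BCFW


namespace BCFW

open Letter

/-! ### The bijections -/

theorem sum_range_skip {n c : ℕ} (hc : c ≤ n) (g : ℕ → ℕ) :
    ∑ u ∈ Finset.range (n + 1), g u = g c + ∑ s ∈ Finset.range n, g (skip c s) := by
  rw [← Fin.sum_univ_eq_sum_range, ← Fin.sum_univ_eq_sum_range (fun s => g (skip c s)),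
    Fin.sum_univ_succAbove _ ⟨c, Nat.lt_succ_of_le hc⟩]
  congr 1
  refine Finset.sum_congr rfl fun s _ => congrArg g ?_
  simp only [Fin.succAbove, skip, Fin.lt_def]
  split_ifs <;> simp_all

/-- Inserting a fixed point creates no descent below the diagonal, and a south step creates exactly
one, at the new last label. -/
theorem PathPair.sum_lt {U L : List Letter} {b : ℕ} {σ : ℕ → ℕ} {S : StrandState}
    (h : PathPair U L b σ S) :
    ∑ s ∈ Finset.range (L.length + 4), (if σ s < s then 1 else 0) = L.count V := by
  induction h with
  | nil => simp
  | @black U L b σ S h ih =>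
    have hb := h.bound_le
    rw [List.length_append, List.length_singleton, show L.length + 1 + 4 = L.length + 4 + 1 by omega,
      sum_range_skip (c := b) (by omega), insertFixed_self, if_neg (lt_irrefl b), zero_add]
    simp only [insertFixed_skip, (skip_strictMono b).lt_iff_lt]
    rw [ih]
    simp
  | @white U w t b σ S h ih =>
    have hb := h.bound_le_of_append
    have hl := h.perm_last
    have hp := h.le_perm_or
    have e1 : (w ++ List.replicate t H).length = w.length + t := by simp
    have e2 : (w ++ V :: List.replicate t H).length + 4 = w.length + t + 4 + 1 := by simp; omega
    have e3 : (w ++ V :: List.replicate t H).count V = (w ++ List.replicate t H).count V + 1 := by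
      simp [List.count_replicate]
    rw [e1] at ih hl hp
    rw [e2, e3, ← ih, sum_range_skip (c := w.length + 3) (by omega),
      show w.length + t + 4 = w.length + t + 3 + 1 by omega, Finset.sum_range_succ _ (w.length + t + 3),
      Finset.sum_range_succ _ (w.length + t + 3), addRow_add_three (by omega)]
    -- Arguments and values are relabelled by different skips; by `le_perm_or` no value lies where
    -- this could reverse the comparison.
    have e4 : ∀ s ∈ Finset.range (w.length + t + 3),
        (if addRow w.length (w.length + t + 3 + 1) σ (skip (w.length + 3) s) < skip (w.length + 3) s
          then 1 else 0) = if σ s < s then 1 else 0 := by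
      intro s hs
      rw [Finset.mem_range] at hs
      rw [addRow_skip (by omega)]
      refine if_congr ?_ rfl rfl
      have := hp s (by omega)
      simp only [skip]
      split_ifs <;> omega
    rw [Finset.sum_congr rfl e4, skip_of_le (c := w.length + 3) (by omega), addRow_last (by omega),
      if_pos (show w.length < w.length + t + 3 + 1 by omega), Nat.add_sub_cancel]
    have e5 : skip w.length (σ (w.length + t + 3)) < w.length + 3 ↔
        σ (w.length + t + 3) < w.length + t + 3 := by
      rcases hl with ⟨-, -, h1⟩ | ⟨-, h1⟩
      · rw [h1, skip_of_le (by omega)]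
        omega
      · rw [skip_of_lt (by omega)]
        omega
    simp only [e5]
    ring

theorem PathPair.rank_eq {U L : List Letter} {b : ℕ} {σ : ℕ → ℕ} {S : StrandState}
    (h : PathPair U L b σ S) {n : ℕ} (hn : L.length + 4 = n) {π : DecPerm n} (hw : π.white = ∅)
    (hσ : ∀ s : Fin n, (π.perm s : ℕ) = σ s) : π.rank = L.count V := by
  classical
  rw [← h.sum_lt, hn, ← Fin.sum_univ_eq_sum_range (fun s => if σ s < s then 1 else 0), DecPerm.rank]
  refine Finset.sum_congr rfl fun s _ => if_congr ?_ rfl rfl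
  rw [hw, Fin.lt_def, hσ]
  simp

theorem LatticePath.ext_word {a b : ℕ} {U U' : LatticePath a b} (h : U.word = U'.word) : U = U' := by
  cases U
  cases U'
  congr

theorem LatticePath.length_word {a b : ℕ} (U : LatticePath a b) : U.word.length = a + b := by
  rw [length_eq_count, U.count_V, U.count_H]

theorem Noncrossing.exists_pathPair {a b : ℕ} {U L : LatticePath a b} (h : Noncrossing U L) :
    ∃ b σ S, PathPair U.word L.word b σ S :=
  PathPair.exists_of_noncrossing _ _ (by rw [U.length_word, L.length_word])
    (by rw [U.count_V, L.count_V]) fun i hi => h i (by rwa [L.length_word] at hi)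

section Bijection

variable {k n : ℕ} (hkn : k + 4 ≤ n)

theorem mapsTo_decPerm :
    Set.MapsTo OplusDiagram.decPerm (latticeDiagrams hkn) (bcfwPerms k n) := by
  rintro _ ⟨U, L, h, rfl⟩
  obtain ⟨b, σ, S, hp⟩ := h.exists_pathPair
  obtain ⟨h1, h2⟩ := hp.decPerm hkn
  exact mem_bcfwPerms_iff.2 ⟨_, _, b, σ, S, hp, by rw [L.length_word]; omega, L.count_V, h1, h2⟩

theorem injOn_decPerm : Set.InjOn OplusDiagram.decPerm (latticeDiagrams hkn) := by
  rintro _ ⟨U, L, h, rfl⟩ _ ⟨U', L', h', rfl⟩ he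
  obtain ⟨b, σ, S, hp⟩ := h.exists_pathPair
  obtain ⟨b', σ', S', hp'⟩ := h'.exists_pathPair
  have hl := L.length_word
  obtain ⟨h1, h2⟩ := hp.paths_eq hp' (by rw [L.length_word, L'.length_word])
    (by rw [L.count_V, L'.count_V]) fun s hs => by
      rw [← (hp.decPerm hkn).2 ⟨s, by omega⟩, ← (hp'.decPerm hkn).2 ⟨s, by omega⟩, he]
  rw [LatticePath.ext_word h1, LatticePath.ext_word h2]

theorem surjOn_decPerm :
    Set.SurjOn OplusDiagram.decPerm (latticeDiagrams hkn) (bcfwPerms k n) := by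
  intro π hπ
  obtain ⟨U, L, b, σ, S, hp, hn, hk, hw, hσ⟩ := mem_bcfwPerms_iff.1 hπ
  have h1 := length_eq_count L
  have h2 := length_eq_count U
  have h3 := hp.length_eq
  have h4 := hp.count_eq
  obtain ⟨g1, g2⟩ := PathPair.decPerm hkn (U := ⟨U, by omega, by omega⟩)
    (L := ⟨L, by omega, by omega⟩) hp
  refine ⟨_, ⟨⟨U, by omega, by omega⟩, ⟨L, by omega, by omega⟩, fun i _ => hp.noncrossing i, rfl⟩,
    DecPerm.ext (Equiv.ext fun s => Fin.ext ?_) (g1.trans hw.symm)⟩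
  rw [g2, hσ]

theorem positroidCell_nonempty {π : DecPerm n} (hπ : π ∈ bcfwPerms k n) :
    (positroidCell k π).Nonempty := by
  obtain ⟨U, L, b, σ, S, hp, hn, hk, hw, hσ⟩ := mem_bcfwPerms_iff.1 hπ
  rw [← hk, ← hp.rank_eq hn hw hσ]
  exact π.positroidCell_nonempty

/-- Equal cells share a point because they are nonempty, and this point has only one decorated
permutation. -/
theorem injOn_cell : Set.InjOn OplusDiagram.cell (latticeDiagrams hkn) := by
  intro D hD D' hD' he
  obtain ⟨V, hV⟩ := positroidCell_nonempty (mapsTo_decPerm hkn hD)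
  have hV' : V ∈ D'.cell := he ▸ hV
  exact injOn_decPerm hkn hD hD' (hV.2.unique hV'.2)

end Bijection

end BCFW

theorem mainTheorem2 (k n : ℕ) (hkn : k + 4 ≤ n) :
    Set.BijOn BCFW.OplusDiagram.cell (BCFW.latticeDiagrams hkn) (BCFW.bcfwCells k n) ∧
      Set.BijOn BCFW.OplusDiagram.decPerm (BCFW.latticeDiagrams hkn) (BCFW.bcfwPerms k n) := by
  have hm := BCFW.mapsTo_decPerm hkn
  have hs := BCFW.surjOn_decPerm hkn
  refine ⟨⟨fun D hD => ⟨_, hm hD, rfl⟩, BCFW.injOn_cell hkn, ?_⟩, hm, BCFW.injOn_decPerm hkn, hs⟩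
  rintro _ ⟨π, hπ, rfl⟩
  obtain ⟨D, hD, rfl⟩ := hs hπ
  exact ⟨D, hD, rfl⟩
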